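/- **Setting.** Let $K\ge 1$ and $F\ge 0$. An $F$-carrier parallel many-to-one interference channel with users $1,\dots,K$ consists, for each carrier $k=1,\dots,F$, of standard Borel alphabets $\mathcal X_i^{(k)}\neq\emptyset$, $\mathcal Y_i^{(k)}$ ($1\le i\le K$), $\mathcal V^{(k)}$ (so finite, countable and Euclidean alphabets are included) and of the following data: for $i\ge2$ the output $Y_i^{(k)}$ is generated from $X_i^{(k)}$ by a transition kernel $p_{Y_i^{(k)}|X_i^{(k)}}$, and $Y_2^{(k)},\dots,Y_K^{(k)}$ are conditionally independent given the inputs; an interference variable $V^{(k)}$ is generated by a kernel $p_{V^{(k)}|X_2^{(k)},\dots,X_K^{(k)}}$ (with an arbitrary dependence between $V^{(k)}$ and $(Y_2^{(k)},\dots,Y_K^{(k)})$ given the inputs); and $Y_1^{(k)}=f_1^{(k)}(X_1^{(k)},V^{(k)})$ with $f_1^{(k)}$ measurable and $V^{(k)}$ a function of $(Y_1^{(k)},X_1^{(k)})$. Given the inputs, different carriers and different channel uses are independent. *Noisy interference condition.* For each $k$, $V^{(k)}$ is a stochastically degraded version of $(Y_2^{(k)},\dots,Y_K^{(k)})$: there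 is a Markov kernel $D^{(k)}$ such that $p_{V^{(k)}|X_2^{(k)},\dots,X_K^{(k)}}$ is the composition of $\prod_{i\ge2}p_{Y_i^{(k)}|X_i^{(k)}}$ with $D^{(k)}$. *Codes and constraints.* A code of length $T\ge1$ has independent uniform messages $W_i\in\mathcal W_i$ ($\mathcal W_i$ finite and nonempty), encoders $\mathcal W_i\to\big(\prod_k\mathcal X_i^{(k)}\big)^T$ and measurable decoders $\big(\prod_k\mathcal Y_i^{(k)}\big)^T\to\mathcal W_i$; its rates are $R_i=\frac1T\log|\mathcal W_i|$ (natural logarithms throughout), and its error probability is the probability that some $W_i$ is decoded wrongly. Codebooks may be constrained: given measurable costs $b_i^{(k)}:\mathcal X_i^{(k)}\to[0,\infty]$ and sets $\mathcal Q_i\subseteq[0,\infty]^F$ that are closed under decreasing coordinates, the vector $\big(E\big[\frac1T\sum_\tau b_i^{(k)}(X_i^{(k)}(\tau))\big]\big)_{k}$ has to lie in $\mathcal Q_i$ for every $i$ (for instance, a bound on the total average power or on the average power per carrier; $\mathcal Q_i=[0,\infty]^F$ for all $i$ means no constraint). A rate tuple is achievable if there is a sequence of codes satisfying the constraint, all of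 exactly these rates, with error probability tending to $0$; $C_\Sigma\in[0,\infty]$ is the supremum of $\sum_iR_i$ over the closure of the set of achievable tuples. *Separate random coding, treating interference as noise.* Let $N\ge1$ and let $p=(p_{s,i}^{(k)})$ be probability laws on the $\mathcal X_i^{(k)}$, for time slots $s=1,\dots,N$. Write $I_p(X_i^{(k)};Y_i^{(k)})$ for the mutual information on carrier $k$ averaged over the $N$ slots, where in slot $s$ the inputs $X_j^{(k)}\sim p_{s,j}^{(k)}$ are independent. Call $p$ feasible if for every $i$ the vector over $k$ of the expected costs averaged over the slots lies in $\mathcal Q_i$. Given rates $r_i^{(k)}\ge0$, user $i$ has for each carrier $k$ a separate random codebook of $\lceil e^{Tr_i^{(k)}}\rceil$ words of length $T$, with all symbols of all codebooks independent and with laws $p_{s,i}^{(k)}$ used periodically in time, and a separate message on each carrier; the decoder of user $i$ for carrier $k$ uses only the output $Y_i^{(k)T}$ and user $i$'s codebook on carrier $k$ (and the channel and $p$). The scheme is reliable if, for suitable measurable decoding rules, the error probability averaged over the random codebooks tends to $0$ as $T\to\infty$. **Corollary (separability).** Assume that every carrier satisfies the noisy interference condition. Then: 1. $C_\Sigma=\sup_{N}\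 \sup_{p\text{ feasible}}\ \sum_{k=1}^F\sum_{i=1}^K I_p(X_i^{(k)};Y_i^{(k)})$. 2. For all $p$ and all rates with $r_i^{(k)}=0$ or $r_i^{(k)}<I_p(X_i^{(k)};Y_i^{(k)})$ for every $i,k$, separate random coding with interference treated as noise is reliable. 3. Separate random coding with interference treated as noise achieves sum-capacity: for every $R<C_\Sigma$ there are $N$, a feasible $p$ and rates with $\sum_{k,i}r_i^{(k)}>R$ for which the scheme is reliable and the random codebooks satisfy the constraint with probability tending to $1$. 4. Independence across carriers is optimal: if the vector inputs $\vec X_1,\dots,\vec X_K$, $\vec X_i=(X_i^{(1)},\dots,X_i^{(F)})$, are independent with arbitrary laws, then $\sum_iI(\vec X_i;\vec Y_i)\le\sum_k\sum_iI(X_i^{(k)};Y_i^{(k)})$, where the right side is evaluated for inputs with the same laws on each carrier (all $X_i^{(k)}$ independent). 5. If there is no constraint, then 1 and 3 hold with a single slot, $N=1$; in particular $$C_\Sigma=\sup\sum_{k=1}^F\sum_{i=1}^KI(X_i^{(k)};Y_i^{(k)}),$$ the supremum being over all product laws $\prod_{i,k}p_{X_i^{(k)}}$. If moreover all input alphabets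 are finite, then the supremum is attained, so that $C_\Sigma=\sum_k\sum_iI(X_i^{(k)};Y_i^{(k)})$ for an optimal input distribution that is independent across users and carriers. -/

import Mathlib

open MeasureTheory ProbabilityTheory Filter Topology
open scoped ENNReal NNReal

noncomputable section

namespace ParallelIC

/-! ### Mutual information and memoryless interference channels -/

/-- The mutual information (in nats) of a pair of random variables with joint law `ρ`. -/
def mutualInfo {α β : Type*} [MeasurableSpace α] [MeasurableSpace β]
    (ρ : Measure (α × β)) : ℝ≥0∞ :=
  InformationTheory.klDiv ρ (ρ.fst.prod ρ.snd)

section Channel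

variable {ι : Type*} [Fintype ι] {X Y : ι → Type*}
  [∀ i, MeasurableSpace (X i)] [∀ i, MeasurableSpace (Y i)]

/-- `I(X_i; Y_i)` for the interference channel `W` with users `ι` (a kernel from the tuple of all
inputs to the tuple of all outputs), when the inputs are independent across users, `X_j ∼ p j`.
All signals of the other users are averaged out, that is, interference is treated as noise. -/
def userInfo (W : Kernel (∀ i, X i) (∀ i, Y i)) (p : ∀ i, ProbabilityMeasure (X i)) (i : ι) :
    ℝ≥0∞ :=
  mutualInfo (((Measure.pi fun j => (p j : Measure (X j))) ⊗ₘ W).map fun z => (z.1 i, z.2 i))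

/-- The law of the outputs during `T` uses of the memoryless channel `W`, given the inputs. -/
def blockLaw (W : Kernel (∀ i, X i) (∀ i, Y i)) {T : ℕ} (x : Fin T → ∀ i, X i) :
    Measure (Fin T → ∀ i, Y i) :=
  Measure.pi fun τ => W (x τ)

/-- The average probability of error of encoders `enc` and decoders `dec`: the probability, for
independent and uniformly distributed messages, that some receiver decodes its message wrongly. -/
def errorProb (W : Kernel (∀ i, X i) (∀ i, Y i)) {T : ℕ} {M : ι → Type*} [∀ i, Fintype (M i)]
    [DecidableEq ι]
    (enc : ∀ i, M i → Fin T → X i) (dec : ∀ i, (Fin T → Y i) → M i) : ℝ≥0∞ :=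
  (Fintype.card (∀ i, M i) : ℝ≥0∞)⁻¹ *
    ∑ w : ∀ i, M i, blockLaw W (fun τ i => enc i (w i) τ)
      {y | ∃ i, dec i (fun τ => y τ i) ≠ w i}

/-- A code of length `T` for an interference channel with inputs `X` and outputs `Y`. -/
structure Code (X Y : ι → Type*) [∀ i, MeasurableSpace (Y i)] (T : ℕ) where
  /-- the number of messages of each user -/
  numMsg : ι → ℕ
  numMsg_pos : ∀ i, 0 < numMsg i
  enc : ∀ i, Fin (numMsg i) → Fin T → X i
  dec : ∀ i, (Fin T → Y i) → Fin (numMsg i)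
  measurable_dec : ∀ i, Measurable (dec i)

/-- The rate (in nats per channel use) of user `i`. -/
def Code.rate {T : ℕ} (c : Code X Y T) (i : ι) : ℝ :=
  Real.log (c.numMsg i) / T

end Channel

/-! ### Many-to-one interference channels -/

/-- A discrete memoryless many-to-one interference channel with the `m + 1` users
`0, 1, …, m`, in which only receiver `0` faces interference: the output of receiver `j + 1` is
generated from the input of transmitter `j + 1` by `direct j`, and the output of receiver `0` is
`f X₀ V`, where `V` is generated from the inputs of the transmitters `1, …, m` and can be recovered
from the output and the input of user `0`.  The kernel `joint` is the joint law of `V` and the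
outputs of the receivers `1, …, m`; these outputs are conditionally independent given the inputs,
but `V` may depend on them in any way. -/
structure ManyToOne {m : ℕ} (X Y : Fin (m + 1) → Type*) (V : Type*)
    [∀ i, MeasurableSpace (X i)] [∀ i, MeasurableSpace (Y i)] [MeasurableSpace V] where
  direct : ∀ j : Fin m, Kernel (X j.succ) (Y j.succ)
  joint : Kernel (∀ j : Fin m, X j.succ) (V × ∀ j : Fin m, Y j.succ)
  markov_direct : ∀ j, IsMarkovKernel (direct j)
  markov_joint : IsMarkovKernel joint
  joint_snd : ∀ x, (joint x).map Prod.snd = Measure.pi fun j => direct j (x j)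
  f : X 0 → V → Y 0
  measurable_f : Measurable (Function.uncurry f)
  /-- the interference as a function of the output and the input of user `0` -/
  inv : Y 0 → X 0 → V
  inv_f : ∀ x v, inv (f x v) x = v

namespace ManyToOne

variable {m : ℕ} {X Y : Fin (m + 1) → Type*} {V : Type*}
  [∀ i, MeasurableSpace (X i)] [∀ i, MeasurableSpace (Y i)] [MeasurableSpace V]

/-- The tuple of all outputs, as a function of the input of user `0`, of the interference and of the
outputs of the other users. -/
def assemble (C : ManyToOne X Y V) (z : X 0 × (V × ∀ j : Fin m, Y j.succ)) : ∀ i, Y i :=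
  Fin.cons (C.f z.1 z.2.1) z.2.2

theorem measurable_assemble (C : ManyToOne X Y V) : Measurable C.assemble := by
  refine measurable_pi_iff.2 fun i => ?_
  refine Fin.cases ?_ (fun j => ?_) i
  · exact C.measurable_f.comp (measurable_fst.prodMk (measurable_fst.comp measurable_snd))
  · exact (measurable_pi_apply j).comp (measurable_snd.comp measurable_snd)

/-- The channel as a kernel from all inputs to all outputs. -/
def kernel (C : ManyToOne X Y V) : Kernel (∀ i, X i) (∀ i, Y i) where
  toFun x := (C.joint fun j => x j.succ).map fun vy => C.assemble (x 0, vy)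
  measurable' := by
    have := C.markov_joint
    have h0 : Measurable fun x : ∀ i, X i => x 0 := measurable_pi_apply 0
    have h1 : Measurable fun (x : ∀ i, X i) (j : Fin m) => x j.succ :=
      measurable_pi_iff.2 fun j => measurable_pi_apply _
    have key : (fun x : ∀ i, X i =>
        (C.joint fun j => x j.succ).map fun vy => C.assemble (x 0, vy)) =
        fun x => ((Kernel.deterministic _ h0 ×ₖ C.joint.comap _ h1).map C.assemble) x := by
      funext x
      rw [Kernel.map_apply _ C.measurable_assemble, Kernel.prod_apply,
        Kernel.deterministic_apply, Kernel.comap_apply, Measure.dirac_prod,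
        Measure.map_map C.measurable_assemble measurable_prodMk_left]
      rfl
    rw [key]
    exact Kernel.measurable _

instance (C : ManyToOne X Y V) : IsMarkovKernel C.kernel := by
  have := C.markov_joint
  refine ⟨fun x => ?_⟩
  exact Measure.isProbabilityMeasure_map
    (C.measurable_assemble.comp measurable_prodMk_left).aemeasurable

/-- The noisy interference condition: the interference is a stochastically degraded version of the
outputs of the receivers that face no interference, with respect to the inputs of their
transmitters. -/
def Degraded (C : ManyToOne X Y V) : Prop :=
  ∃ D : Kernel (∀ j : Fin m, Y j.succ) V, IsMarkovKernel D ∧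
    C.joint.map Prod.fst = D ∘ₖ C.joint.map Prod.snd

end ManyToOne

/-! ### Parallel channels -/

section Parallel

variable {ι : Type*} [Fintype ι] {κ : Type*} [Fintype κ] {X Y : ι → κ → Type*}
  [∀ i k, MeasurableSpace (X i k)] [∀ i k, MeasurableSpace (Y i k)]

/-- The parallel channel with carriers `κ`: given the (vector) inputs, the outputs on the carriers
are independent, and those on carrier `k` are generated from the inputs on carrier `k` by `W k`. -/
def parallel (W : ∀ k, Kernel (∀ i, X i k) (∀ i, Y i k)) [∀ k, IsMarkovKernel (W k)] :
    Kernel (∀ i, ∀ k, X i k) (∀ i, ∀ k, Y i k) where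
  toFun x := (Measure.pi fun k => W k fun i => x i k).map fun y i k => y k i
  measurable' := by
    have h : Measurable fun x : ∀ i, ∀ k, X i k => Measure.pi fun k => W k fun i => x i k := by
      refine Measurable.measure_of_isPiSystem_of_isProbabilityMeasure
        generateFrom_pi.symm isPiSystem_pi ?_
      rintro s ⟨t, ht, rfl⟩
      simp only [Measure.pi_pi]
      refine Finset.measurable_prod _ fun k _ => ?_
      exact (Kernel.measurable_coe (W k) (ht k (Set.mem_univ k))).comp
        (measurable_pi_iff.2 fun i => (measurable_pi_apply k).comp (measurable_pi_apply i))
    refine (Measure.measurable_map _ ?_).comp h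
    exact measurable_pi_iff.2 fun i => measurable_pi_iff.2 fun k =>
      (measurable_pi_apply i).comp (measurable_pi_apply k)

/-- A constraint on the codebooks: each input symbol on each carrier has a cost, and for user `i`
the vector of the average costs on the carriers has to lie in `region i`, where lowering the costs
is always allowed (for example: the sum over the carriers of the average powers is at most `P i`, or
the average power on carrier `k` is at most `P i k`, or no constraint at all). -/
structure CostConstraint (X : ι → κ → Type*) [∀ i k, MeasurableSpace (X i k)] where
  cost : ∀ i k, X i k → ℝ≥0∞
  measurable_cost : ∀ i k, Measurable (cost i k)
  region : ι → Set (κ → ℝ≥0∞)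
  isLowerSet_region : ∀ i, IsLowerSet (region i)

namespace CostConstraint

/-- The vector of the costs on the carriers of a codebook of user `i`, averaged over the (uniformly
distributed) message and over time. -/
def codebookCost (Q : CostConstraint X) (i : ι) {M : Type*} [Fintype M] {T : ℕ}
    (c : M → Fin T → ∀ k, X i k) (k : κ) : ℝ≥0∞ :=
  ((Fintype.card M : ℝ≥0∞) * T)⁻¹ * ∑ w, ∑ τ, Q.cost i k (c w τ k)

/-- `p s i k` is the law of the input of user `i` on carrier `k` in time slot `s`, where the slots
`0, …, N` are used equally often.  Such input laws are feasible if their expected costs, averaged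
over the time slots, satisfy the constraint. -/
def Feasible (Q : CostConstraint X) {N : ℕ}
    (p : Fin (N + 1) → ∀ i k, ProbabilityMeasure (X i k)) : Prop :=
  ∀ i, (fun k => ((N + 1 : ℕ) : ℝ≥0∞)⁻¹ * ∑ s, ∫⁻ x, Q.cost i k x ∂(p s i k : Measure (X i k)))
    ∈ Q.region i

end CostConstraint

variable [DecidableEq ι] [DecidableEq κ]

/-- A rate tuple is achievable for the parallel channel under the constraint `Q` if there is a
sequence of codes of exactly these rates, with codebooks that satisfy the constraint, whose average
probability of error tends to zero. -/
def Achievable (W : ∀ k, Kernel (∀ i, X i k) (∀ i, Y i k)) [∀ k, IsMarkovKernel (W k)]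
    (Q : CostConstraint X) (R : ι → ℝ) : Prop :=
  ∃ (T : ℕ → ℕ) (c : ∀ n, Code (fun i => ∀ k, X i k) (fun i => ∀ k, Y i k) (T n)),
    (∀ n, 0 < T n) ∧ (∀ n i, (c n).rate i = R i) ∧
    (∀ n i, Q.codebookCost i ((c n).enc i) ∈ Q.region i) ∧
    Tendsto (fun n => errorProb (parallel W) (c n).enc (c n).dec) atTop (𝓝 0)

/-- The sum-capacity: the supremum of the sum-rates over the capacity region, which is the closure
of the set of the achievable rate tuples. -/
def sumCapacity (W : ∀ k, Kernel (∀ i, X i k) (∀ i, Y i k)) [∀ k, IsMarkovKernel (W k)]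
    (Q : CostConstraint X) : ℝ≥0∞ :=
  ⨆ R ∈ closure {R : ι → ℝ | Achievable W Q R}, ENNReal.ofReal (∑ i, R i)

/-- The mutual information `I(X_i; Y_i)` on carrier `k`, averaged over the time slots, for input
laws `p` under which all inputs are independent across users, carriers and time. -/
def carrierInfo (W : ∀ k, Kernel (∀ i, X i k) (∀ i, Y i k)) {N : ℕ}
    (p : Fin (N + 1) → ∀ i k, ProbabilityMeasure (X i k)) (i : ι) (k : κ) : ℝ≥0∞ :=
  ((N + 1 : ℕ) : ℝ≥0∞)⁻¹ * ∑ s, userInfo (W k) (fun j => p s j k) i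

/-! ### Separate random coding, treating interference as noise -/

/-- The number of messages in a code of length `T` and of rate (at least) `r`. -/
def msgCount (T : ℕ) (r : ℝ≥0) : ℕ := ⌈Real.exp (T * r)⌉₊

/-- Codebooks of length `T`, one for each user and each carrier, of the rates `r i k`. -/
abbrev Codebooks (X : ι → κ → Type*) (r : ι → κ → ℝ≥0) (T : ℕ) : Type _ :=
  ∀ i k, Fin (msgCount T (r i k)) → Fin T → X i k

/-- Decoding rules for separate coding with interference treated as noise: the decoder of user `i`
for carrier `k` sees only the output of receiver `i` on this carrier, and knows, besides the input
laws and the channel, only the codebook of user `i` on this carrier. -/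
abbrev TINDecoders (X Y : ι → κ → Type*) (r : ι → κ → ℝ≥0) (T : ℕ) : Type _ :=
  ∀ i k, (Fin (msgCount T (r i k)) → Fin T → X i k) → (Fin T → Y i k) →
    Fin (msgCount T (r i k))

/-- The law of the random codebooks: all symbols of all codewords are independent, and symbol `τ` of
a codeword of user `i` on carrier `k` has the law `p s i k` with `s = τ` modulo `N + 1`. -/
def randomCodebooks {N : ℕ} (p : Fin (N + 1) → ∀ i k, ProbabilityMeasure (X i k))
    (r : ι → κ → ℝ≥0) (T : ℕ) : Measure (Codebooks X r T) :=
  Measure.pi fun i => Measure.pi fun k => Measure.pi fun _ => Measure.pi fun τ : Fin T =>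
    (p (Fin.ofNat (N + 1) τ) i k : Measure (X i k))

/-- The encoders of separate coding: the message of user `i` is a tuple of messages, one for each
carrier, and each of them is encoded with the codebook of its carrier. -/
def separateEnc {r : ι → κ → ℝ≥0} {T : ℕ} (c : Codebooks X r T) (i : ι)
    (w : ∀ k, Fin (msgCount T (r i k))) (τ : Fin T) (k : κ) : X i k :=
  c i k (w k) τ

/-- The decoders of separate coding with interference treated as noise. -/
def separateDec {r : ι → κ → ℝ≥0} {T : ℕ} (δ : TINDecoders X Y r T) (c : Codebooks X r T) (i : ι)
    (y : Fin T → ∀ k, Y i k) (k : κ) : Fin (msgCount T (r i k)) :=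
  δ i k (c i k) fun τ => y τ k

/-- Separate random coding from the input laws `p` at the rates `r i k`, with interference treated
as noise, is reliable: for suitable decoding rules, the probability of error, averaged over the
random codebooks, tends to zero. -/
def ReliableTIN (W : ∀ k, Kernel (∀ i, X i k) (∀ i, Y i k)) [∀ k, IsMarkovKernel (W k)] {N : ℕ}
    (p : Fin (N + 1) → ∀ i k, ProbabilityMeasure (X i k)) (r : ι → κ → ℝ≥0) : Prop :=
  ∃ δ : ∀ T, TINDecoders X Y r T,
    (∀ T i k, Measurable (Function.uncurry (δ T i k))) ∧
    Tendsto (fun T => ∫⁻ c, errorProb (parallel W) (separateEnc c) (separateDec (δ T) c)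
      ∂(randomCodebooks p r T)) atTop (𝓝 0)

/-- The random codebooks satisfy the constraint with probability tending to one. -/
def MeetsConstraint (Q : CostConstraint X) {N : ℕ}
    (p : Fin (N + 1) → ∀ i k, ProbabilityMeasure (X i k)) (r : ι → κ → ℝ≥0) : Prop :=
  Tendsto (fun T => randomCodebooks p r T
    {c | ¬ ∀ i, Q.codebookCost i (separateEnc c i) ∈ Q.region i}) atTop (𝓝 0)

end Parallel

/-- The law of the component on carrier `k` of a vector input. -/
def carrierMarginal {κ : Type*} {X : κ → Type*} [∀ k, MeasurableSpace (X k)]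
    (q : ProbabilityMeasure (∀ k, X k)) (k : κ) : ProbabilityMeasure (X k) :=
  q.map (measurable_pi_apply k).aemeasurable

end ParallelIC

end

open ParallelIC

noncomputable section

namespace ParallelIC

open InformationTheory

set_option linter.unusedSectionVars false

/-! ### Finite products of measures and of kernels -/

section Pi

variable {ι : Type*} [Fintype ι] {A B : ι → Type*}
  [∀ i, MeasurableSpace (A i)] [∀ i, MeasurableSpace (B i)]

-- The converse rests on one quantity, the total correlation TC(P), the divergence of a law on a
-- product over carriers from the product of its marginals. For a channel `U` from vector inputs to
-- vector outputs whose k-th output marginal given x depends only on x_k, computing D(P_XY ‖ P_X × ∏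
-- P_{Y_k}) in two ways gives I(X; Y) + TC(Y) ≤ sup_x TC(U(x)) + ∑_k I(X_k; Y_k)
-- (`mutualInfo_add_totalCorr_le`). A receiver without interference has TC(U(x)) = 0, so correlating
-- its inputs across carriers costs it TC(Y_j). Receiver 0 may gain, but at most TC(V), since given
-- its input its output is a carrierwise function of V. The noisy interference condition bounds this
-- gain by the losses: V is distributed as carrierwise processing of the other outputs, which are
-- independent across users, so data processing yields TC(V) ≤ ∑_j TC(Y_j)
-- (`totalCorr_interference_le`). Adding up and cancelling gives `sum_userInfo_parallel_le`. Only
-- divergences occur, no entropies, so general alphabets cause no trouble.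
--
-- A code of length T is one use of a parallel channel whose carriers are the pairs (time, carrier).
-- The same inequality therefore single-letterizes over time as well, and the symbol laws of the
-- code become feasible time-slotted input laws. Fano's inequality, obtained from the
-- Donsker-Varadhan bound with a multiple of an indicator as test function, then yields the upper
-- bound (`sumCapacity_le`).
--
-- For achievability, each user and carrier is a point-to-point channel after averaging over the
-- other users' random codebooks (`lintegral_user_error`). The decoder compares with a threshold the
-- sum of a bounded metric g, with ∫ e^g ≤ 1 under the product law and mean close to the mutual
-- information under the joint law; such g exist by the converse half of Donsker-Varadhan, even for
-- infinite information. Chebyshev controls the true codeword, and Markov's inequality for e^{∑ g}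
-- the wrong ones (`random_coding`).
--
-- Cost constraints are met by creating slack: one slot with a cheap deterministic symbol is added
-- to many repetitions of the given slots, at a vanishing loss of rate (`exists_slack`), and a
-- truncated law of large numbers handles the random codebooks. Exact rates are obtained from
-- multiples of (log 2)/b at block lengths divisible by b.
--
-- Without a constraint, an average over slots is at most the supremum over single slots. For finite
-- input alphabets the objective is continuous on a compact product of simplices, hence attains its
-- maximum.

theorem lintegral_pi_prod (μ : ∀ i, Measure (A i)) [∀ i, IsProbabilityMeasure (μ i)]
    {f : ∀ i, A i → ℝ≥0∞} (hf : ∀ i, Measurable (f i)) :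
    ∫⁻ x, ∏ i, f i (x i) ∂(Measure.pi μ) = ∏ i, ∫⁻ a, f i a ∂(μ i) := by
  have h := lintegral_prod_eq_prod_lintegral_of_indepFun (μ := Measure.pi μ) Finset.univ
    (fun i x => f i (x i)) (iIndepFun_pi fun i => (hf i).aemeasurable)
    (fun i => (hf i).comp (measurable_pi_apply i))
  rw [h]
  refine Finset.prod_congr rfl fun i _ => ?_
  exact (measurePreserving_eval μ i).lintegral_comp (hf i)

/-- The product of finitely many Markov kernels. -/
def piKernel (κ : ∀ i, Kernel (A i) (B i)) [∀ i, IsMarkovKernel (κ i)] :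
    Kernel (∀ i, A i) (∀ i, B i) where
  toFun x := Measure.pi fun i => κ i (x i)
  measurable' := by
    refine Measurable.measure_of_isPiSystem_of_isProbabilityMeasure
      generateFrom_pi.symm isPiSystem_pi ?_
    rintro s ⟨t, ht, rfl⟩
    simp only [Measure.pi_pi]
    refine Finset.measurable_prod _ fun i _ => ?_
    exact (Kernel.measurable_coe (κ i) (ht i (Set.mem_univ i))).comp (measurable_pi_apply i)

theorem piKernel_apply (κ : ∀ i, Kernel (A i) (B i)) [∀ i, IsMarkovKernel (κ i)] (x : ∀ i, A i) :
    piKernel κ x = Measure.pi fun i => κ i (x i) := rfl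

instance (κ : ∀ i, Kernel (A i) (B i)) [∀ i, IsMarkovKernel (κ i)] :
    IsMarkovKernel (piKernel κ) :=
  ⟨fun x => by rw [piKernel_apply]; infer_instance⟩

theorem piKernel_comp_pi (κ : ∀ i, Kernel (A i) (B i)) [∀ i, IsMarkovKernel (κ i)]
    (μ : ∀ i, Measure (A i)) [∀ i, IsProbabilityMeasure (μ i)] :
    piKernel κ ∘ₘ Measure.pi μ = Measure.pi fun i => κ i ∘ₘ μ i := by
  refine (Measure.pi_eq fun s hs => ?_).symm
  rw [Measure.bind_apply (MeasurableSet.univ_pi hs) (Kernel.aemeasurable _)]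
  simp only [piKernel_apply, Measure.pi_pi]
  rw [lintegral_pi_prod μ fun i => Kernel.measurable_coe (κ i) (hs i)]
  refine Finset.prod_congr rfl fun i _ => ?_
  rw [Measure.bind_apply (hs i) (Kernel.aemeasurable _)]

theorem pi_compProd_piKernel (κ : ∀ i, Kernel (A i) (B i)) [∀ i, IsMarkovKernel (κ i)]
    (μ : ∀ i, Measure (A i)) [∀ i, IsProbabilityMeasure (μ i)] :
    (Measure.pi μ ⊗ₘ piKernel κ).map (fun z i => (z.1 i, z.2 i)) =
      Measure.pi fun i => μ i ⊗ₘ κ i := by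
  have hm : ∀ i, Measurable fun z : (∀ i, A i) × (∀ i, B i) => (z.1 i, z.2 i) := fun i =>
    ((measurable_pi_apply i).comp measurable_fst).prodMk
      ((measurable_pi_apply i).comp measurable_snd)
  refine (Measure.pi_eq fun s hs => ?_).symm
  rw [Measure.map_apply (measurable_pi_iff.2 hm) (MeasurableSet.univ_pi hs),
    Measure.compProd_apply ((measurable_pi_iff.2 hm) (MeasurableSet.univ_pi hs))]
  have : ∀ x : ∀ i, A i, piKernel κ x (Prod.mk x ⁻¹' ((fun z i => (z.1 i, z.2 i)) ⁻¹'
      Set.univ.pi s)) = ∏ i, κ i (x i) (Prod.mk (x i) ⁻¹' s i) := by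
    intro x
    rw [piKernel_apply, ← Measure.pi_pi]
    rfl
  simp only [this]
  rw [lintegral_pi_prod μ (f := fun i a => κ i a (Prod.mk a ⁻¹' s i))
    fun i => Kernel.measurable_kernel_prodMk_left (hs i)]
  refine Finset.prod_congr rfl fun i _ => ?_
  rw [Measure.compProd_apply (hs i)]

theorem pi_prod_pi (μ : ∀ i, Measure (A i)) [∀ i, IsProbabilityMeasure (μ i)]
    (ν : ∀ i, Measure (B i)) [∀ i, IsProbabilityMeasure (ν i)] :
    ((Measure.pi μ).prod (Measure.pi ν)).map (fun z i => (z.1 i, z.2 i)) =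
      Measure.pi fun i => (μ i).prod (ν i) := by
  have h := pi_compProd_piKernel (fun i => Kernel.const (A i) (ν i)) μ
  have h2 : piKernel (fun i => Kernel.const (A i) (ν i)) = Kernel.const _ (Measure.pi ν) := by
    ext1 x
    simp [piKernel_apply]
  rw [h2] at h
  simpa [Measure.compProd_const] using h

theorem measurable_update_pair [DecidableEq ι] (i : ι) :
    Measurable fun z : A i × (∀ j, A j) => Function.update z.2 i z.1 := by
  refine measurable_pi_iff.2 fun j => ?_
  by_cases h : j = i
  · subst h
    simpa using measurable_fst
  · simp only [Function.update_of_ne h]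
    exact (measurable_pi_apply j).comp measurable_snd

/-- By independence, one coordinate may be drawn afresh without changing the law. This is what
separates one user's input or codebook from those of the others. -/
theorem pi_map_update [DecidableEq ι] (μ : ∀ i, Measure (A i)) [∀ i, IsProbabilityMeasure (μ i)]
    (i : ι) :
    ((μ i).prod (Measure.pi μ)).map (fun z => Function.update z.2 i z.1) = Measure.pi μ := by
  refine (Measure.pi_eq fun s hs => ?_).symm
  rw [Measure.map_apply (measurable_update_pair i) (MeasurableSet.univ_pi hs)]
  have : (fun z : A i × (∀ j, A j) => Function.update z.2 i z.1) ⁻¹' Set.univ.pi s =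
      (s i) ×ˢ Set.univ.pi (Function.update s i Set.univ) := by
    ext z
    simp only [Set.mem_preimage, Set.mem_pi, Set.mem_univ, true_imp_iff, Set.mem_prod]
    constructor
    · intro h
      refine ⟨by simpa using h i, fun j => ?_⟩
      by_cases hj : j = i
      · subst hj; simp
      · simpa [hj] using h j
    · rintro ⟨h1, h2⟩ j
      by_cases hj : j = i
      · subst hj; simpa using h1
      · simpa [hj] using h2 j
  rw [this, Measure.prod_prod, Measure.pi_pi, ← Finset.mul_prod_erase _ _ (Finset.mem_univ i),
    ← Finset.mul_prod_erase Finset.univ (fun j => μ j (s j)) (Finset.mem_univ i)]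
  simp only [Function.update_self, measure_univ, one_mul]
  congr 1
  refine Finset.prod_congr rfl fun j hj => ?_
  rw [Function.update_of_ne (Finset.ne_of_mem_erase hj)]

theorem lintegral_pi_update [DecidableEq ι] (μ : ∀ i, Measure (A i))
    [∀ i, IsProbabilityMeasure (μ i)] (i : ι) {f : (∀ i, A i) → ℝ≥0∞} (hf : Measurable f) :
    ∫⁻ x, f x ∂(Measure.pi μ) =
      ∫⁻ a, ∫⁻ x, f (Function.update x i a) ∂(Measure.pi μ) ∂(μ i) := by
  conv_lhs => rw [← pi_map_update μ i]
  rw [lintegral_map hf (measurable_update_pair i),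
    lintegral_prod (fun z => f (Function.update z.2 i z.1))
      (hf.comp (measurable_update_pair i)).aemeasurable]

end Pi

-- Doubly indexed products: transposing and currying the indices

section PiPi

variable {ι κ : Type*} {X : ι → κ → Type*} [∀ i k, MeasurableSpace (X i k)]

theorem measurable_swap_pi : Measurable fun (x : ∀ k i, X i k) i k => x k i :=
  measurable_pi_iff.2 fun i => measurable_pi_iff.2 fun k =>
    (measurable_pi_apply i).comp (measurable_pi_apply k)

theorem measurable_curry_pi :
    Measurable fun (x : ∀ z : ι × κ, X z.1 z.2) i k => x (i, k) :=
  measurable_pi_iff.2 fun i => measurable_pi_iff.2 fun k =>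
    measurable_pi_apply (X := fun z : ι × κ => X z.1 z.2) (i, k)

variable [Fintype ι] [Fintype κ]

/-- Rectangles in both indices form a π-system generating the iterated product σ-algebra. -/
theorem pi_pi_eq (μ : ∀ i k, Measure (X i k)) [∀ i k, IsProbabilityMeasure (μ i k)]
    {ν : Measure (∀ i k, X i k)}
    (h : ∀ s : ∀ i k, Set (X i k), (∀ i k, MeasurableSet (s i k)) →
      ν {x | ∀ i k, x i k ∈ s i k} = ∏ i, ∏ k, μ i k (s i k)) :
    Measure.pi (fun i => Measure.pi (μ i)) = ν := by
  classical
  refine Measure.pi_eq_generateFrom (C := fun i => Set.pi Set.univ ''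
    Set.pi Set.univ fun k => {s : Set (X i k) | MeasurableSet s}) (fun i => generateFrom_pi)
    (fun i => isPiSystem_pi) (fun i => ?_) ?_
  · exact ⟨fun _ => Set.univ, fun _ => ⟨fun _ => Set.univ, by simp, by simp⟩,
      fun _ => measure_lt_top _ _, Set.iUnion_const _⟩
  · intro s hs
    choose t ht hts using hs
    have hset : Set.univ.pi s = {x | ∀ i k, x i k ∈ t i k} := by
      ext x
      simp [← hts]
    rw [hset, h t fun i k => ht i k (Set.mem_univ k)]
    refine Finset.prod_congr rfl fun i _ => ?_
    rw [← hts i, Measure.pi_pi]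

theorem pi_pi_map_swap (μ : ∀ i k, Measure (X i k)) [∀ i k, IsProbabilityMeasure (μ i k)] :
    (Measure.pi fun k => Measure.pi fun i => μ i k).map (fun x i k => x k i) =
      Measure.pi fun i => Measure.pi (μ i) := by
  refine (pi_pi_eq μ fun s hs => ?_).symm
  rw [Measure.map_apply measurable_swap_pi]
  · have : (fun (x : ∀ k i, X i k) i k => x k i) ⁻¹' {x | ∀ i k, x i k ∈ s i k} =
        Set.univ.pi fun k => Set.univ.pi fun i => s i k := by
      ext x
      simp only [Set.mem_preimage, Set.mem_ofPred_eq, Set.mem_pi, Set.mem_univ, true_imp_iff]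
      exact forall_comm
    rw [this]
    simp only [Measure.pi_pi]
    exact Finset.prod_comm
  · simp only [Set.ofPred_forall]
    exact MeasurableSet.iInter fun i => MeasurableSet.iInter fun k =>
      ((measurable_pi_apply k).comp (measurable_pi_apply i)) (hs i k)

theorem pi_map_curry (μ : ∀ i k, Measure (X i k)) [∀ i k, IsProbabilityMeasure (μ i k)] :
    (Measure.pi fun z : ι × κ => μ z.1 z.2).map (fun x i k => x (i, k)) =
      Measure.pi fun i => Measure.pi (μ i) := by
  refine (pi_pi_eq μ fun s hs => ?_).symm
  rw [Measure.map_apply measurable_curry_pi]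
  · have : (fun (x : ∀ z : ι × κ, X z.1 z.2) i k => x (i, k)) ⁻¹' {x | ∀ i k, x i k ∈ s i k} =
        Set.univ.pi fun z : ι × κ => s z.1 z.2 := by
      ext x
      simp
    rw [this]
    simp only [Measure.pi_pi]
    exact Fintype.prod_prod_type _
  · simp only [Set.ofPred_forall]
    exact MeasurableSet.iInter fun i => MeasurableSet.iInter fun k =>
      ((measurable_pi_apply k).comp (measurable_pi_apply i)) (hs i k)

end PiPi

/-! ### Kullback-Leibler divergence -/

section KL

variable {α β : Type*} [MeasurableSpace α] [MeasurableSpace β]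

theorem klDiv_of_integrable_llr {μ ν : Measure α} [IsProbabilityMeasure μ]
    [IsProbabilityMeasure ν] (h1 : μ ≪ ν) (h2 : Integrable (llr μ ν) μ) :
    klDiv μ ν = ENNReal.ofReal (∫ x, llr μ ν x ∂μ) := by
  rw [klDiv_of_ac_of_integrable h1 h2]
  simp

section Kernel

variable [MeasurableSpace.CountableOrCountablyGenerated α β]

theorem klDiv_kernel_eq (κ η : Kernel α β) [IsFiniteKernel κ] [IsFiniteKernel η] (a : α)
    [Decidable (κ a ≪ η a)] :
    klDiv (κ a) (η a) = if κ a ≪ η a then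
      ∫⁻ b, ENNReal.ofReal (klFun (Kernel.rnDeriv κ η a b).toReal) ∂(η a) else ∞ := by
  split_ifs with h
  · rw [klDiv_eq_lintegral_klFun_of_ac h]
    refine lintegral_congr_ae ?_
    filter_upwards [Kernel.rnDeriv_eq_rnDeriv_measure (κ := κ) (η := η) (a := a)] with b hb
    rw [hb]
  · exact klDiv_of_not_ac h

/-- The Radon-Nikodym derivative of two kernels is jointly measurable under the countability
assumption on the spaces, and absolute continuity is a measurable condition on the input. -/
theorem measurable_klDiv_kernel (κ η : Kernel α β) [IsFiniteKernel κ] [IsFiniteKernel η] :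
    Measurable fun a => klDiv (κ a) (η a) := by
  classical
  simp only [klDiv_kernel_eq]
  refine Measurable.ite (Kernel.measurableSet_absolutelyContinuous κ η) ?_ measurable_const
  refine Measurable.lintegral_kernel_prod_right (f := fun a b =>
    ENNReal.ofReal (klFun (Kernel.rnDeriv κ η a b).toReal)) ?_
  exact ENNReal.measurable_ofReal.comp (measurable_klFun.comp
    (Kernel.measurable_rnDeriv κ η).ennreal_toReal)

/-- The kernel derivative is also the density of the two joint laws, so the integral of `klFun`
disintegrates. If absolute continuity fails on a non-null set of inputs, both sides are infinite. -/
theorem klDiv_compProd_eq_lintegral (μ : Measure α) [IsFiniteMeasure μ] (κ η : Kernel α β)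
    [IsMarkovKernel κ] [IsMarkovKernel η] :
    klDiv (μ ⊗ₘ κ) (μ ⊗ₘ η) = ∫⁻ a, klDiv (κ a) (η a) ∂μ := by
  classical
  by_cases hac : ∀ᵐ a ∂μ, κ a ≪ η a
  · have hac' : μ ⊗ₘ κ ≪ μ ⊗ₘ η := Measure.absolutelyContinuous_compProd_right_iff.2 hac
    have hm := Kernel.measurable_rnDeriv κ η
    have hdens : μ ⊗ₘ κ = (μ ⊗ₘ η).withDensity fun p => Kernel.rnDeriv κ η p.1 p.2 := by
      rw [← Measure.compProd_withDensity hm]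
      refine Measure.compProd_congr ?_
      filter_upwards [hac] with a ha
      exact (Kernel.withDensity_rnDeriv_eq ha).symm
    have hrn : (μ ⊗ₘ κ).rnDeriv (μ ⊗ₘ η) =ᵐ[μ ⊗ₘ η] fun p => Kernel.rnDeriv κ η p.1 p.2 := by
      conv_lhs => rw [hdens]
      exact Measure.rnDeriv_withDensity _ hm
    rw [klDiv_eq_lintegral_klFun_of_ac hac']
    have : ∫⁻ p, ENNReal.ofReal (klFun ((μ ⊗ₘ κ).rnDeriv (μ ⊗ₘ η) p).toReal) ∂(μ ⊗ₘ η) =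
        ∫⁻ p, ENNReal.ofReal (klFun (Kernel.rnDeriv κ η p.1 p.2).toReal) ∂(μ ⊗ₘ η) := by
      refine lintegral_congr_ae ?_
      filter_upwards [hrn] with p hp
      rw [hp]
    rw [this, Measure.lintegral_compProd]
    · refine lintegral_congr_ae ?_
      filter_upwards [hac] with a ha
      rw [klDiv_kernel_eq, if_pos ha]
    · exact ENNReal.measurable_ofReal.comp (measurable_klFun.comp hm.ennreal_toReal)
  · have hac' : ¬ μ ⊗ₘ κ ≪ μ ⊗ₘ η := fun h =>
      hac (Measure.absolutelyContinuous_compProd_right_iff.1 h)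
    rw [klDiv_of_not_ac hac']
    by_contra hne
    refine hac ?_
    filter_upwards [ae_lt_top (measurable_klDiv_kernel κ η) (Ne.symm hne)] with a ha
    by_contra h
    simp [klDiv_of_not_ac h] at ha

end Kernel

/-- **Compensation identity**: replacing the output law of a channel by another reference law
increases the divergence by the divergence of the two output laws. -/
theorem klDiv_compProd_prod [StandardBorelSpace α] [Nonempty α] (p : Measure α)
    [IsProbabilityMeasure p] (U : Kernel α β) [IsMarkovKernel U] (R : Measure β)
    [IsProbabilityMeasure R] :
    klDiv (p ⊗ₘ U) (p.prod R) = mutualInfo (p ⊗ₘ U) + klDiv (U ∘ₘ p) R := by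
  have hswap : ∀ μ ν : Measure (α × β), IsProbabilityMeasure μ → IsProbabilityMeasure ν →
      klDiv (μ.map Prod.swap) (ν.map Prod.swap) = klDiv μ ν := by
    intro μ ν _ _
    refine le_antisymm (klDiv_map_le _ _ measurable_swap) ?_
    have := klDiv_map_le (μ.map Prod.swap) (ν.map Prod.swap) (measurable_swap (α := β) (β := α))
    rwa [Measure.map_map measurable_swap measurable_swap,
      Measure.map_map measurable_swap measurable_swap, Prod.swap_swap_eq, Measure.map_id,
      Measure.map_id] at this
  -- With the output as first coordinate, both reference laws have the constant conditional law `p`.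
  -- The chain rule, conditioning on the output, then splits off the divergence of the output laws.
  set ρ := (p ⊗ₘ U).map Prod.swap with hρ
  have : IsProbabilityMeasure ρ := Measure.isProbabilityMeasure_map measurable_swap.aemeasurable
  have hfst : ρ.fst = U ∘ₘ p := by
    rw [hρ, Measure.fst_map_swap, Measure.snd_compProd]
  have hdis : (U ∘ₘ p) ⊗ₘ ρ.condKernel = ρ := by
    rw [← hfst]; exact Measure.disintegrate ρ ρ.condKernel
  have h2 : (p.prod R).map Prod.swap = R ⊗ₘ Kernel.const β p := by
    rw [Measure.prod_swap, Measure.compProd_const]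
  have h3 : (p.prod (U ∘ₘ p)).map Prod.swap = (U ∘ₘ p) ⊗ₘ Kernel.const β p := by
    rw [Measure.prod_swap, Measure.compProd_const]
  rw [mutualInfo, Measure.fst_compProd, Measure.snd_compProd, ← hswap (p ⊗ₘ U) (p.prod R)
    inferInstance inferInstance, ← hswap (p ⊗ₘ U) (p.prod (U ∘ₘ p)) inferInstance inferInstance,
    h2, h3, ← hρ]
  conv_lhs => rw [← hdis]
  rw [klDiv_compProd_eq_add, hdis, add_comm]

theorem mutualInfo_compProd_eq (p : Measure α) [IsProbabilityMeasure p] (U : Kernel α β)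
    [IsMarkovKernel U] :
    mutualInfo (p ⊗ₘ U) = klDiv (p ⊗ₘ U) (p ⊗ₘ Kernel.const α (U ∘ₘ p)) := by
  rw [mutualInfo, Measure.fst_compProd, Measure.snd_compProd, Measure.compProd_const]

theorem mutualInfo_compProd_eq_lintegral [MeasurableSpace.CountableOrCountablyGenerated α β]
    (p : Measure α) [IsProbabilityMeasure p] (U : Kernel α β) [IsMarkovKernel U] :
    mutualInfo (p ⊗ₘ U) = ∫⁻ x, klDiv (U x) (U ∘ₘ p) ∂p := by
  rw [mutualInfo_compProd_eq, klDiv_compProd_eq_lintegral]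
  rfl

/-- Passing to a description of the input of a channel does not change the mutual information. -/
theorem mutualInfo_compProd_comap {γ : Type*} [MeasurableSpace γ]
    [MeasurableSpace.CountableOrCountablyGenerated α β]
    [MeasurableSpace.CountableOrCountablyGenerated γ β]
    (p : Measure γ) [IsProbabilityMeasure p] (U : Kernel α β) [IsMarkovKernel U] {e : γ → α}
    (he : Measurable e) :
    mutualInfo (p ⊗ₘ U.comap e he) = mutualInfo (p.map e ⊗ₘ U) := by
  have : IsProbabilityMeasure (p.map e) := Measure.isProbabilityMeasure_map he.aemeasurable
  have h : U.comap e he ∘ₘ p = U ∘ₘ p.map e := by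
    ext s hs
    rw [Measure.bind_apply hs (Kernel.aemeasurable _), Measure.bind_apply hs (Kernel.aemeasurable _),
      lintegral_map (Kernel.measurable_coe U hs) he]
    rfl
  rw [mutualInfo_compProd_eq_lintegral, mutualInfo_compProd_eq_lintegral, h,
    lintegral_map _ he]
  · rfl
  · exact measurable_klDiv_kernel U (Kernel.const α (U ∘ₘ p.map e))

end KL

-- Total correlation

section Product

variable {κ : Type*} [Fintype κ] {Y : κ → Type*} [∀ k, MeasurableSpace (Y k)]

theorem pi_withDensity (Q : ∀ k, Measure (Y k)) [∀ k, IsProbabilityMeasure (Q k)]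
    {d : ∀ k, Y k → ℝ≥0∞} (hd : ∀ k, Measurable (d k))
    [∀ k, IsProbabilityMeasure ((Q k).withDensity (d k))] :
    (Measure.pi Q).withDensity (fun y => ∏ k, d k (y k)) =
      Measure.pi fun k => (Q k).withDensity (d k) := by
  refine (Measure.pi_eq fun s hs => ?_).symm
  rw [withDensity_apply _ (MeasurableSet.univ_pi hs), ← lintegral_indicator (MeasurableSet.univ_pi hs)]
  have : ∀ y : ∀ k, Y k, (Set.univ.pi s).indicator (fun y => ∏ k, d k (y k)) y =
      ∏ k, (s k).indicator (d k) (y k) := by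
    intro y
    by_cases hy : y ∈ Set.univ.pi s
    · rw [Set.indicator_of_mem hy]
      refine Finset.prod_congr rfl fun k _ => ?_
      rw [Set.indicator_of_mem (hy k (Set.mem_univ k))]
    · rw [Set.indicator_of_notMem hy]
      simp only [Set.mem_pi, Set.mem_univ, true_imp_iff, not_forall] at hy
      obtain ⟨k, hk⟩ := hy
      exact (Finset.prod_eq_zero (Finset.mem_univ k) (Set.indicator_of_notMem hk _)).symm
  simp only [this]
  rw [lintegral_pi_prod Q fun k => (hd k).indicator (hs k)]
  refine Finset.prod_congr rfl fun k _ => ?_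
  rw [lintegral_indicator (hs k), withDensity_apply _ (hs k)]

instance (P : Measure (∀ k, Y k)) [IsProbabilityMeasure P] (k : κ) :
    IsProbabilityMeasure (P.map fun y => y k) :=
  Measure.isProbabilityMeasure_map (measurable_pi_apply k).aemeasurable

/-- The total correlation: the divergence of a joint law from the product of its marginals. -/
def totalCorr (P : Measure (∀ k, Y k)) : ℝ≥0∞ :=
  klDiv P (Measure.pi fun k => P.map fun y => y k)

/-- The log-density of `P` with respect to the product of the `Q k` is the one with respect to the
product of its own marginals plus the marginal log-densities; integrate under `P`. If a term on the
right is infinite there is nothing to prove. -/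
theorem klDiv_pi_le (P : Measure (∀ k, Y k)) [IsProbabilityMeasure P]
    (Q : ∀ k, Measure (Y k)) [∀ k, IsProbabilityMeasure (Q k)] :
    klDiv P (Measure.pi Q) ≤ totalCorr P + ∑ k, klDiv (P.map fun y => y k) (Q k) := by
  set Pk : ∀ k, Measure (Y k) := fun k => P.map fun y => y k with hPk
  by_cases h1 : totalCorr P = ∞
  · simp [h1]
  by_cases h2 : ∀ k, klDiv (Pk k) (Q k) ≠ ∞
  swap
  · push Not at h2
    obtain ⟨k, hk⟩ := h2
    have : ∑ k, klDiv (Pk k) (Q k) = ∞ := ENNReal.sum_eq_top.2 ⟨k, Finset.mem_univ k, hk⟩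
    exact le_top.trans_eq (ENNReal.add_eq_top.2 (Or.inr this)).symm
  obtain ⟨hac, hint⟩ := klDiv_ne_top_iff.1 h1
  have hack : ∀ k, Pk k ≪ Q k := fun k => (klDiv_ne_top_iff.1 (h2 k)).1
  have hintk : ∀ k, Integrable (llr (Pk k) (Q k)) (Pk k) := fun k => (klDiv_ne_top_iff.1 (h2 k)).2
  set d : ∀ k, Y k → ℝ≥0∞ := fun k => (Pk k).rnDeriv (Q k) with hd
  have hdm : ∀ k, Measurable (d k) := fun k => Measure.measurable_rnDeriv _ _
  have hdk : ∀ k, (Q k).withDensity (d k) = Pk k := fun k =>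
    Measure.withDensity_rnDeriv_eq _ _ (hack k)
  have : ∀ k, IsProbabilityMeasure ((Q k).withDensity (d k)) := fun k => by
    rw [hdk]; infer_instance
  have hpi : (Measure.pi Q).withDensity (fun y => ∏ k, d k (y k)) = Measure.pi Pk := by
    rw [pi_withDensity Q hdm]
    simp only [hdk]
  have hdpm : Measurable fun y : ∀ k, Y k => ∏ k, d k (y k) :=
    Finset.measurable_prod _ fun k _ => (hdm k).comp (measurable_pi_apply k)
  have hacpi : Measure.pi Pk ≪ Measure.pi Q := hpi ▸ withDensity_absolutelyContinuous _ _
  have hrn : (Measure.pi Pk).rnDeriv (Measure.pi Q) =ᵐ[Measure.pi Q] fun y => ∏ k, d k (y k) := by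
    rw [← hpi]
    exact Measure.rnDeriv_withDensity _ hdpm
  have hacQ : P ≪ Measure.pi Q := hac.trans hacpi
  have hllr : llr P (Measure.pi Q) =ᵐ[P] fun y =>
      llr P (Measure.pi Pk) y + ∑ k, llr (Pk k) (Q k) (y k) := by
    -- The derivatives multiply along `P`, product of marginals, product of the `Q k`. The logarithm
    -- splits because the total density is positive and finite `P`-almost everywhere.
    filter_upwards [hacQ hrn, hacQ (Measure.rnDeriv_mul_rnDeriv (κ := Measure.pi Q) hac),
      Measure.rnDeriv_pos hacQ, hacQ (Measure.rnDeriv_lt_top P (Measure.pi Q))]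
      with y hy1 hy2 hy3 hy4
    have hne : (P.rnDeriv (Measure.pi Q) y).toReal ≠ 0 :=
      (ENNReal.toReal_pos hy3.ne' hy4.ne).ne'
    simp only [llr]
    rw [← hy2, Pi.mul_apply, hy1, ENNReal.toReal_mul, ENNReal.toReal_prod] at hne ⊢
    have hne2 := (mul_ne_zero_iff.1 hne)
    rw [Real.log_mul hne2.1 hne2.2, Real.log_prod]
    intro k hk
    exact Finset.prod_ne_zero_iff.1 hne2.2 k hk
  have hintk' : ∀ k, Integrable (fun y : ∀ k, Y k => llr (Pk k) (Q k) (y k)) P := fun k =>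
    (hintk k).comp_measurable (measurable_pi_apply k)
  have hsum : Integrable (fun y : ∀ k, Y k => ∑ k, llr (Pk k) (Q k) (y k)) P :=
    integrable_finsetSum _ fun k _ => hintk' k
  have hintQ : Integrable (llr P (Measure.pi Q)) P := (integrable_congr hllr).2 (hint.add hsum)
  rw [klDiv_of_integrable_llr hacQ hintQ, integral_congr_ae hllr, integral_add hint hsum,
    integral_finsetSum _ fun k _ => hintk' k]
  -- Subadditivity of `ENNReal.ofReal` is enough, so the signs of the separate integrals need not be
  -- checked.
  refine ENNReal.ofReal_add_le.trans ?_
  refine add_le_add (klDiv_of_integrable_llr hac hint).ge ?_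
  refine (Finset.le_sum_of_subadditive ENNReal.ofReal ENNReal.ofReal_zero.le
    (fun _ _ => ENNReal.ofReal_add_le) _ _).trans (Finset.sum_le_sum fun k _ => ?_)
  rw [klDiv_of_integrable_llr (hack k) (hintk k)]
  exact ENNReal.ofReal_le_ofReal (integral_map (measurable_pi_apply k).aemeasurable
    (measurable_llr _ _).aestronglyMeasurable).ge

theorem map_eval_pi (P : ∀ k, Measure (Y k)) [∀ k, IsProbabilityMeasure (P k)] (k : κ) :
    (Measure.pi P).map (fun y => y k) = P k :=
  (measurePreserving_eval P k).map_eq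

theorem totalCorr_pi (P : ∀ k, Measure (Y k)) [∀ k, IsProbabilityMeasure (P k)] :
    totalCorr (Measure.pi P) = 0 := by
  rw [totalCorr]
  simp only [map_eval_pi]
  exact klDiv_self _

theorem klDiv_pi_pi_le (P Q : ∀ k, Measure (Y k)) [∀ k, IsProbabilityMeasure (P k)]
    [∀ k, IsProbabilityMeasure (Q k)] :
    klDiv (Measure.pi P) (Measure.pi Q) ≤ ∑ k, klDiv (P k) (Q k) := by
  have h := klDiv_pi_le (Measure.pi P) Q
  rw [totalCorr_pi, zero_add] at h
  simpa only [map_eval_pi] using h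

/-- A componentwise map carries the product of the marginals to the product of the new marginals, so
this is data processing. -/
theorem totalCorr_map_le {Z : κ → Type*} [∀ k, MeasurableSpace (Z k)] (P : Measure (∀ k, Y k))
    [IsProbabilityMeasure P] {f : ∀ k, Y k → Z k} (hf : ∀ k, Measurable (f k)) :
    totalCorr (P.map fun y k => f k (y k)) ≤ totalCorr P := by
  have hfm : Measurable fun (y : ∀ k, Y k) k => f k (y k) :=
    measurable_pi_iff.2 fun k => (hf k).comp (measurable_pi_apply k)
  have : ∀ k, IsProbabilityMeasure ((P.map fun y => y k).map (f k)) := fun k =>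
    Measure.isProbabilityMeasure_map (hf k).aemeasurable
  have h : (Measure.pi fun k => (P.map fun y k => f k (y k)).map fun z => z k) =
      (Measure.pi fun k => P.map fun y => y k).map fun y k => f k (y k) := by
    rw [Measure.pi_map_pi fun k => (hf k).aemeasurable]
    congr 1
    funext k
    rw [Measure.map_map (measurable_pi_apply k) hfm,
      Measure.map_map (hf k) (measurable_pi_apply k)]
    rfl
  rw [totalCorr, totalCorr, h]
  exact klDiv_map_le _ _ hfm

theorem piKernel_comp_map_eval {Z : κ → Type*} [∀ k, MeasurableSpace (Z k)]
    (P : Measure (∀ k, Y k)) [IsProbabilityMeasure P] (D : ∀ k, Kernel (Y k) (Z k))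
    [∀ k, IsMarkovKernel (D k)] (k : κ) :
    (piKernel D ∘ₘ P).map (fun z => z k) = D k ∘ₘ P.map fun y => y k := by
  ext s hs
  rw [Measure.map_apply (measurable_pi_apply k) hs,
    Measure.bind_apply (measurable_pi_apply k hs) (Kernel.aemeasurable _),
    Measure.bind_apply hs (Kernel.aemeasurable _),
    lintegral_map (Kernel.measurable_coe _ hs) (measurable_pi_apply k)]
  refine lintegral_congr fun y => ?_
  rw [← Measure.map_apply (measurable_pi_apply k) hs, piKernel_apply, map_eval_pi]

/-- Data processing again, now for independent noise added on each component. -/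
theorem totalCorr_piKernel_le {Z : κ → Type*} [∀ k, MeasurableSpace (Z k)]
    (P : Measure (∀ k, Y k)) [IsProbabilityMeasure P] (D : ∀ k, Kernel (Y k) (Z k))
    [∀ k, IsMarkovKernel (D k)] :
    totalCorr (piKernel D ∘ₘ P) ≤ totalCorr P := by
  rw [totalCorr, totalCorr]
  simp only [piKernel_comp_map_eval]
  rw [← piKernel_comp_pi]
  exact klDiv_comp_right_le _ _ _

end Product

/-! ### The channel of one user when interference is treated as noise -/

section Tin

variable {ι : Type*} [Fintype ι] [DecidableEq ι] {X Y : ι → Type*}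
  [∀ i, MeasurableSpace (X i)] [∀ i, MeasurableSpace (Y i)]

/-- The channel from the input to the output of user `i` when the other inputs are independent with
the laws `p j`. -/
def tin (W : Kernel (∀ i, X i) (∀ i, Y i)) (p : ∀ i, Measure (X i)) (i : ι) :
    Kernel (X i) (Y i) :=
  (W.map fun y => y i) ∘ₖ
    ((Kernel.id ×ₖ Kernel.const (X i) (Measure.pi p)).map fun z => Function.update z.2 i z.1)

variable (W : Kernel (∀ i, X i) (∀ i, Y i)) (p : ∀ i, Measure (X i))

theorem tin_apply [∀ i, IsProbabilityMeasure (p i)] (i : ι) (a : X i) {s : Set (Y i)}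
    (hs : MeasurableSet s) :
    tin W p i a s = ∫⁻ z, W (Function.update z i a) ((fun y => y i) ⁻¹' s) ∂(Measure.pi p) := by
  have hm : Measurable fun y : ∀ i, Y i => y i := measurable_pi_apply i
  have hu : Measurable fun z : X i × (∀ j, X j) =>
      (W.map fun y => y i) (Function.update z.2 i z.1) s :=
    (Kernel.measurable_coe _ hs).comp (measurable_update_pair i)
  rw [tin, Kernel.comp_apply' _ _ _ hs, Kernel.map_apply _ (measurable_update_pair i),
    Kernel.prod_apply, Kernel.id_apply, Kernel.const_apply,
    lintegral_map (Kernel.measurable_coe _ hs) (measurable_update_pair i),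
    Measure.dirac_prod, lintegral_map hu measurable_prodMk_left]
  refine lintegral_congr fun z => ?_
  rw [Kernel.map_apply' _ hm _ hs]

instance [IsMarkovKernel W] [∀ i, IsProbabilityMeasure (p i)] (i : ι) :
    IsMarkovKernel (tin W p i) := by
  have := Kernel.IsMarkovKernel.map W (measurable_pi_apply i)
  have := Kernel.IsMarkovKernel.map (Kernel.id ×ₖ Kernel.const (X i) (Measure.pi p))
    (measurable_update_pair i)
  unfold tin
  infer_instance

/-- Drawing the input of user `i` separately leaves an average over the other users' inputs. Hence
`userInfo` is the mutual information of an ordinary point-to-point channel. -/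
theorem compProd_tin [IsMarkovKernel W] [∀ i, IsProbabilityMeasure (p i)] (i : ι) :
    (Measure.pi p ⊗ₘ W).map (fun z => (z.1 i, z.2 i)) = p i ⊗ₘ tin W p i := by
  have hm : Measurable fun z : (∀ i, X i) × (∀ i, Y i) => (z.1 i, z.2 i) :=
    ((measurable_pi_apply i).comp measurable_fst).prodMk
      ((measurable_pi_apply i).comp measurable_snd)
  ext s hs
  rw [Measure.map_apply hm hs, Measure.compProd_apply (hm hs), Measure.compProd_apply hs,
    lintegral_pi_update p i (Kernel.measurable_kernel_prodMk_left (hm hs))]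
  refine lintegral_congr fun a => ?_
  rw [tin_apply W p i a (measurable_prodMk_left hs)]
  refine lintegral_congr fun z => ?_
  congr 1
  ext y
  simp

theorem userInfo_eq [IsMarkovKernel W] (p : ∀ i, ProbabilityMeasure (X i)) (i : ι) :
    userInfo W p i = mutualInfo ((p i : Measure (X i)) ⊗ₘ tin W (fun j => (p j : Measure _)) i) := by
  rw [userInfo, compProd_tin]

/-- Passing to descriptions of the inputs does not change the mutual informations. -/
theorem userInfo_comap {M : ι → Type*} [∀ i, MeasurableSpace (M i)]
    [∀ i, StandardBorelSpace (Y i)] [IsMarkovKernel W]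
    (p : ∀ i, ProbabilityMeasure (M i)) {e : ∀ i, M i → X i} (he : ∀ i, Measurable (e i))
    (hem : Measurable fun (w : ∀ i, M i) i => e i (w i)) (i : ι) :
    userInfo (W.comap (fun w i => e i (w i)) hem) p i =
      userInfo W (fun i => (p i).map (he i).aemeasurable) i := by
  have h : tin (W.comap (fun w i => e i (w i)) hem) (fun j => (p j : Measure (M j))) i =
      (tin W (fun j => ((p j).map (he j).aemeasurable : Measure (X j))) i).comap (e i) (he i) := by
    ext a s hs
    rw [Kernel.comap_apply, tin_apply _ _ _ _ hs, tin_apply _ _ _ _ hs]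
    have hpi : (Measure.pi fun j => (((p j).map (he j).aemeasurable : ProbabilityMeasure (X j)) :
        Measure (X j))) = (Measure.pi fun j => (p j : Measure (M j))).map fun w j => e j (w j) := by
      have : ∀ j, IsProbabilityMeasure ((p j : Measure (M j)).map (e j)) := fun j =>
        Measure.isProbabilityMeasure_map (he j).aemeasurable
      rw [Measure.pi_map_pi fun j => (he j).aemeasurable]
      rfl
    have hu : Measurable fun x : ∀ j, X j =>
        W (Function.update x i (e i a)) ((fun y => y i) ⁻¹' s) :=
      (Kernel.measurable_coe W (measurable_pi_apply i hs)).comp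
        ((measurable_update_pair i).comp measurable_prodMk_left)
    rw [hpi, lintegral_map hu hem]
    refine lintegral_congr fun w => ?_
    rw [Kernel.comap_apply]
    congr 2
    funext j
    by_cases hj : j = i
    · subst hj; simp
    · simp [hj]
  rw [userInfo_eq, userInfo_eq, h, mutualInfo_compProd_comap]
  rfl

end Tin

-- Marginals of parallel channels

section ParallelKernel

variable {ι : Type*} [Fintype ι] {κ : Type*} [Fintype κ] {X Y : ι → κ → Type*}
  [∀ i k, MeasurableSpace (X i k)] [∀ i k, MeasurableSpace (Y i k)]
  (W : ∀ k, Kernel (∀ i, X i k) (∀ i, Y i k)) [∀ k, IsMarkovKernel (W k)]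

theorem parallel_apply (x : ∀ i k, X i k) :
    parallel W x = (Measure.pi fun k => W k fun i => x i k).map fun y i k => y k i := rfl

instance : IsMarkovKernel (parallel W) :=
  ⟨fun x => by
    rw [parallel_apply]
    exact Measure.isProbabilityMeasure_map measurable_swap_pi.aemeasurable⟩

theorem parallel_map_user (x : ∀ i k, X i k) (i : ι) :
    (parallel W x).map (fun y => y i) =
      Measure.pi fun k => (W k fun i => x i k).map fun y => y i := by
  have : ∀ k, IsProbabilityMeasure ((W k fun i => x i k).map fun y => y i) := fun k =>
    Measure.isProbabilityMeasure_map (measurable_pi_apply i).aemeasurable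
  rw [parallel_apply, Measure.map_map (measurable_pi_apply i) measurable_swap_pi,
    ← Measure.pi_map_pi fun k => (measurable_pi_apply i).aemeasurable]
  rfl

theorem parallel_map_user_carrier (x : ∀ i k, X i k) (i : ι) (k : κ) :
    (parallel W x).map (fun y => y i k) = (W k fun i => x i k).map fun y => y i := by
  have : ∀ k, IsProbabilityMeasure ((W k fun i => x i k).map fun y => y i) := fun k =>
    Measure.isProbabilityMeasure_map (measurable_pi_apply i).aemeasurable
  have h : (parallel W x).map (fun y => y i k) =
      ((parallel W x).map (fun y => y i)).map fun y => y k := by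
    rw [Measure.map_map (measurable_pi_apply k) (measurable_pi_apply i)]
    rfl
  rw [h, parallel_map_user, map_eval_pi]

/-- The output on carrier `k` involves only the inputs on carrier `k`. Any dependence of the input
laws across carriers therefore disappears in this marginal. -/
theorem tin_parallel_map_eval [DecidableEq ι] (q : ∀ i, Measure (∀ k, X i k))
    [∀ i, IsProbabilityMeasure (q i)] (i : ι) (x : ∀ k, X i k) (k : κ) :
    (tin (parallel W) q i x).map (fun y => y k) =
      tin (W k) (fun j => (q j).map fun x => x k) i (x k) := by
  ext s hs
  have hk : Measurable fun (z : ∀ i k, X i k) i => z i k :=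
    measurable_pi_iff.2 fun i => (measurable_pi_apply k).comp (measurable_pi_apply i)
  have hpi : (Measure.pi fun j => (q j).map fun x => x k) =
      (Measure.pi q).map fun z i => z i k :=
    (Measure.pi_map_pi fun j => (measurable_pi_apply k).aemeasurable).symm
  have hu : Measurable fun z : ∀ j, X j k =>
      W k (Function.update z i (x k)) ((fun y => y i) ⁻¹' s) :=
    (Kernel.measurable_coe (W k) (measurable_pi_apply i hs)).comp
      ((measurable_update_pair i).comp measurable_prodMk_left)
  rw [Measure.map_apply (measurable_pi_apply k) hs,
    tin_apply (parallel W) q i x (measurable_pi_apply k hs), tin_apply (W k) _ i (x k) hs, hpi,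
    lintegral_map hu hk]
  refine lintegral_congr fun z => ?_
  have h := parallel_map_user_carrier W (Function.update z i x) i k
  have h2 : (fun j => Function.update z i x j k) =
      Function.update (fun j => z j k) i (x k) := by
    funext j
    by_cases hj : j = i
    · subst hj; simp
    · simp [hj]
  rw [h2] at h
  have h3 := congrArg (fun μ => μ s) h
  have hm : Measurable fun y : ∀ i k, Y i k => y i k :=
    (measurable_pi_apply k).comp (measurable_pi_apply i)
  rw [Measure.map_apply hm hs, Measure.map_apply (measurable_pi_apply i) hs] at h3
  exact h3

end ParallelKernel

/-! ### Independence across carriers -/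

section OneUser

variable {κ : Type*} [Fintype κ] {X Y : κ → Type*}
  [∀ k, MeasurableSpace (X k)] [∀ k, StandardBorelSpace (X k)] [∀ k, Nonempty (X k)]
  [∀ k, MeasurableSpace (Y k)] [∀ k, StandardBorelSpace (Y k)]

/-- Both sides are compared with the divergence of the joint law from `q` times the product of the
output marginals. The compensation identity turns that divergence into the left side; conditioning
on the input and applying `klDiv_pi_le` for each `x` bounds it by the right side. -/
theorem mutualInfo_add_totalCorr_le (U : Kernel (∀ k, X k) (∀ k, Y k)) [IsMarkovKernel U]
    (Uk : ∀ k, Kernel (X k) (Y k)) [∀ k, IsMarkovKernel (Uk k)]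
    (hU : ∀ x k, (U x).map (fun y => y k) = Uk k (x k)) {t : ℝ≥0∞}
    (ht : ∀ x, totalCorr (U x) ≤ t) (q : Measure (∀ k, X k)) [IsProbabilityMeasure q] :
    mutualInfo (q ⊗ₘ U) + totalCorr (U ∘ₘ q) ≤
      t + ∑ k, mutualInfo (q.map (fun x => x k) ⊗ₘ Uk k) := by
  set Q : ∀ k, Measure (Y k) := fun k => (U ∘ₘ q).map fun y => y k with hQ
  have hQk : ∀ k, Q k = Uk k ∘ₘ q.map (fun x => x k) := by
    intro k
    ext s hs
    rw [hQ, Measure.map_apply (measurable_pi_apply k) hs,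
      Measure.bind_apply (measurable_pi_apply k hs) (Kernel.aemeasurable _),
      Measure.bind_apply hs (Kernel.aemeasurable _),
      lintegral_map (Kernel.measurable_coe _ hs) (measurable_pi_apply k)]
    refine lintegral_congr fun x => ?_
    rw [← hU, Measure.map_apply (measurable_pi_apply k) hs]
  have hmk : ∀ k, Measurable fun x : ∀ k, X k => klDiv (Uk k (x k)) (Q k) := fun k =>
    (measurable_klDiv_kernel (Uk k) (Kernel.const _ (Q k))).comp (measurable_pi_apply k)
  have h : totalCorr (U ∘ₘ q) = klDiv (U ∘ₘ q) (Measure.pi Q) := rfl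
  rw [h, ← klDiv_compProd_prod, ← Measure.compProd_const, klDiv_compProd_eq_lintegral]
  calc ∫⁻ x, klDiv (U x) (Kernel.const _ (Measure.pi Q) x) ∂q
      ≤ ∫⁻ x, (t + ∑ k, klDiv (Uk k (x k)) (Q k)) ∂q := by
        refine lintegral_mono fun x => ?_
        refine (klDiv_pi_le (U x) Q).trans (add_le_add (ht x) (le_of_eq ?_))
        simp only [hU]
    _ = t + ∑ k, ∫⁻ x, klDiv (Uk k (x k)) (Q k) ∂q := by
        rw [lintegral_add_left measurable_const, lintegral_const, measure_univ, mul_one,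
          lintegral_finsetSum _ fun k _ => hmk k]
    _ = t + ∑ k, mutualInfo (q.map (fun x => x k) ⊗ₘ Uk k) := by
        congr 1
        refine Finset.sum_congr rfl fun k _ => ?_
        have hm : Measurable fun x : X k => klDiv (Uk k x) (Q k) :=
          measurable_klDiv_kernel (Uk k) (Kernel.const _ (Q k))
        rw [mutualInfo_compProd_eq_lintegral, ← hQk, lintegral_map hm (measurable_pi_apply k)]

end OneUser

-- Trading correlation of the interference against correlation of the other outputs

namespace ManyToOne

section

variable {m : ℕ} {X Y : Fin (m + 1) → Type*} {V : Type*}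
  [∀ i, MeasurableSpace (X i)] [∀ i, MeasurableSpace (Y i)] [MeasurableSpace V]
  (C : ManyToOne X Y V)

instance : IsMarkovKernel C.joint := C.markov_joint

instance (j : Fin m) : IsMarkovKernel (C.direct j) := C.markov_direct j

theorem kernel_apply (x : ∀ i, X i) :
    C.kernel x = (C.joint fun j => x j.succ).map fun vy => C.assemble (x 0, vy) := rfl

theorem kernel_map_zero (x : ∀ i, X i) :
    (C.kernel x).map (fun y => y 0) =
      ((C.joint.map Prod.fst) fun j => x j.succ).map (C.f (x 0)) := by
  have hf : Measurable (C.f (x 0)) := C.measurable_f.comp measurable_prodMk_left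
  have ha : Measurable fun vy => C.assemble (x 0, vy) :=
    C.measurable_assemble.comp measurable_prodMk_left
  rw [kernel_apply, Measure.map_map (measurable_pi_apply 0) ha, Kernel.map_apply _ measurable_fst,
    Measure.map_map hf measurable_fst]
  rfl

theorem kernel_map_succ (x : ∀ i, X i) (j : Fin m) :
    (C.kernel x).map (fun y => y j.succ) = C.direct j (x j.succ) := by
  have ha : Measurable fun vy => C.assemble (x 0, vy) :=
    C.measurable_assemble.comp measurable_prodMk_left
  rw [kernel_apply, Measure.map_map (measurable_pi_apply _) ha]
  have h := congrArg (fun μ => μ.map fun y => y j) (C.joint_snd fun j => x j.succ)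
  rw [map_eval_pi, Measure.map_map (measurable_pi_apply _) measurable_snd] at h
  exact h

end

theorem pi_map_tail {m : ℕ} {A : Fin (m + 1) → Type*} [∀ i, MeasurableSpace (A i)]
    (q : ∀ i, Measure (A i)) [∀ i, IsProbabilityMeasure (q i)] :
    (Measure.pi q).map (fun z (j : Fin m) => z j.succ) = Measure.pi fun j => q j.succ := by
  refine (Measure.pi_eq fun s hs => ?_).symm
  have hm : Measurable fun (z : ∀ i, A i) (j : Fin m) => z j.succ :=
    measurable_pi_iff.2 fun j => measurable_pi_apply _
  rw [Measure.map_apply hm (MeasurableSet.univ_pi hs)]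
  have : (fun (z : ∀ i, A i) (j : Fin m) => z j.succ) ⁻¹' Set.univ.pi s =
      Set.univ.pi (Fin.cons Set.univ s : ∀ i, Set (A i)) := by
    ext z
    simp [Set.mem_pi, Fin.forall_fin_succ]
  rw [this, Measure.pi_pi, Fin.prod_univ_succ]
  simp

variable {κ : Type*} [Fintype κ] {m : ℕ} {X Y : Fin (m + 1) → κ → Type*} {V : κ → Type*}
  [∀ i k, MeasurableSpace (X i k)] [∀ i k, MeasurableSpace (Y i k)] [∀ k, MeasurableSpace (V k)]
  (C : ∀ k, ManyToOne (fun i => X i k) (fun i => Y i k) (V k))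

/-- These receivers see no interference, so the channel does not depend on `q`, and given the input
the carriers are independent. -/
theorem tin_parallel_succ (q : ∀ i, Measure (∀ k, X i k)) [∀ i, IsProbabilityMeasure (q i)]
    (j : Fin m) :
    tin (parallel fun k => (C k).kernel) q j.succ = piKernel fun k => (C k).direct j := by
  ext x s hs
  rw [tin_apply (parallel fun k => (C k).kernel) q j.succ x hs]
  have : ∀ z, parallel (fun k => (C k).kernel) (Function.update z j.succ x)
      ((fun y => y j.succ) ⁻¹' s) = piKernel (fun k => (C k).direct j) x s := by
    intro z
    have hm : Measurable fun y : ∀ i k, Y i k => y j.succ := measurable_pi_apply _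
    rw [← Measure.map_apply hm hs, parallel_map_user]
    simp only [kernel_map_succ, Function.update_self]
    rfl
  simp [this]

instance (k : κ) : IsMarkovKernel ((C k).joint.map Prod.fst) :=
  Kernel.IsMarkovKernel.map _ measurable_fst

instance (k : κ) : IsMarkovKernel ((C k).joint.map Prod.snd) :=
  Kernel.IsMarkovKernel.map _ measurable_snd

theorem measurable_tail_swap :
    Measurable fun (z : ∀ i k, X i k) k (j : Fin m) => z j.succ k :=
  measurable_pi_iff.2 fun k => measurable_pi_iff.2 fun j =>
    (measurable_pi_apply k).comp (measurable_pi_apply j.succ)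

/-- The joint law of the interference on all carriers. -/
def interference (q : ∀ i, Measure (∀ k, X i k)) : Measure (∀ k, V k) :=
  piKernel (fun k => (C k).joint.map Prod.fst) ∘ₘ
    (Measure.pi q).map fun z k (j : Fin m) => z j.succ k

/-- Given its own input, receiver `0` sees a carrierwise function of the interference. The
interference may be dependent across carriers, through the inputs of the other users. -/
theorem tin_parallel_zero (q : ∀ i, Measure (∀ k, X i k)) [∀ i, IsProbabilityMeasure (q i)]
    (x : ∀ k, X 0 k) :
    tin (parallel fun k => (C k).kernel) q 0 x =
      (interference C q).map fun v k => (C k).f (x k) (v k) := by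
  have hf : ∀ k, Measurable ((C k).f (x k)) := fun k =>
    (C k).measurable_f.comp measurable_prodMk_left
  have hF : Measurable fun (v : ∀ k, V k) k => (C k).f (x k) (v k) :=
    measurable_pi_iff.2 fun k => (hf k).comp (measurable_pi_apply k)
  ext s hs
  rw [tin_apply (parallel fun k => (C k).kernel) q 0 x hs, Measure.map_apply hF hs, interference,
    Measure.bind_apply (hF hs) (Kernel.aemeasurable _),
    lintegral_map (Kernel.measurable_coe _ (hF hs)) measurable_tail_swap]
  refine lintegral_congr fun z => ?_
  have hm : Measurable fun y : ∀ i k, Y i k => y 0 := measurable_pi_apply _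
  rw [← Measure.map_apply hm hs, parallel_map_user, piKernel_apply,
    ← Measure.map_apply hF hs]
  have h : ∀ k, IsProbabilityMeasure ((((C k).joint.map Prod.fst) fun j => z j.succ k).map
      ((C k).f (x k))) := fun k => Measure.isProbabilityMeasure_map (hf k).aemeasurable
  rw [Measure.pi_map_pi fun k => (hf k).aemeasurable]
  simp only [kernel_map_zero, Function.update_self]
  rfl

/-- Here the noisy interference condition enters. The law of the interference is that of the outputs
of receivers `1, …, m`, processed on each carrier by its own kernel `D k`, so data processing
applies. These output vectors are independent across users, so their total correlations across
carriers add up. Only the law of `V` given the inputs matters, not its coupling with the outputs. -/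
theorem totalCorr_interference_le (hC : ∀ k, (C k).Degraded) (q : ∀ i, Measure (∀ k, X i k))
    [∀ i, IsProbabilityMeasure (q i)] :
    totalCorr (interference C q) ≤
      ∑ j : Fin m, totalCorr ((piKernel fun k => (C k).direct j) ∘ₘ q j.succ) := by
  choose D hD hDe using hC
  set μ : Measure (∀ k, ∀ j : Fin m, X j.succ k) :=
    (Measure.pi q).map fun z k (j : Fin m) => z j.succ k with hμ
  have hμp : IsProbabilityMeasure μ :=
    Measure.isProbabilityMeasure_map measurable_tail_swap.aemeasurable
  set P : ∀ j : Fin m, Measure (∀ k, Y j.succ k) :=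
    fun j => (piKernel fun k => (C k).direct j) ∘ₘ q j.succ with hP
  have h1 : interference C q =
      piKernel D ∘ₘ (piKernel (fun k => (C k).joint.map Prod.snd) ∘ₘ μ) := by
    rw [interference, ← hμ, Measure.comp_assoc]
    congr 1
    ext1 x
    rw [Kernel.comp_apply, piKernel_apply, piKernel_apply, piKernel_comp_pi]
    congr 1
    funext k
    rw [hDe, Kernel.comp_apply]
  have h2 : piKernel (fun k => (C k).joint.map Prod.snd) ∘ₘ μ =
      (Measure.pi P).map fun y k (j : Fin m) => y j k := by
    have h3 : Measure.pi P = piKernel (fun j : Fin m => piKernel fun k => (C k).direct j) ∘ₘ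
        Measure.pi fun j : Fin m => q j.succ := (piKernel_comp_pi _ _).symm
    ext s hs
    have hs' := (measurable_swap_pi (X := fun (k : κ) (j : Fin m) => Y j.succ k)) hs
    rw [Measure.map_apply measurable_swap_pi hs, h3, Measure.bind_apply hs' (Kernel.aemeasurable _),
      ← pi_map_tail, lintegral_map (Kernel.measurable_coe _ hs')
        (measurable_pi_iff.2 fun j => measurable_pi_apply _),
      Measure.bind_apply hs (Kernel.aemeasurable _), hμ,
      lintegral_map (Kernel.measurable_coe _ hs) measurable_tail_swap]
    refine lintegral_congr fun z => ?_
    rw [← Measure.map_apply measurable_swap_pi hs]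
    congr 1
    simp only [piKernel_apply]
    rw [pi_pi_map_swap fun (k : κ) (j : Fin m) => (C k).direct j (z j.succ k)]
    congr 1
    funext k
    rw [Kernel.map_apply _ measurable_snd, (C k).joint_snd]
  rw [h1]
  refine (totalCorr_piKernel_le _ _).trans ?_
  have h4 : ∀ k, ((Measure.pi P).map fun y k (j : Fin m) => y j k).map (fun y => y k) =
      Measure.pi fun j => (P j).map fun y => y k := by
    intro k
    rw [Measure.map_map (measurable_pi_apply k) measurable_swap_pi,
      ← Measure.pi_map_pi fun j => (measurable_pi_apply k).aemeasurable]
    rfl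
  rw [h2, totalCorr]
  simp only [h4]
  -- After exchanging users and carriers, both arguments are products over users, for which
  -- divergences add up.
  rw [← pi_pi_map_swap fun (k : κ) (j : Fin m) => (P j).map fun y => y k]
  refine (klDiv_map_le _ _ measurable_swap_pi).trans ?_
  exact klDiv_pi_pi_le _ _

/-- **Independence across carriers is optimal** for parallel many-to-one interference channels with
noisy interference. -/
theorem sum_userInfo_parallel_le [∀ i k, StandardBorelSpace (X i k)] [∀ i k, Nonempty (X i k)]
    [∀ i k, StandardBorelSpace (Y i k)] (hC : ∀ k, (C k).Degraded)
    (q : ∀ i, ProbabilityMeasure (∀ k, X i k)) :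
    ∑ i, userInfo (parallel fun k => (C k).kernel) q i ≤
      ∑ k, ∑ i, userInfo (C k).kernel (fun j => carrierMarginal (q j) k) i := by
  classical
  set q' : ∀ i, Measure (∀ k, X i k) := fun i => q i with hq'
  set U := tin (parallel fun k => (C k).kernel) q' with hU
  set Uk := fun i k => tin (C k).kernel (fun j => (q' j).map fun x => x k) i with hUk
  have hmarg : ∀ i x k, (U i x).map (fun y => y k) = Uk i k (x k) := fun i x k =>
    tin_parallel_map_eval (fun k => (C k).kernel) q' i x k
  have hI : ∀ i k, userInfo (C k).kernel (fun j => carrierMarginal (q j) k) i =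
      mutualInfo ((q' i).map (fun x => x k) ⊗ₘ Uk i k) := fun i k => userInfo_eq _ _ _
  -- For receiver `0`, the correlation of the interference bounds the possible gain; the correlation
  -- of its own output is discarded.
  have h0 : mutualInfo (q' 0 ⊗ₘ U 0) ≤ totalCorr (interference C q') +
      ∑ k, mutualInfo ((q' 0).map (fun x => x k) ⊗ₘ Uk 0 k) := by
    refine le_self_add.trans (mutualInfo_add_totalCorr_le (U 0) (Uk 0) (hmarg 0) (fun x => ?_) _)
    have : IsProbabilityMeasure ((Measure.pi q').map fun z k (j : Fin m) => z j.succ k) :=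
      Measure.isProbabilityMeasure_map measurable_tail_swap.aemeasurable
    have : IsProbabilityMeasure (interference C q') := by
      rw [interference]; infer_instance
    rw [hU, tin_parallel_zero]
    exact totalCorr_map_le _ fun k => (C k).measurable_f.comp measurable_prodMk_left
  have hs : ∀ j : Fin m, mutualInfo (q' j.succ ⊗ₘ U j.succ) + totalCorr (U j.succ ∘ₘ q' j.succ) ≤
      ∑ k, mutualInfo ((q' j.succ).map (fun x => x k) ⊗ₘ Uk j.succ k) := by
    intro j
    refine (mutualInfo_add_totalCorr_le (U j.succ) (Uk j.succ) (hmarg _) (t := 0)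
      (fun x => ?_) _).trans_eq (zero_add _)
    rw [hU, tin_parallel_succ, piKernel_apply, totalCorr_pi]
  have hV : totalCorr (interference C q') ≤
      ∑ j : Fin m, totalCorr (U j.succ ∘ₘ q' j.succ) := by
    refine (totalCorr_interference_le C hC q').trans_eq ?_
    simp only [hU, tin_parallel_succ]
  rw [Finset.sum_comm]
  simp only [hI, userInfo_eq]
  rw [Fin.sum_univ_succ, Fin.sum_univ_succ]
  -- If the other users' total correlation is infinite, so is the sum of their single-carrier
  -- informations on the right, by `hs`. Otherwise it can be cancelled.
  by_cases hT : ∑ j : Fin m, totalCorr (U j.succ ∘ₘ q' j.succ) = ∞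
  · have hR : ∑ j : Fin m, ∑ k, mutualInfo ((q' j.succ).map (fun x => x k) ⊗ₘ Uk j.succ k) = ∞ :=
      top_unique (hT ▸ Finset.sum_le_sum fun j _ => le_add_self.trans (hs j))
    exact le_top.trans_eq (ENNReal.add_eq_top.2 (Or.inr hR)).symm
  · refine (ENNReal.add_le_add_iff_right hT).1 ?_
    rw [add_assoc, ← Finset.sum_add_distrib]
    calc mutualInfo (q' 0 ⊗ₘ U 0) + ∑ j : Fin m,
          (mutualInfo (q' j.succ ⊗ₘ U j.succ) + totalCorr (U j.succ ∘ₘ q' j.succ))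
        ≤ (∑ j : Fin m, totalCorr (U j.succ ∘ₘ q' j.succ) +
            ∑ k, mutualInfo ((q' 0).map (fun x => x k) ⊗ₘ Uk 0 k)) +
          ∑ j : Fin m, ∑ k, mutualInfo ((q' j.succ).map (fun x => x k) ⊗ₘ Uk j.succ k) :=
          add_le_add (h0.trans (add_le_add_left hV _)) (Finset.sum_le_sum fun j _ => hs j)
      _ = _ := by ring

end ManyToOne

/-! ### Fano's inequality -/

section Fano

variable {α β : Type*} [MeasurableSpace α] [MeasurableSpace β]

/-- One half of the Donsker-Varadhan variational formula. -/
theorem integral_le_klDiv_add_log {μ ν : Measure α} [IsProbabilityMeasure μ]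
    [IsProbabilityMeasure ν] (hfin : klDiv μ ν ≠ ∞) {g : α → ℝ} (hg : Measurable g) {b : ℝ}
    (hb : ∀ x, |g x| ≤ b) :
    ∫ x, g x ∂μ ≤ (klDiv μ ν).toReal + Real.log (∫ x, Real.exp (g x) ∂ν) := by
  obtain ⟨hac, hint⟩ := klDiv_ne_top_iff.1 hfin
  have hgμ : Integrable g μ := Integrable.of_bound hg.aestronglyMeasurable b
    (ae_of_all _ fun x => by simpa using hb x)
  have hgν : Integrable (fun x => Real.exp (g x)) ν :=
    Integrable.of_bound (Real.measurable_exp.comp hg).aestronglyMeasurable (Real.exp b)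
      (ae_of_all _ fun x => by
        rw [Real.norm_eq_abs, Real.abs_exp]
        exact Real.exp_le_exp.2 ((le_abs_self _).trans (hb x)))
  -- The claim is the nonnegativity of the divergence of `μ` from `ν` tilted by `g`.
  have := isProbabilityMeasure_tilted hgν
  have h1 := integral_llr_tilted_right hac hgμ hgν hint
  have h2 := integral_llr_add_sub_measure_univ_nonneg
    (hac.trans (absolutelyContinuous_tilted hgν)) (integrable_llr_tilted_right hac hgμ hint hgν)
  have h3 := toReal_klDiv_of_measure_eq hac (by simp)
  simp only [probReal_univ, add_sub_cancel_right] at h2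
  linarith

/-- The uniform law on a finite type. -/
def unif (M : Type*) [Fintype M] [MeasurableSpace M] : Measure M :=
  (Fintype.card M : ℝ≥0∞)⁻¹ • Measure.count

theorem lintegral_unif {M : Type*} [Fintype M] [MeasurableSpace M] [MeasurableSingletonClass M]
    (f : M → ℝ≥0∞) : ∫⁻ w, f w ∂(unif M) = (Fintype.card M : ℝ≥0∞)⁻¹ * ∑ w, f w := by
  rw [unif, lintegral_smul_measure, lintegral_count, tsum_fintype, smul_eq_mul]

instance {M : Type*} [Fintype M] [Nonempty M] [MeasurableSpace M] [MeasurableSingletonClass M] :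
    IsProbabilityMeasure (unif M) := by
  refine ⟨?_⟩
  have h := lintegral_unif (M := M) fun _ => 1
  rw [lintegral_one] at h
  rw [h]
  simp only [Finset.sum_const, Finset.card_univ, nsmul_eq_mul, mul_one]
  exact ENNReal.inv_mul_cancel (by simp) (by simp)

theorem pi_unif {ι : Type*} [Fintype ι] [DecidableEq ι] (M : ι → Type*) [∀ i, Fintype (M i)]
    [∀ i, Nonempty (M i)] [∀ i, MeasurableSpace (M i)] [∀ i, MeasurableSingletonClass (M i)] :
    Measure.pi (fun i => unif (M i)) = unif (∀ i, M i) := by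
  have hs : ∀ {N : Type _} [Fintype N] [MeasurableSpace N] [MeasurableSingletonClass N] (w : N),
      unif N {w} = (Fintype.card N : ℝ≥0∞)⁻¹ := by
    intro N _ _ _ w
    rw [unif, Measure.smul_apply, Measure.count_singleton, smul_eq_mul, mul_one]
  have hs' : ∀ i (w : M i), unif (M i) {w} = (Fintype.card (M i) : ℝ≥0∞)⁻¹ := by
    intro i w
    rw [unif, Measure.smul_apply, Measure.count_singleton, smul_eq_mul, mul_one]
  refine Measure.ext_of_singleton fun w => ?_
  rw [Measure.pi_singleton, hs]
  simp only [hs']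
  rw [Fintype.card_pi, Nat.cast_prod, ENNReal.prod_inv_distrib]
  intro i _ j _ _
  right
  simp

/-- This is Donsker-Varadhan with the test function `c` times the indicator of correct decoding,
where `exp c = |M| a`. Under the product law a guess is right with probability `1 / |M|`, so the
exponential moment is `1 - 1 / |M| + a`. Optimizing over `a` would produce the binary entropy;
keeping `a` free allows the limit in the error probability to be taken first and `a → ∞` afterwards.
-/
theorem fano {M : Type*} [Fintype M] [Nonempty M] [MeasurableSpace M] [MeasurableSingletonClass M]
    (ρ : Measure (M × β)) [IsProbabilityMeasure ρ] (hfst : ρ.fst = unif M)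
    (hfin : mutualInfo ρ ≠ ∞) {dec : β → M} (hdec : Measurable dec) {a : ℝ} (ha : 0 < a) :
    ρ.real {z | dec z.2 = z.1} * (Real.log (Fintype.card M) + Real.log a) ≤
      (mutualInfo ρ).toReal + Real.log (1 + a) := by
  set A : Set (M × β) := {z | dec z.2 = z.1} with hA
  have hAm : MeasurableSet A :=
    measurableSet_eq_fun (hdec.comp measurable_snd) measurable_fst
  have hcard : (0 : ℝ) < Fintype.card M := by exact_mod_cast Fintype.card_pos
  set σ := ρ.fst.prod ρ.snd with hσ
  have hσA : σ.real A = (Fintype.card M : ℝ)⁻¹ := by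
    rw [measureReal_def, hσ, Measure.prod_apply_symm hAm, hfst]
    have : ∀ b, unif M ((fun w => (w, b)) ⁻¹' A) = (Fintype.card M : ℝ≥0∞)⁻¹ := by
      intro b
      have : (fun w => (w, b)) ⁻¹' A = {dec b} := by
        ext w
        simp [hA, eq_comm]
      rw [this, unif, Measure.smul_apply, Measure.count_singleton, smul_eq_mul, mul_one]
    simp [this]
  set c := Real.log (Fintype.card M) + Real.log a with hc
  have hec : Real.exp c = Fintype.card M * a := by
    rw [hc, Real.exp_add, Real.exp_log hcard, Real.exp_log ha]
  have hg : Measurable (A.indicator fun _ => c) := measurable_const.indicator hAm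
  have hb : ∀ z, |A.indicator (fun _ => c) z| ≤ |c| := fun z => by
    by_cases hz : z ∈ A <;> simp [hz]
  have h := integral_le_klDiv_add_log (μ := ρ) (ν := σ) hfin hg hb
  rw [integral_indicator_const _ hAm, smul_eq_mul] at h
  have hexp : ∫ z, Real.exp (A.indicator (fun _ => c) z) ∂σ ≤ 1 + a := by
    have : ∀ z, Real.exp (A.indicator (fun _ => c) z) =
        1 + A.indicator (fun _ => Real.exp c - 1) z := by
      intro z
      by_cases hz : z ∈ A <;> simp [hz]
    simp only [this]
    rw [integral_add (integrable_const _) ((integrable_const _).indicator hAm),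
      integral_indicator_const _ hAm, hσA, hec]
    have : 0 < (Fintype.card M : ℝ)⁻¹ := inv_pos.2 hcard
    simp only [integral_const, probReal_univ, smul_eq_mul, one_mul]
    have h1 : (Fintype.card M : ℝ)⁻¹ * (Fintype.card M * a - 1) = a - (Fintype.card M : ℝ)⁻¹ := by
      field_simp
    rw [h1]
    linarith
  refine h.trans (add_le_add le_rfl (Real.log_le_log ?_ hexp))
  refine integral_exp_pos ?_
  exact Integrable.of_bound (Real.measurable_exp.comp hg).aestronglyMeasurable (Real.exp |c|)
    (ae_of_all _ fun z => by
      rw [Real.norm_eq_abs, Real.abs_exp]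
      exact Real.exp_le_exp.2 ((le_abs_self _).trans (hb z)))

end Fano

/-! ### Block codes as product channels -/

section Block

variable {ι : Type*} [Fintype ι] {κ : Type*} [Fintype κ] {X Y : ι → κ → Type*}
  [∀ i k, MeasurableSpace (X i k)] [∀ i k, MeasurableSpace (Y i k)]
  (W : ∀ k, Kernel (∀ i, X i k) (∀ i, Y i k)) [∀ k, IsMarkovKernel (W k)] {T : ℕ}

instance (x : Fin T → ∀ i k, X i k) : IsProbabilityMeasure (blockLaw (parallel W) x) := by
  unfold blockLaw; infer_instance

theorem blockLaw_map_user (x : Fin T → ∀ i k, X i k) (i : ι) :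
    (blockLaw (parallel W) x).map (fun y τ => y τ i) =
      Measure.pi fun τ => Measure.pi fun k => (W k fun j => x τ j k).map fun y => y i := by
  have : ∀ τ, IsProbabilityMeasure ((parallel W (x τ)).map fun y => y i) := fun τ =>
    Measure.isProbabilityMeasure_map (measurable_pi_apply i).aemeasurable
  rw [blockLaw, Measure.pi_map_pi fun τ => (measurable_pi_apply i).aemeasurable]
  simp only [parallel_map_user]

/-- For each receiver, a block of `T` uses is a single use of a parallel channel whose carriers are
the pairs of a time and a carrier. -/
theorem parallel_block_map_user (x : Fin T → ∀ i k, X i k) (i : ι) :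
    (parallel (X := fun i (z : Fin T × κ) => X i z.2) (Y := fun i (z : Fin T × κ) => Y i z.2)
      (fun z => W z.2) fun i z => x z.1 i z.2).map (fun y τ k => y i (τ, k)) =
      (blockLaw (parallel W) x).map fun y τ => y τ i := by
  have : ∀ τ k, IsProbabilityMeasure ((W k fun j => x τ j k).map fun y => y i) := fun τ k =>
    Measure.isProbabilityMeasure_map (measurable_pi_apply i).aemeasurable
  have hm : Measurable fun y : ∀ (i : ι) (z : Fin T × κ), Y i z.2 => y i := measurable_pi_apply i
  have hc : Measurable fun (y : ∀ z : Fin T × κ, Y i z.2) τ k => y (τ, k) :=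
    measurable_curry_pi (X := fun (_ : Fin T) k => Y i k)
  rw [blockLaw_map_user, ← pi_map_curry fun τ k => (W k fun j => x τ j k).map fun y => y i,
    ← parallel_map_user (X := fun i (z : Fin T × κ) => X i z.2)
      (Y := fun i (z : Fin T × κ) => Y i z.2) (fun z => W z.2) (fun i z => x z.1 i z.2) i,
    Measure.map_map hc hm]
  rfl

end Block

/-! ### The converse -/

section CodeLaw

variable {ι : Type*} [Fintype ι] {κ : Type*} [Fintype κ] {X Y : ι → κ → Type*}
  [∀ i k, MeasurableSpace (X i k)] [∀ i k, MeasurableSpace (Y i k)] {T : ℕ}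
  (c : Code (fun i => ∀ k, X i k) (fun i => ∀ k, Y i k) T)

instance (i : ι) : Nonempty (Fin (c.numMsg i)) := ⟨⟨0, c.numMsg_pos i⟩⟩

/-- The law of the input at time `τ` of user `i` on carrier `k`, for uniform messages. -/
def codeLaw (τ : Fin T) (i : ι) (k : κ) : ProbabilityMeasure (X i k) :=
  ⟨(unif (Fin (c.numMsg i))).map fun w => c.enc i w τ k,
    Measure.isProbabilityMeasure_map Measurable.of_discrete.aemeasurable⟩

/-- The law of the codeword of user `i`, for uniform messages. -/
def wordLaw (i : ι) : ProbabilityMeasure (∀ z : Fin T × κ, X i z.2) :=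
  ProbabilityMeasure.map ⟨unif (Fin (c.numMsg i)), inferInstance⟩
    (f := fun w (z : Fin T × κ) => c.enc i w z.1 z.2) Measurable.of_discrete.aemeasurable

theorem carrierMarginal_wordLaw (i : ι) (z : Fin T × κ) :
    carrierMarginal (wordLaw c i) z = codeLaw c z.1 i z.2 := by
  refine Subtype.ext ?_
  change ((unif (Fin (c.numMsg i))).map fun w (z : Fin T × κ) => c.enc i w z.1 z.2).map
    (fun x => x z) = (unif (Fin (c.numMsg i))).map fun w => c.enc i w z.1 z.2
  rw [Measure.map_map (measurable_pi_apply z) Measurable.of_discrete]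
  rfl

/-- Hence the symbol laws of an admissible code are feasible, with one slot for each channel use. -/
theorem codebookCost_eq (Q : CostConstraint X) (i : ι) (k : κ) :
    (T : ℝ≥0∞)⁻¹ * ∑ τ, ∫⁻ x, Q.cost i k x ∂(codeLaw c τ i k : Measure (X i k)) =
      Q.codebookCost i (c.enc i) k := by
  have h : ∀ τ, ∫⁻ x, Q.cost i k x ∂(codeLaw c τ i k : Measure (X i k)) =
      (Fintype.card (Fin (c.numMsg i)) : ℝ≥0∞)⁻¹ * ∑ w, Q.cost i k (c.enc i w τ k) := by
    intro τ
    rw [← lintegral_unif]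
    exact lintegral_map (Q.measurable_cost i k) Measurable.of_discrete
  simp only [h]
  rw [← Finset.mul_sum, Finset.sum_comm, CostConstraint.codebookCost, ← mul_assoc,
    ENNReal.mul_inv (by simp) (by simp), mul_comm (T : ℝ≥0∞)⁻¹]

variable [DecidableEq ι] (W : ∀ k, Kernel (∀ i, X i k) (∀ i, Y i k)) [∀ k, IsMarkovKernel (W k)]

theorem errorProb_le_one : errorProb (parallel W) c.enc c.dec ≤ 1 := by
  rw [errorProb]
  calc _ ≤ (Fintype.card (∀ i, Fin (c.numMsg i)) : ℝ≥0∞)⁻¹ *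
        ∑ w : ∀ i, Fin (c.numMsg i), 1 := by
        gcongr
        exact prob_le_one
    _ ≤ 1 := by
        simp only [Finset.sum_const, Finset.card_univ, nsmul_eq_mul, mul_one]
        exact ENNReal.inv_mul_le_one _

/-- The channel from the messages to the outputs. -/
def messageChannel : Kernel (∀ i, Fin (c.numMsg i)) (∀ i (z : Fin T × κ), Y i z.2) :=
  (parallel (X := fun i (z : Fin T × κ) => X i z.2) (Y := fun i (z : Fin T × κ) => Y i z.2)
    fun z => W z.2).comap (fun w i z => c.enc i (w i) z.1 z.2) Measurable.of_discrete

instance : IsMarkovKernel (messageChannel c W) := by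
  unfold messageChannel; infer_instance

/-- Fano is applied to the message and not to the codeword, as encoders need not be injective;
`userInfo_comap` passes from the messages to the codeword laws. -/
theorem fano_user [∀ i k, StandardBorelSpace (Y i k)] (i : ι) {a : ℝ} (ha : 1 ≤ a)
    (hfin : userInfo (parallel (X := fun i (z : Fin T × κ) => X i z.2)
      (Y := fun i (z : Fin T × κ) => Y i z.2) fun z => W z.2) (wordLaw c) i ≠ ∞) :
    (1 - (errorProb (parallel W) c.enc c.dec).toReal) * (Real.log (c.numMsg i) + Real.log a) ≤
      (userInfo (parallel (X := fun i (z : Fin T × κ) => X i z.2)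
        (Y := fun i (z : Fin T × κ) => Y i z.2) fun z => W z.2) (wordLaw c) i).toReal +
        Real.log (1 + a) := by
  set p : ∀ i, ProbabilityMeasure (Fin (c.numMsg i)) := fun i => ⟨unif _, inferInstance⟩ with hp
  have hu := userInfo_comap (parallel (X := fun i (z : Fin T × κ) => X i z.2)
    (Y := fun i (z : Fin T × κ) => Y i z.2) fun z => W z.2) p
    (e := fun i w z => c.enc i w z.1 z.2) (fun i => Measurable.of_discrete)
    Measurable.of_discrete i
  change userInfo (messageChannel c W) p i = userInfo _ (wordLaw c) i at hu
  rw [← hu] at hfin ⊢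
  rw [userInfo_eq] at hfin ⊢
  set ρ : Measure (Fin (c.numMsg i) × ∀ z : Fin T × κ, Y i z.2) :=
    (p i : Measure (Fin (c.numMsg i))) ⊗ₘ
      tin (messageChannel c W) (fun j => (p j : Measure (Fin (c.numMsg j)))) i with hρ
  have hcm : Measurable fun (y : ∀ z : Fin T × κ, Y i z.2) τ k => y (τ, k) :=
    measurable_curry_pi (X := fun (_ : Fin T) k => Y i k)
  set dec : (∀ z : Fin T × κ, Y i z.2) → Fin (c.numMsg i) :=
    fun y => c.dec i fun τ k => y (τ, k) with hdec
  have hdm : Measurable dec := (c.measurable_dec i).comp hcm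
  have hf := fano ρ (Measure.fst_compProd _ _) hfin hdm (zero_lt_one.trans_le ha)
  rw [Fintype.card_fin] at hf
  refine le_trans ?_ hf
  have hMpos : (1 : ℝ) ≤ c.numMsg i := by exact_mod_cast c.numMsg_pos i
  -- The assumption `1 ≤ a` makes the factor nonnegative, so the probability of correct decoding may
  -- be replaced by the smaller `1 - e`.
  refine mul_le_mul_of_nonneg_right ?_ (add_nonneg (Real.log_nonneg hMpos) (Real.log_nonneg ha))
  have hA : MeasurableSet {z : Fin (c.numMsg i) × ∀ z : Fin T × κ, Y i z.2 | dec z.2 = z.1} :=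
    measurableSet_eq_fun (hdm.comp measurable_snd) measurable_fst
  have hcompl := probReal_compl_eq_one_sub (μ := ρ) hA
  have hle : ρ {z | dec z.2 = z.1}ᶜ ≤ errorProb (parallel W) c.enc c.dec := by
    have hm : Measurable fun z : (∀ i, Fin (c.numMsg i)) × (∀ i (z : Fin T × κ), Y i z.2) =>
        (z.1 i, z.2 i) :=
      ((measurable_pi_apply i).comp measurable_fst).prodMk
        ((measurable_pi_apply i).comp measurable_snd)
    rw [hρ, ← compProd_tin (messageChannel c W)
      (fun j => (p j : Measure (Fin (c.numMsg j)))) i, Measure.map_apply hm hA.compl, Measure.compProd_apply (hm hA.compl)]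
    simp only [hp, ProbabilityMeasure.coe_mk]
    rw [pi_unif, lintegral_unif, errorProb]
    gcongr with w
    have hym : Measurable fun y : ∀ i (z : Fin T × κ), Y i z.2 =>
        fun (τ : Fin T) (k : κ) => y i (τ, k) := hcm.comp (measurable_pi_apply i)
    have hyb : Measurable fun (y : Fin T → ∀ i k, Y i k) (τ : Fin T) => y τ i :=
      measurable_pi_iff.2 fun τ => (measurable_pi_apply i).comp (measurable_pi_apply τ)
    have hBm : MeasurableSet {y : Fin T → ∀ k, Y i k | c.dec i y ≠ w i} :=
      (c.measurable_dec i (measurableSet_singleton (w i))).compl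
    have hblock := congrArg (fun μ => μ {y : Fin T → ∀ k, Y i k | c.dec i y ≠ w i})
      (parallel_block_map_user W (fun τ i => c.enc i (w i) τ) i)
    rw [Measure.map_apply hym hBm, Measure.map_apply hyb hBm] at hblock
    exact (show messageChannel c W w _ = _ from hblock).trans_le
      (measure_mono fun y hy => Exists.intro i hy)
  have hle' : ρ.real {z | dec z.2 = z.1}ᶜ ≤ (errorProb (parallel W) c.enc c.dec).toReal :=
    ENNReal.toReal_mono ((errorProb_le_one c W).trans_lt ENNReal.one_lt_top).ne hle
  linarith

end CodeLaw

section Converse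

variable {m : ℕ} {κ : Type*} [Fintype κ] {X Y : Fin (m + 1) → κ → Type*} {V : κ → Type*}
  [∀ i k, MeasurableSpace (X i k)] [∀ i k, StandardBorelSpace (X i k)] [∀ i k, Nonempty (X i k)]
  [∀ i k, MeasurableSpace (Y i k)] [∀ i k, StandardBorelSpace (Y i k)]
  [∀ k, MeasurableSpace (V k)]
  (C : ∀ k, ManyToOne (fun i => X i k) (fun i => Y i k) (V k))

/-- With pairs (time, carrier) as carriers, optimality of independence across carriers is also the
single-letterization over time. The times of the code become the slots of the input laws, which
explains the factor `N + 1`. -/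
theorem sum_userInfo_wordLaw_le (hC : ∀ k, (C k).Degraded) {N : ℕ}
    (c : Code (fun i => ∀ k, X i k) (fun i => ∀ k, Y i k) (N + 1)) :
    ∑ i, userInfo (parallel (X := fun i (z : Fin (N + 1) × κ) => X i z.2)
        (Y := fun i (z : Fin (N + 1) × κ) => Y i z.2) fun z => (C z.2).kernel) (wordLaw c) i ≤
      ((N + 1 : ℕ) : ℝ≥0∞) * ∑ k, ∑ i, carrierInfo (fun k => (C k).kernel) (codeLaw c) i k := by
  refine (ManyToOne.sum_userInfo_parallel_le (fun z : Fin (N + 1) × κ => C z.2)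
    (fun z => hC z.2) (wordLaw c)).trans_eq ?_
  simp only [carrierMarginal_wordLaw, carrierInfo]
  rw [Fintype.sum_prod_type, Finset.sum_comm, Finset.mul_sum]
  refine Finset.sum_congr rfl fun k _ => ?_
  rw [Finset.sum_comm, Finset.mul_sum]
  refine Finset.sum_congr rfl fun i _ => ?_
  rw [← mul_assoc, ENNReal.mul_inv_cancel (by simp) (by simp), one_mul]

theorem code_converse (hC : ∀ k, (C k).Degraded) {N : ℕ}
    (c : Code (fun i => ∀ k, X i k) (fun i => ∀ k, Y i k) (N + 1)) {S : ℝ≥0∞} (hS : S ≠ ∞)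
    (hle : ∑ k, ∑ i, carrierInfo (fun k => (C k).kernel) (codeLaw c) i k ≤ S)
    {a : ℝ} (ha : 1 ≤ a) :
    (1 - (errorProb (parallel fun k => (C k).kernel) c.enc c.dec).toReal) * ∑ i, c.rate i ≤
      S.toReal + (m + 1) * (Real.log (1 + a) -
        (1 - (errorProb (parallel fun k => (C k).kernel) c.enc c.dec).toReal) * Real.log a) := by
  set e := (errorProb (parallel fun k => (C k).kernel) c.enc c.dec).toReal with he
  have he0 : 0 ≤ e := ENNReal.toReal_nonneg
  have he1 : e ≤ 1 := ENNReal.toReal_le_of_le_ofReal zero_le_one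
    (by simpa using errorProb_le_one c fun k => (C k).kernel)
  have hsum : ∑ i, userInfo (parallel (X := fun i (z : Fin (N + 1) × κ) => X i z.2)
      (Y := fun i (z : Fin (N + 1) × κ) => Y i z.2) fun z => (C z.2).kernel) (wordLaw c) i ≤
      ((N + 1 : ℕ) : ℝ≥0∞) * S :=
    (sum_userInfo_wordLaw_le C hC c).trans (by gcongr)
  have htop : ((N + 1 : ℕ) : ℝ≥0∞) * S ≠ ∞ := ENNReal.mul_ne_top (by simp) hS
  have hfin : ∀ i, userInfo (parallel (X := fun i (z : Fin (N + 1) × κ) => X i z.2)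
      (Y := fun i (z : Fin (N + 1) × κ) => Y i z.2) fun z => (C z.2).kernel) (wordLaw c) i ≠ ∞ :=
    fun i => ((Finset.single_le_sum (fun _ _ => zero_le) (Finset.mem_univ i)).trans
      hsum |>.trans_lt htop.lt_top).ne
  have h1 := Finset.sum_le_sum fun i (_ : i ∈ Finset.univ) =>
    fano_user c (fun k => (C k).kernel) i ha (hfin i)
  rw [← he, ← Finset.mul_sum, Finset.sum_add_distrib, Finset.sum_add_distrib,
    ← ENNReal.toReal_sum fun i _ => hfin i] at h1
  simp only [Finset.sum_const, Finset.card_univ, Fintype.card_fin, nsmul_eq_mul, Nat.cast_add,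
    Nat.cast_one] at h1
  have h2 := ENNReal.toReal_mono htop hsum
  rw [ENNReal.toReal_mul, ENNReal.toReal_natCast] at h2
  have hrate : ∑ i, Real.log (c.numMsg i) = ((N + 1 : ℕ) : ℝ) * ∑ i, c.rate i := by
    rw [Finset.mul_sum]
    refine Finset.sum_congr rfl fun i _ => ?_
    rw [Code.rate]
    field_simp
  rw [hrate] at h1
  have hN : (1 : ℝ) ≤ ((N + 1 : ℕ) : ℝ) := by norm_cast; omega
  -- The Fano remainder is nonnegative, so multiplying it by `N + 1` only weakens the bound. The
  -- remainder is not divided by the length, and code lengths need not grow.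
  have hlog : 0 ≤ Real.log (1 + a) - (1 - e) * Real.log a := by
    have h3 : Real.log a ≤ Real.log (1 + a) := Real.log_le_log (by linarith) (by linarith)
    have h4 : 0 ≤ Real.log a := Real.log_nonneg ha
    nlinarith
  have hm : (0 : ℝ) ≤ m + 1 := by positivity
  have h5 := mul_nonneg hm hlog
  have h6 : ((N + 1 : ℕ) : ℝ) * ((1 - e) * ∑ i, c.rate i) ≤
      ((N + 1 : ℕ) : ℝ) * (S.toReal + (m + 1) * (Real.log (1 + a) - (1 - e) * Real.log a)) := by
    nlinarith
  exact le_of_mul_le_mul_left h6 (by linarith)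

theorem sumCapacity_le [DecidableEq κ] (hC : ∀ k, (C k).Degraded) (Q : CostConstraint X) :
    sumCapacity (fun k => (C k).kernel) Q ≤
      ⨆ (N : ℕ) (p : Fin (N + 1) → ∀ i k, ProbabilityMeasure (X i k)) (_ : Q.Feasible p),
        ∑ k, ∑ i, carrierInfo (fun k => (C k).kernel) p i k := by
  set S : ℝ≥0∞ := ⨆ (N : ℕ) (p : Fin (N + 1) → ∀ i k, ProbabilityMeasure (X i k))
    (_ : Q.Feasible p), ∑ k, ∑ i, carrierInfo (fun k => (C k).kernel) p i k with hS
  by_cases htop : S = ∞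
  · rw [htop]; exact le_top
  have key : {R : Fin (m + 1) → ℝ | Achievable (fun k => (C k).kernel) Q R} ⊆
      {R | ∑ i, R i ≤ S.toReal} := by
    rintro R ⟨T, c, hT, hrate, hcost, herr⟩
    have hbound : ∀ n, ∀ a : ℝ, 1 ≤ a →
        (1 - (errorProb (parallel fun k => (C k).kernel) (c n).enc (c n).dec).toReal) *
          ∑ i, R i ≤ S.toReal + (m + 1) * (Real.log (1 + a) -
          (1 - (errorProb (parallel fun k => (C k).kernel) (c n).enc (c n).dec).toReal) *
            Real.log a) := by
      intro n a ha
      have hr := hrate n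
      have hq := hcost n
      have hTn := hT n
      -- The type of the code depends on its length, so both are generalized before the positive
      -- length is written as `N + 1`.
      generalize c n = c' at hr hq ⊢
      generalize T n = T' at hTn c' 
      obtain ⟨N, rfl⟩ : ∃ N, T' = N + 1 := ⟨T' - 1, by omega⟩
      have hfeas : Q.Feasible (codeLaw c') := by
        intro i
        have := hq i
        convert this using 1
        funext k
        exact codebookCost_eq c' Q i k
      have h := code_converse C hC c' htop
        (le_iSup₂_of_le N (codeLaw c') (le_iSup_of_le hfeas le_rfl)) ha
      simpa only [hr] using h
    have herr' : Tendsto (fun n => (errorProb (parallel fun k => (C k).kernel)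
        (c n).enc (c n).dec).toReal) atTop (𝓝 0) :=
      (ENNReal.tendsto_toReal ENNReal.zero_ne_top).comp herr
    -- For fixed `a` the error tends to zero. The remainder `log (1 + a) - log a` then vanishes as
    -- `a` grows.
    have hlim : ∀ a : ℝ, 1 ≤ a → ∑ i, R i ≤ S.toReal + (m + 1) * (Real.log (1 + a) - Real.log a) := by
      intro a ha
      have hone : Tendsto (fun n => 1 - (errorProb (parallel fun k => (C k).kernel)
          (c n).enc (c n).dec).toReal) atTop (𝓝 1) := by
        simpa using tendsto_const_nhds.sub herr'
      have hl : Tendsto _ atTop (𝓝 (1 * ∑ i, R i)) := hone.mul_const (∑ i, R i)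
      have hr : Tendsto _ atTop (𝓝 (S.toReal + (m + 1) * (Real.log (1 + a) - 1 * Real.log a))) :=
        ((hone.mul_const (Real.log a)).const_sub (Real.log (1 + a))).const_mul ((m : ℝ) + 1)
          |>.const_add S.toReal
      have := le_of_tendsto_of_tendsto' hl hr fun n => hbound n a ha
      simpa using this
    have hlog : Tendsto (fun n : ℕ => Real.log (1 + (n + 1 : ℝ)) - Real.log (n + 1)) atTop (𝓝 0) := by
      have h1 : ∀ n : ℕ, Real.log (1 + (n + 1 : ℝ)) - Real.log (n + 1) =
          Real.log (1 + 1 / ((n : ℝ) + 1)) := by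
        intro n
        have : (0 : ℝ) < n + 1 := by positivity
        rw [← Real.log_div (by positivity) (by positivity)]
        congr 1
        field_simp
        ring
      simp only [h1]
      have h2 : Tendsto (fun n : ℕ => 1 + 1 / ((n : ℝ) + 1)) atTop (𝓝 1) := by
        simpa using tendsto_one_div_add_atTop_nhds_zero_nat.const_add (1 : ℝ)
      have := (Real.continuousAt_log one_ne_zero).tendsto.comp h2
      rw [Real.log_one] at this
      exact this
    have hfinal : Tendsto _ atTop (𝓝 (S.toReal + ((m : ℝ) + 1) * 0)) :=
      (hlog.const_mul ((m : ℝ) + 1)).const_add S.toReal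
    have := ge_of_tendsto' hfinal fun n : ℕ => hlim (n + 1) (by
      have : (0 : ℝ) ≤ n := n.cast_nonneg
      linarith)
    simpa using this
  have hclosed : IsClosed {R : Fin (m + 1) → ℝ | ∑ i, R i ≤ S.toReal} :=
    isClosed_le (by fun_prop) continuous_const
  refine iSup₂_le fun R hR => ?_
  have h := closure_minimal key hclosed hR
  exact (ENNReal.ofReal_le_ofReal h).trans ENNReal.ofReal_toReal_le

end Converse

/-! ### Bounded test functions -/

section Test

variable {α : Type*} [MeasurableSpace α]

/-- The other half of the Donsker-Varadhan variational formula. -/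
theorem exists_bounded_test (ρ σ : Measure α) [IsProbabilityMeasure ρ] [IsProbabilityMeasure σ]
    {a : ℝ≥0} (h : (a : ℝ≥0∞) < klDiv ρ σ) :
    ∃ (g : α → ℝ) (b : ℝ), Measurable g ∧ (∀ x, |g x| ≤ b) ∧
      ∫⁻ x, ENNReal.ofReal (Real.exp (g x)) ∂σ ≤ 1 ∧ (a : ℝ) ≤ ∫ x, g x ∂ρ := by
  by_cases hac : ρ ≪ σ
  -- Without absolute continuity, a large multiple of the indicator of a `σ`-null set of positive
  -- `ρ`-measure has arbitrarily large mean and exponential moment one.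
  swap
  · obtain ⟨A, hA, hσA, hρA⟩ : ∃ A, MeasurableSet A ∧ σ A = 0 ∧ ρ A ≠ 0 := by
      by_contra hcon
      push Not at hcon
      exact hac (Measure.AbsolutelyContinuous.mk fun s hs h0 => hcon s hs h0)
    have hpos : 0 < ρ.real A := ENNReal.toReal_pos hρA (measure_ne_top ρ A)
    set c : ℝ := a / ρ.real A with hc
    have hc0 : 0 ≤ c := div_nonneg a.2 hpos.le
    refine ⟨A.indicator fun _ => c, c, measurable_const.indicator hA, fun x => ?_, ?_, ?_⟩
    · by_cases hx : x ∈ A <;> simp [hx, abs_of_nonneg hc0, hc0]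
    · have : (fun x => ENNReal.ofReal (Real.exp (A.indicator (fun _ => c) x))) =ᵐ[σ] fun _ => 1 := by
        have h0 : ∀ᵐ x ∂σ, x ∉ A := measure_eq_zero_iff_ae_notMem.1 hσA
        filter_upwards [h0] with x hx
        simp [hx]
      rw [lintegral_congr_ae this]
      simp
    · rw [integral_indicator_const _ hA, smul_eq_mul, hc]
      field_simp
      exact le_rfl
  set d : α → ℝ := fun x => (ρ.rnDeriv σ x).toReal with hd
  have hdm : Measurable d := (Measure.measurable_rnDeriv ρ σ).ennreal_toReal
  have hd0 : ∀ x, 0 ≤ d x := fun x => ENNReal.toReal_nonneg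
  have hdi : Integrable d σ := Measure.integrable_toReal_rnDeriv
  have hd1 : ∫ x, d x ∂σ = 1 := by
    rw [hd, Measure.integral_toReal_rnDeriv hac, probReal_univ]
  -- The density is clipped to `[1 / (n + 3), n + 3]`. The shift by `3 > e` gives `log (n + 3) ≥ 1`,
  -- which keeps `u n` below nonnegative where the density is cut off.
  set dn : ℕ → α → ℝ := fun n x => max ((n + 3 : ℝ)⁻¹) (min (d x) (n + 3)) with hdn
  have hN : ∀ n : ℕ, (3 : ℝ) ≤ n + 3 := fun n => by
    have : (0 : ℝ) ≤ n := n.cast_nonneg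
    linarith
  have hNinv : ∀ n : ℕ, (0 : ℝ) < (n + 3 : ℝ)⁻¹ := fun n => inv_pos.2 (by linarith [hN n])
  have hNinv1 : ∀ n : ℕ, (n + 3 : ℝ)⁻¹ ≤ 1 := fun n => inv_le_one_of_one_le₀ (by linarith [hN n])
  have hdnpos : ∀ n x, 0 < dn n x := fun n x => lt_max_of_lt_left (hNinv n)
  have hdnm : ∀ n, Measurable (dn n) := fun n =>
    measurable_const.max (hdm.min measurable_const)
  have hlogb : ∀ n x, |Real.log (dn n x)| ≤ Real.log (n + 3) := by
    intro n x
    rw [abs_le, ← Real.log_inv]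
    refine ⟨Real.log_le_log (hNinv n) (le_max_left _ _), Real.log_le_log (hdnpos n x) ?_⟩
    exact max_le ((hNinv1 n).trans (by linarith [hN n])) (min_le_right _ _)
  set u : ℕ → α → ℝ := fun n x => d x * Real.log (dn n x) - d x + 1 with hu
  have hum : ∀ n, Measurable (u n) := fun n =>
    ((hdm.mul (Real.measurable_log.comp (hdnm n))).sub hdm).add_const 1
  have hu0 : ∀ n x, 0 ≤ u n x := by
    intro n x
    by_cases hx : d x ≤ n + 3
    · have h1 : d x ≤ dn n x := (le_min le_rfl hx).trans (le_max_right _ _)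
      have h2 := klFun_nonneg (hd0 x)
      rw [klFun_apply] at h2
      rcases (hd0 x).eq_or_lt with h0 | h0
      · simp [hu, ← h0]
      · have h3 := mul_le_mul_of_nonneg_left (Real.log_le_log h0 h1) (hd0 x)
        simp only [hu]
        linarith
    · push Not at hx
      have h1 : dn n x = n + 3 := by
        simp only [hdn]
        rw [min_eq_right hx.le, max_eq_right ((hNinv1 n).trans (by linarith [hN n]))]
      have h2 : 1 ≤ Real.log (n + 3) := by
        rw [Real.le_log_iff_exp_le (by linarith [hN n])]
        exact (Real.exp_one_lt_d9.le.trans (by norm_num)).trans (hN n)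
      have h3 := mul_le_mul_of_nonneg_left h2 (hd0 x)
      simp only [hu, h1]
      linarith
  have hulim : ∀ x, Tendsto (fun n => u n x) atTop (𝓝 (klFun (d x))) := by
    intro x
    rcases (hd0 x).eq_or_lt with h0 | h0
    · have : ∀ n, u n x = klFun (d x) := fun n => by simp [hu, ← h0, klFun_zero]
      simp only [this]
      exact tendsto_const_nhds
    · refine tendsto_const_nhds.congr' ?_
      obtain ⟨n₁, hn₁⟩ := exists_nat_ge (d x)
      obtain ⟨n₂, hn₂⟩ := exists_nat_ge ((d x)⁻¹)
      filter_upwards [eventually_ge_atTop n₁, eventually_ge_atTop n₂] with n h1 h2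
      have h1' : d x ≤ n + 3 := hn₁.trans (by
        have : (n₁ : ℝ) ≤ n := by exact_mod_cast h1
        linarith)
      have h2' : (n + 3 : ℝ)⁻¹ ≤ d x := by
        have : (n₂ : ℝ) ≤ n := by exact_mod_cast h2
        exact inv_le_of_inv_le₀ h0 (by linarith)
      have h3 : dn n x = d x := by
        simp only [hdn]
        rw [min_eq_left h1', max_eq_right h2']
      simp only [hu, h3, klFun_apply]
      ring
  -- Since `u n ≥ 0` tends to `klFun` of the density, Fatou's lemma applies even if the divergence
  -- is infinite.
  have hfatou : klDiv ρ σ ≤ liminf (fun n => ∫⁻ x, ENNReal.ofReal (u n x) ∂σ) atTop := by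
    rw [klDiv_eq_lintegral_klFun_of_ac hac]
    refine le_trans (le_of_eq ?_) (lintegral_liminf_le fun n => (hum n).ennreal_ofReal)
    refine lintegral_congr fun x => ?_
    exact ((ENNReal.continuous_ofReal.tendsto _).comp (hulim x)).liminf_eq.symm
  obtain ⟨b, hab, hbl⟩ := ENNReal.lt_iff_exists_nnreal_btwn.1 (h.trans_le hfatou)
  have hab' : (a : ℝ) < b := by exact_mod_cast hab
  have hlog : Tendsto (fun n : ℕ => Real.log (1 + (n + 3 : ℝ)⁻¹)) atTop (𝓝 0) := by
    have h1 : Tendsto (fun n : ℕ => (n + 3 : ℝ)⁻¹) atTop (𝓝 0) :=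
      tendsto_inv_atTop_zero.comp (tendsto_atTop_add_const_right _ _ tendsto_natCast_atTop_atTop)
    have h2 : Tendsto (fun n : ℕ => 1 + (n + 3 : ℝ)⁻¹) atTop (𝓝 1) := by
      simpa using h1.const_add (1 : ℝ)
    have h3 := (Real.continuousAt_log one_ne_zero).tendsto.comp h2
    rw [Real.log_one] at h3
    exact h3
  obtain ⟨n, hn1, hn2⟩ := ((eventually_lt_of_lt_liminf hbl).and
    (hlog.eventually (gt_mem_nhds (sub_pos.2 hab')))).exists
  have hlogi : Integrable (fun x => Real.log (dn n x)) ρ :=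
    Integrable.of_bound (Real.measurable_log.comp (hdnm n)).aestronglyMeasurable _
      (ae_of_all _ fun x => by simpa using hlogb n x)
  have hdl : Integrable (fun x => d x * Real.log (dn n x)) σ := by
    refine hdi.mul_bdd (c := Real.log (n + 3))
      (Real.measurable_log.comp (hdnm n)).aestronglyMeasurable (ae_of_all _ fun x => ?_)
    simpa using hlogb n x
  have huint : ∫ x, u n x ∂σ = ∫ x, Real.log (dn n x) ∂ρ := by
    have h1 : ∫ x, d x * Real.log (dn n x) ∂σ = ∫ x, Real.log (dn n x) ∂ρ := by
      simpa [hd] using integral_rnDeriv_smul (f := fun x => Real.log (dn n x)) hac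
    have h2 : ∫ x, (d x * Real.log (dn n x) - d x) ∂σ = _ := integral_sub hdl hdi
    have h3 : ∫ x, u n x ∂σ = ∫ x, (d x * Real.log (dn n x) - d x) ∂σ + ∫ _, (1 : ℝ) ∂σ :=
      integral_add (hdl.sub hdi) (integrable_const (1 : ℝ))
    rw [h3, h2, h1, hd1]
    simp
  have hKpos : 0 < 1 + (n + 3 : ℝ)⁻¹ := by linarith [hNinv n]
  -- The clipped density is at most the density plus `1 / (n + 3)`, so dividing by `1 + 1 / (n + 3)`
  -- normalizes the exponential moment. The logarithm of this constant is smaller than the gap `b -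
  -- a` by the choice of `n`.
  refine ⟨fun x => Real.log (dn n x) - Real.log (1 + (n + 3 : ℝ)⁻¹),
    Real.log (n + 3) + |Real.log (1 + (n + 3 : ℝ)⁻¹)|,
    (Real.measurable_log.comp (hdnm n)).sub_const _, fun x => ?_, ?_, ?_⟩
  · exact (abs_sub _ _).trans (add_le_add (hlogb n x) le_rfl)
  · have h1 : ∀ x, Real.exp (Real.log (dn n x) - Real.log (1 + (n + 3 : ℝ)⁻¹)) ≤
        (d x + (n + 3 : ℝ)⁻¹) / (1 + (n + 3 : ℝ)⁻¹) := by
      intro x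
      rw [Real.exp_sub, Real.exp_log (hdnpos n x), Real.exp_log hKpos]
      refine div_le_div_of_nonneg_right (max_le ?_ ?_) hKpos.le
      · linarith [hd0 x]
      · exact (min_le_left _ _).trans (by linarith [hNinv n])
    have hint : Integrable (fun x => (d x + (n + 3 : ℝ)⁻¹) / (1 + (n + 3 : ℝ)⁻¹)) σ :=
      (hdi.add (integrable_const _)).div_const _
    calc _ ≤ ∫⁻ x, ENNReal.ofReal ((d x + (n + 3 : ℝ)⁻¹) / (1 + (n + 3 : ℝ)⁻¹)) ∂σ :=
          lintegral_mono fun x => ENNReal.ofReal_le_ofReal (h1 x)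
      _ = ENNReal.ofReal (∫ x, (d x + (n + 3 : ℝ)⁻¹) / (1 + (n + 3 : ℝ)⁻¹) ∂σ) :=
          (ofReal_integral_eq_lintegral_ofReal hint (ae_of_all _ fun x =>
            div_nonneg (add_nonneg (hd0 x) (hNinv n).le) hKpos.le)).symm
      _ = 1 := by
          rw [integral_div, integral_add hdi (integrable_const _), hd1]
          simp [hKpos.ne']
  · rw [integral_sub hlogi (integrable_const _)]
    have h1 : Integrable (u n) σ := (hdl.sub hdi).add (integrable_const _)
    rw [← ofReal_integral_eq_lintegral_ofReal h1 (ae_of_all _ (hu0 n)), huint,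
      ← ENNReal.ofReal_coe_nnreal] at hn1
    have h2 := (ENNReal.ofReal_lt_ofReal_iff_of_nonneg b.2).1 hn1
    simp only [integral_const, probReal_univ, smul_eq_mul, one_mul]
    simp only [NNReal.val_eq_coe] at h2
    linarith

end Test

/-! ### Sums of independent bounded variables -/

/-- Chebyshev's inequality: each of the `T` independent terms has variance at most `B ^ 2`. The
index type is arbitrary, so that the bound serves both for the times of a block and for all symbols
of a codebook. -/
theorem measure_sum_le_le {J : Type*} [Fintype J] {T : ℕ} (hJ : Fintype.card J = T) (hT : 0 < T)
    {A : J → Type*} [∀ τ, MeasurableSpace (A τ)]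
    (μ : ∀ τ, Measure (A τ)) [∀ τ, IsProbabilityMeasure (μ τ)] {X : ∀ τ, A τ → ℝ}
    (hX : ∀ τ, Measurable (X τ)) {B : ℝ} (hB : ∀ τ x, |X τ x| ≤ B) {c ε : ℝ} (hε : 0 < ε)
    (hc : c + T * ε ≤ ∑ τ, ∫ x, X τ x ∂(μ τ)) :
    Measure.pi μ {x | ∑ τ, X τ (x τ) ≤ c} ≤ ENNReal.ofReal (B ^ 2 / (T * ε ^ 2)) := by
  have hT' : (0 : ℝ) < T := by exact_mod_cast hT
  have hLp : ∀ τ, MemLp (X τ) 2 (μ τ) := fun τ =>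
    MemLp.of_bound (hX τ).aestronglyMeasurable B (ae_of_all _ fun x => by simpa using hB τ x)
  set S : (∀ τ, A τ) → ℝ := ∑ τ, fun x => X τ (x τ) with hS
  have hSx : ∀ x, S x = ∑ τ, X τ (x τ) := fun x => by simp [hS]
  have hSLp : MemLp S 2 (Measure.pi μ) := by
    rw [hS]
    exact memLp_finsetSum' _ fun τ _ => (hLp τ).comp_measurePreserving (measurePreserving_eval μ τ)
  have hmean : ∫ x, S x ∂(Measure.pi μ) = ∑ τ, ∫ x, X τ x ∂(μ τ) := by
    simp only [hSx]
    rw [integral_finsetSum _ fun τ _ => integrable_comp_eval ((hLp τ).integrable one_le_two)]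
    exact Finset.sum_congr rfl fun τ _ => integral_comp_eval (hX τ).aestronglyMeasurable
  have hvar : Var[S; Measure.pi μ] ≤ T * B ^ 2 := by
    rw [hS, variance_sum_pi hLp]
    have : ∀ τ, Var[X τ; μ τ] ≤ B ^ 2 := by
      intro τ
      refine (variance_le_expectation_sq (hX τ).aestronglyMeasurable).trans ?_
      have h1 : ∀ x, (X τ ^ 2) x ≤ B ^ 2 := fun x => by
        rw [Pi.pow_apply, ← sq_abs]
        exact pow_le_pow_left₀ (abs_nonneg _) (hB τ x) 2
      have h2 := integral_mono_of_nonneg (μ := μ τ) (ae_of_all _ fun x => by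
        rw [Pi.pow_apply]; exact sq_nonneg _) (integrable_const (B ^ 2)) (ae_of_all _ h1)
      simpa using h2
    calc ∑ τ, Var[X τ; μ τ] ≤ ∑ _τ : J, B ^ 2 := Finset.sum_le_sum fun τ _ => this τ
      _ = T * B ^ 2 := by simp [hJ]
  have hTε : 0 < T * ε := mul_pos hT' hε
  calc Measure.pi μ {x | ∑ τ, X τ (x τ) ≤ c}
      ≤ Measure.pi μ {x | T * ε ≤ |S x - ∫ x, S x ∂(Measure.pi μ)|} := by
        refine measure_mono fun x hx => ?_
        change ∑ τ, X τ (x τ) ≤ c at hx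
        change T * ε ≤ |S x - ∫ x, S x ∂(Measure.pi μ)|
        rw [hmean, hSx, abs_sub_comm]
        exact le_trans (by linarith) (le_abs_self _)
    _ ≤ ENNReal.ofReal (Var[S; Measure.pi μ] / (T * ε) ^ 2) := meas_ge_le_variance_div_sq hSLp hTε
    _ ≤ ENNReal.ofReal (B ^ 2 / (T * ε ^ 2)) := by
        refine ENNReal.ofReal_le_ofReal ?_
        rw [div_le_div_iff₀ (by positivity) (by positivity)]
        have : 0 ≤ T * ε ^ 2 := by positivity
        calc Var[S; Measure.pi μ] * (T * ε ^ 2) ≤ T * B ^ 2 * (T * ε ^ 2) :=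
              mul_le_mul_of_nonneg_right hvar this
          _ = B ^ 2 * (T * ε) ^ 2 := by ring

/-! ### Random coding with threshold decoding -/

section RandomCoding

variable {A B : Type*} [MeasurableSpace A] [MeasurableSpace B] {T M : ℕ}

/-- Some index at which a predicate holds, if there is one. -/
def pick (hM : 0 < M) (s : Fin M → Prop) : Fin M :=
  open Classical in if h : ∃ i, s i then h.choose else ⟨0, hM⟩

/-- The threshold decoder with the metric `∑ τ, g τ`. -/
def thresholdDec (hM : 0 < M) (g : Fin T → A × B → ℝ) (γ : ℝ) (b : Fin M → Fin T → A)
    (y : Fin T → B) : Fin M :=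
  pick hM fun i => γ < ∑ τ, g τ (b i τ, y τ)

theorem measurable_score {g : Fin T → A × B → ℝ} (hg : ∀ τ, Measurable (g τ)) :
    Measurable fun z : (Fin T → A) × (Fin T → B) => ∑ τ, g τ (z.1 τ, z.2 τ) :=
  Finset.measurable_sum _ fun τ _ => (hg τ).comp
    (((measurable_pi_apply τ).comp measurable_fst).prodMk
      ((measurable_pi_apply τ).comp measurable_snd))

theorem measurable_thresholdDec (hM : 0 < M) {g : Fin T → A × B → ℝ} (hg : ∀ τ, Measurable (g τ))
    (γ : ℝ) : Measurable (Function.uncurry (thresholdDec hM g γ)) := by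
  have h : Measurable fun (z : (Fin M → Fin T → A) × (Fin T → B)) (i : Fin M) =>
      γ < ∑ τ, g τ (z.1 i τ, z.2 τ) := by
    refine measurable_pi_iff.2 fun i => ?_
    have h1 : Measurable fun z : (Fin M → Fin T → A) × (Fin T → B) =>
        ∑ τ, g τ (z.1 i τ, z.2 τ) :=
      Finset.measurable_sum _ fun τ _ => (hg τ).comp
        (((measurable_pi_apply τ).comp ((measurable_pi_apply i).comp measurable_fst)).prodMk
          ((measurable_pi_apply τ).comp measurable_snd))
    exact measurableSet_setOfPred.1 (measurableSet_lt measurable_const h1)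
  exact (Measurable.of_discrete (f := pick hM)).comp h

theorem thresholdDec_ne (hM : 0 < M) {g : Fin T → A × B → ℝ} {γ : ℝ} {b : Fin M → Fin T → A}
    {y : Fin T → B} {w : Fin M} (h : thresholdDec hM g γ b y ≠ w) :
    ∑ τ, g τ (b w τ, y τ) ≤ γ ∨ ∃ i, i ≠ w ∧ γ < ∑ τ, g τ (b i τ, y τ) := by
  by_contra hcon
  push Not at hcon
  obtain ⟨h1, h2⟩ := hcon
  have hex : ∃ i, γ < ∑ τ, g τ (b i τ, y τ) := ⟨w, h1⟩
  apply h
  rw [thresholdDec, pick, dif_pos hex]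
  by_contra hne
  exact absurd hex.choose_spec (not_lt.2 (h2 _ hne))

/-- An error requires a low score of the sent codeword, which is the first term, or a high score of
another one. The output is independent of another codeword, so the exponential of its score has mean
at most one, and Markov's inequality bounds each of these events by `exp (-γ)`. -/
theorem random_coding (hM : 0 < M) (μ : Fin T → Measure A) [∀ τ, IsProbabilityMeasure (μ τ)]
    (U : Fin T → Kernel A B) [∀ τ, IsMarkovKernel (U τ)] {g : Fin T → A × B → ℝ}
    (hg : ∀ τ, Measurable (g τ))
    (hexp : ∀ τ, ∫⁻ z, ENNReal.ofReal (Real.exp (g τ z)) ∂((μ τ).prod (U τ ∘ₘ μ τ)) ≤ 1)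
    (γ : ℝ) (w : Fin M) :
    ∫⁻ b : Fin M → Fin T → A, piKernel U (b w) {y | thresholdDec hM g γ b y ≠ w}
        ∂(Measure.pi fun _ => Measure.pi μ) ≤
      (Measure.pi fun τ => μ τ ⊗ₘ U τ) {z | ∑ τ, g τ (z τ) ≤ γ} +
        M * ENNReal.ofReal (Real.exp (-γ)) := by
  have hsc := measurable_score hg
  set G : Set ((Fin T → A) × (Fin T → B)) := {z | ∑ τ, g τ (z.1 τ, z.2 τ) ≤ γ} with hG
  have hGm : MeasurableSet G := measurableSet_le hsc measurable_const
  have hf1 : Measurable fun a : Fin T → A => piKernel U a (Prod.mk a ⁻¹' G) :=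
    Kernel.measurable_kernel_prodMk_left hGm
  have hf2 : ∀ i : Fin M, Measurable fun b : Fin M → Fin T → A =>
      piKernel U (b w) (Prod.mk (b i) ⁻¹' Gᶜ) := by
    intro i
    have hw : Measurable fun b : Fin M → Fin T → A => b w := measurable_pi_apply w
    have h := Kernel.measurable_kernel_prodMk_left (κ := (piKernel U).comap _ hw)
      (t := {z : (Fin M → Fin T → A) × (Fin T → B) | (z.1 i, z.2) ∈ Gᶜ})
      ((((measurable_pi_apply i).comp measurable_fst).prodMk measurable_snd) hGm.compl)
    exact h
  have hpt : ∀ b : Fin M → Fin T → A, piKernel U (b w) {y | thresholdDec hM g γ b y ≠ w} ≤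
      piKernel U (b w) (Prod.mk (b w) ⁻¹' G) +
        ∑ i ∈ Finset.univ.erase w, piKernel U (b w) (Prod.mk (b i) ⁻¹' Gᶜ) := by
    intro b
    refine (measure_mono (t := (Prod.mk (b w) ⁻¹' G) ∪
      ⋃ i ∈ Finset.univ.erase w, (Prod.mk (b i) ⁻¹' Gᶜ)) fun y hy => ?_).trans
      ((measure_union_le _ _).trans (add_le_add le_rfl (measure_biUnion_finset_le _ _)))
    rcases thresholdDec_ne hM hy with h | ⟨i, hi, h⟩
    · exact Or.inl h
    · refine Or.inr ?_
      simp only [Set.mem_iUnion]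
      exact ⟨i, Finset.mem_erase.2 ⟨hi, Finset.mem_univ i⟩, not_le.2 h⟩
  refine (lintegral_mono hpt).trans ?_
  have hf1w : Measurable fun b : Fin M → Fin T → A => piKernel U (b w) (Prod.mk (b w) ⁻¹' G) :=
    hf1.comp (measurable_pi_apply w)
  rw [lintegral_add_left hf1w, lintegral_finsetSum _ fun i _ => hf2 i]
  refine add_le_add (le_of_eq ?_) ?_
  · have h1 := (measurePreserving_eval (fun _ : Fin M => Measure.pi μ) w).lintegral_comp hf1
    have hzm : Measurable fun (z : (Fin T → A) × (Fin T → B)) τ => (z.1 τ, z.2 τ) :=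
      measurable_pi_iff.2 fun τ => ((measurable_pi_apply τ).comp measurable_fst).prodMk
        ((measurable_pi_apply τ).comp measurable_snd)
    have hset : MeasurableSet {z : Fin T → A × B | ∑ τ, g τ (z τ) ≤ γ} :=
      measurableSet_le (Finset.measurable_sum _ fun τ _ => (hg τ).comp (measurable_pi_apply τ))
        measurable_const
    rw [← pi_compProd_piKernel, Measure.map_apply hzm hset, Measure.compProd_apply (hzm hset)]
    exact h1
  · have hi : ∀ i ∈ Finset.univ.erase w, ∫⁻ b : Fin M → Fin T → A,
        piKernel U (b w) (Prod.mk (b i) ⁻¹' Gᶜ) ∂(Measure.pi fun _ => Measure.pi μ) ≤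
        ENNReal.ofReal (Real.exp (-γ)) := by
      intro i hi
      have hiw : w ≠ i := (Finset.ne_of_mem_erase hi).symm
      -- Codeword `i` is drawn separately: the output depends only on codeword `w`, so the two are
      -- independent.
      rw [lintegral_pi_update _ i (hf2 i)]
      simp only [Function.update_of_ne hiw, Function.update_self]
      have h1 : ∀ a : Fin T → A, ∫⁻ b : Fin M → Fin T → A, piKernel U (b w) (Prod.mk a ⁻¹' Gᶜ)
          ∂(Measure.pi fun _ => Measure.pi μ) =
          (piKernel U ∘ₘ Measure.pi μ) (Prod.mk a ⁻¹' Gᶜ) := by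
        intro a
        have hm := measurable_prodMk_left (x := a) hGm.compl
        rw [Measure.bind_apply hm (Kernel.aemeasurable _)]
        exact (measurePreserving_eval (fun _ : Fin M => Measure.pi μ) w).lintegral_comp
          (Kernel.measurable_coe (piKernel U) hm)
      simp only [h1]
      rw [← Measure.prod_apply hGm.compl, piKernel_comp_pi]
      set P := (Measure.pi μ).prod (Measure.pi fun τ => U τ ∘ₘ μ τ) with hP
      have hexpm : Measurable fun z : (Fin T → A) × (Fin T → B) =>
          ENNReal.ofReal (Real.exp (∑ τ, g τ (z.1 τ, z.2 τ))) :=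
        (Real.measurable_exp.comp hsc).ennreal_ofReal
      have hmarkov := mul_meas_ge_le_lintegral (μ := P) hexpm (ENNReal.ofReal (Real.exp γ))
      have hprod : ∫⁻ z, ENNReal.ofReal (Real.exp (∑ τ, g τ (z.1 τ, z.2 τ))) ∂P ≤ 1 := by
        have hgm : ∀ τ, Measurable fun z => ENNReal.ofReal (Real.exp (g τ z)) := fun τ =>
          (Real.measurable_exp.comp (hg τ)).ennreal_ofReal
        have hzm : Measurable fun (z : (Fin T → A) × (Fin T → B)) τ => (z.1 τ, z.2 τ) :=
          measurable_pi_iff.2 fun τ => ((measurable_pi_apply τ).comp measurable_fst).prodMk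
            ((measurable_pi_apply τ).comp measurable_snd)
        have h2 := lintegral_map (μ := P) (f := fun z : Fin T → A × B =>
          ∏ τ, ENNReal.ofReal (Real.exp (g τ (z τ)))) (Finset.measurable_prod _ fun τ _ =>
            (hgm τ).comp (measurable_pi_apply τ)) hzm
        rw [hP, pi_prod_pi, lintegral_pi_prod _ hgm, ← hP] at h2
        calc _ = ∫⁻ z, ∏ τ, ENNReal.ofReal (Real.exp (g τ (z.1 τ, z.2 τ))) ∂P := by
              refine lintegral_congr fun z => ?_
              rw [Real.exp_sum, ENNReal.ofReal_prod_of_nonneg fun _ _ => (Real.exp_pos _).le]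
          _ = _ := h2.symm
          _ ≤ 1 := Finset.prod_le_one' fun τ _ => hexp τ
      have hle : P Gᶜ ≤ P {z | ENNReal.ofReal (Real.exp γ) ≤
          ENNReal.ofReal (Real.exp (∑ τ, g τ (z.1 τ, z.2 τ)))} := by
        refine measure_mono fun z hz => ?_
        exact ENNReal.ofReal_le_ofReal (Real.exp_le_exp.2 (not_le.1
          (show ¬ ∑ τ, g τ (z.1 τ, z.2 τ) ≤ γ from hz)).le)
      calc P Gᶜ = ENNReal.ofReal (Real.exp (-γ)) * (ENNReal.ofReal (Real.exp γ) * P Gᶜ) := by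
            rw [← mul_assoc, ← ENNReal.ofReal_mul (Real.exp_pos _).le, ← Real.exp_add]
            simp
        _ ≤ ENNReal.ofReal (Real.exp (-γ)) * 1 := by
            gcongr
            exact (mul_le_mul_right hle _).trans (hmarkov.trans hprod)
        _ = _ := mul_one _
    refine (Finset.sum_le_sum hi).trans ?_
    rw [Finset.sum_const, nsmul_eq_mul]
    gcongr
    exact (Finset.card_le_univ _).trans (by simp)

end RandomCoding

/-! ### Periodic sums and approximation from below -/

theorem sum_range_mul_periodic {α : Type*} [AddCommMonoid α] {N : ℕ} (a : Fin (N + 1) → α)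
    (n : ℕ) :
    ∑ τ ∈ Finset.range (n * (N + 1)), a (Fin.ofNat (N + 1) τ) = n • ∑ s, a s := by
  induction n with
  | zero => simp
  | succ n ih =>
    rw [add_mul, one_mul, Finset.sum_range_add, ih, succ_nsmul, Finset.sum_range]
    congr 1
    refine Finset.sum_congr rfl fun s _ => ?_
    congr 1
    ext
    simp [Fin.ofNat, Nat.mod_eq_of_lt s.2]

/-- Only complete periods are counted; the incomplete last one costs at most one period sum. -/
theorem mul_sum_le_sum_periodic {N : ℕ} {a : Fin (N + 1) → ℝ} (ha : ∀ s, 0 ≤ a s) (T : ℕ) :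
    (T : ℝ) * ((∑ s, a s) / (N + 1)) - ∑ s, a s ≤ ∑ τ : Fin T, a (Fin.ofNat (N + 1) τ) := by
  set n := T / (N + 1) with hn
  have hS : 0 ≤ ∑ s, a s := Finset.sum_nonneg fun s _ => ha s
  have h1 : n * (N + 1) ≤ T := Nat.div_mul_le_self T (N + 1)
  have h2 : T < (n + 1) * (N + 1) := by
    rw [mul_comm]
    exact Nat.lt_mul_div_succ T (Nat.succ_pos N)
  have h3 : ∑ τ ∈ Finset.range (n * (N + 1)), a (Fin.ofNat (N + 1) τ) ≤
      ∑ τ ∈ Finset.range T, a (Fin.ofNat (N + 1) τ) :=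
    Finset.sum_le_sum_of_subset_of_nonneg (Finset.range_subset_range.2 h1) fun _ _ _ => ha _
  rw [sum_range_mul_periodic, nsmul_eq_mul, Finset.sum_range] at h3
  refine le_trans ?_ h3
  have h4 : (T : ℝ) ≤ (n + 1) * (N + 1) := by exact_mod_cast h2.le
  have h5 : (0 : ℝ) < N + 1 := by positivity
  have h6 : (T : ℝ) * ((∑ s, a s) / (N + 1)) ≤ (n + 1) * ∑ s, a s := by
    rw [mul_div_assoc', div_le_iff₀ h5]
    nlinarith
  linarith

theorem sum_periodic_le {N : ℕ} (a : Fin (N + 1) → ℝ≥0∞) (T : ℕ) :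
    ∑ τ : Fin T, a (Fin.ofNat (N + 1) τ) ≤ ((T / (N + 1) + 1 : ℕ) : ℝ≥0∞) * ∑ s, a s := by
  rw [← nsmul_eq_mul, ← sum_range_mul_periodic, ← Finset.sum_range
    (f := fun τ => a (Fin.ofNat (N + 1) τ))]
  refine Finset.sum_le_sum_of_subset (Finset.range_subset_range.2 ?_)
  rw [mul_comm]
  exact (Nat.lt_mul_div_succ T (Nat.succ_pos N)).le

/-- An infinite term can carry the whole sum alone. If all terms are finite, a small common amount
is subtracted; terms that it exhausts become zero, whence the alternative in the conclusion. -/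
theorem exists_lt_sum {ι : Type*} [Fintype ι] {f : ι → ℝ≥0∞} {R : ℝ≥0∞} (h : R < ∑ i, f i) :
    ∃ a : ι → ℝ≥0, (∀ i, a i = 0 ∨ (a i : ℝ≥0∞) < f i) ∧ R < ((∑ i, a i : ℝ≥0) : ℝ≥0∞) := by
  classical
  by_cases htop : ∃ i, f i = ∞
  · obtain ⟨i, hi⟩ := htop
    lift R to ℝ≥0 using h.ne_top
    refine ⟨fun j => if j = i then R + 1 else 0, fun j => ?_, ?_⟩
    · by_cases hj : j = i
      · subst hj
        right
        rw [hi]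
        exact ENNReal.coe_lt_top
      · simp [hj]
    · simp only [Finset.sum_ite_eq', Finset.mem_univ, if_true]
      exact_mod_cast lt_add_one R
  · push Not at htop
    lift f to ι → ℝ≥0 using htop
    have hcont : Tendsto (fun ε : ℝ≥0 => ((∑ i, (f i - ε) : ℝ≥0) : ℝ≥0∞)) (𝓝[>] 0)
        (𝓝 ((∑ i, (f i - 0) : ℝ≥0) : ℝ≥0∞)) := by
      refine (Continuous.tendsto (f := fun ε : ℝ≥0 => ((∑ i, (f i - ε) : ℝ≥0) : ℝ≥0∞)) ?_ 0).mono_left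
        nhdsWithin_le_nhds
      fun_prop
    have hlt : R < ((∑ i, (f i - 0) : ℝ≥0) : ℝ≥0∞) := by simpa using h
    obtain ⟨ε, hε, hε0⟩ := ((hcont.eventually (lt_mem_nhds hlt)).and self_mem_nhdsWithin).exists
    refine ⟨fun i => f i - ε, fun i => ?_, hε⟩
    rcases le_or_gt (f i) ε with hi | hi
    · exact Or.inl (tsub_eq_zero_of_le hi)
    · right
      exact ENNReal.coe_lt_coe.2 (tsub_lt_self (zero_le.trans_lt hi) hε0)

/-! ### Reliability of separate random coding -/

theorem msgCount_pos (T : ℕ) (r : ℝ≥0) : 0 < msgCount T r :=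
  Nat.ceil_pos.2 (Real.exp_pos _)

instance (T : ℕ) (r : ℝ≥0) : Nonempty (Fin (msgCount T r)) := ⟨⟨0, msgCount_pos T r⟩⟩

theorem msgCount_zero (T : ℕ) : msgCount T 0 = 1 := by
  simp [msgCount]

theorem msgCount_le (T : ℕ) (r : ℝ≥0) : (msgCount T r : ℝ) ≤ 2 * Real.exp (T * r) := by
  have h1 : (msgCount T r : ℝ) < Real.exp (T * r) + 1 := Nat.ceil_lt_add_one (Real.exp_pos _).le
  have h2 : 1 ≤ Real.exp (T * r) := Real.one_le_exp (by positivity)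
  linarith

section SingleUser

variable {A B : Type*} [MeasurableSpace A] [MeasurableSpace B]

/-- Random coding for a single user over a periodic memoryless channel. -/
theorem exists_periodic_decoder {N : ℕ} (μ : Fin (N + 1) → Measure A)
    [∀ s, IsProbabilityMeasure (μ s)] (U : Fin (N + 1) → Kernel A B) [∀ s, IsMarkovKernel (U s)]
    {r : ℝ≥0} (hr : r = 0 ∨
      (r : ℝ≥0∞) < ((N + 1 : ℕ) : ℝ≥0∞)⁻¹ * ∑ s, mutualInfo (μ s ⊗ₘ U s)) :
    ∃ (δ : ∀ T, (Fin (msgCount T r) → Fin T → A) → (Fin T → B) → Fin (msgCount T r))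
      (e : ℕ → ℝ≥0∞), (∀ T, Measurable (Function.uncurry (δ T))) ∧ Tendsto e atTop (𝓝 0) ∧
      ∀ᶠ T in atTop, ∀ w,
        ∫⁻ b, piKernel (fun τ : Fin T => U (Fin.ofNat (N + 1) τ)) (b w) {y | δ T b y ≠ w}
          ∂(Measure.pi fun _ => Measure.pi fun τ : Fin T => μ (Fin.ofNat (N + 1) τ)) ≤ e T := by
  rcases hr with rfl | hr
  -- At rate zero there is exactly one message, so no error can occur even if the information
  -- vanishes.
  · refine ⟨fun T _ _ => ⟨0, msgCount_pos T 0⟩, 0, fun T => measurable_const, tendsto_const_nhds,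
      Eventually.of_forall fun T w => ?_⟩
    have : ∀ v : Fin (msgCount T 0), v = w := by
      have : Subsingleton (Fin (msgCount T 0)) := by
        rw [msgCount_zero]; infer_instance
      exact fun v => Subsingleton.elim v w
    simp [this]
  have hN0 : ((N + 1 : ℕ) : ℝ≥0∞) ≠ 0 := by simp
  have hNt : ((N + 1 : ℕ) : ℝ≥0∞) ≠ ∞ := by simp
  have hr' : ((N + 1 : ℕ) : ℝ≥0∞) * r < ∑ s, mutualInfo (μ s ⊗ₘ U s) := by
    have h := (ENNReal.mul_lt_mul_iff_right hN0 hNt).2 hr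
    rwa [← mul_assoc, ENNReal.mul_inv_cancel hN0 hNt, one_mul] at h
  obtain ⟨a, ha, hasum⟩ := exists_lt_sum hr'
  have htest : ∀ s, ∃ (g : A × B → ℝ) (b : ℝ), Measurable g ∧ (∀ x, |g x| ≤ b) ∧
      ∫⁻ x, ENNReal.ofReal (Real.exp (g x)) ∂((μ s).prod (U s ∘ₘ μ s)) ≤ 1 ∧
      (a s : ℝ) ≤ ∫ x, g x ∂(μ s ⊗ₘ U s) := by
    intro s
    rcases ha s with h0 | h0
    · exact ⟨fun _ => 0, 0, measurable_const, by simp, by simp, by simp [h0]⟩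
    · refine exists_bounded_test _ _ ?_
      rwa [mutualInfo, Measure.fst_compProd, Measure.snd_compProd] at h0
  choose g b hg hb hexp hmean using htest
  set S : ℝ := ∑ s, (a s : ℝ) with hS
  have hS0 : 0 ≤ S := Finset.sum_nonneg fun s _ => (a s).2
  have hN1 : (0 : ℝ) < N + 1 := by positivity
  have hrS : (N + 1 : ℝ) * r < S := by
    have : ((N + 1 : ℕ) : ℝ≥0) * r < ∑ s, a s := by exact_mod_cast hasum
    have h2 := NNReal.coe_lt_coe.2 this
    push_cast at h2
    exact h2
  -- The gap between information and rate is split into three parts: the excess of the threshold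
  -- over the rate, the deviation in Chebyshev's inequality, and the loss from an incomplete period.
  set η : ℝ := (S / (N + 1) - r) / 3 with hη
  have hη0 : 0 < η := by
    have : (r : ℝ) < S / (N + 1) := (lt_div_iff₀ hN1).2 (by linarith)
    rw [hη]
    linarith
  set D : ℝ := ∑ s, |b s| with hD
  have hbD : ∀ s x, |g s x| ≤ D := fun s x =>
    ((hb s x).trans (le_abs_self _)).trans
      (Finset.single_le_sum (f := fun s => |b s|) (fun _ _ => abs_nonneg _) (Finset.mem_univ s))
  refine ⟨fun T => thresholdDec (msgCount_pos T r) (fun τ => g (Fin.ofNat (N + 1) τ)) (T * (r + η)),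
    fun T => ENNReal.ofReal (D ^ 2 / (T * η ^ 2)) + ENNReal.ofReal (2 * Real.exp (-(T * η))),
    fun T => measurable_thresholdDec _ (fun τ => hg _) _, ?_, ?_⟩
  · have h1 : Tendsto (fun T : ℕ => D ^ 2 / (T * η ^ 2)) atTop (𝓝 0) :=
      Tendsto.const_div_atTop (tendsto_natCast_atTop_atTop.atTop_mul_const (by positivity)) _
    have h2 : Tendsto (fun T : ℕ => 2 * Real.exp (-(T * η))) atTop (𝓝 (2 * 0)) :=
      (Real.tendsto_exp_neg_atTop_nhds_zero.comp
        (tendsto_natCast_atTop_atTop.atTop_mul_const hη0)).const_mul 2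
    rw [mul_zero] at h2
    have := (ENNReal.tendsto_ofReal h1).add (ENNReal.tendsto_ofReal h2)
    simpa using this
  · obtain ⟨T₀, hT₀⟩ := exists_nat_ge (S / η)
    filter_upwards [eventually_ge_atTop T₀, eventually_gt_atTop 0] with T hT hTpos w
    have hTS : S ≤ T * η := by
      have : S / η ≤ T := hT₀.trans (by exact_mod_cast hT)
      exact (div_le_iff₀ hη0).1 this
    refine (random_coding (msgCount_pos T r) (fun τ : Fin T => μ (Fin.ofNat (N + 1) τ))
      (fun τ => U (Fin.ofNat (N + 1) τ)) (fun τ => hg _) (fun τ => hexp _) _ w).trans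
      (add_le_add ?_ ?_)
    · refine measure_sum_le_le (Fintype.card_fin T) hTpos _ (fun τ => hg _) (fun τ => hbD _) hη0 ?_
      have h1 := mul_sum_le_sum_periodic (a := fun s => (a s : ℝ)) (fun s => (a s).2) T
      have h2 : ∑ τ : Fin T, (a (Fin.ofNat (N + 1) τ) : ℝ) ≤ ∑ τ : Fin T,
          ∫ x, g (Fin.ofNat (N + 1) τ) x ∂(μ (Fin.ofNat (N + 1) τ) ⊗ₘ U (Fin.ofNat (N + 1) τ)) :=
        Finset.sum_le_sum fun τ _ => hmean _
      rw [← hS] at h1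
      have h3 : S / (N + 1) = r + 3 * η := by rw [hη]; ring
      rw [h3] at h1
      refine le_trans ?_ h2
      refine le_trans ?_ h1
      nlinarith
    · have h1 : (msgCount T r : ℝ≥0∞) = ENNReal.ofReal (msgCount T r : ℝ) := by simp
      rw [h1, ← ENNReal.ofReal_mul (by positivity)]
      refine ENNReal.ofReal_le_ofReal ?_
      calc (msgCount T r : ℝ) * Real.exp (-(T * (r + η)))
          ≤ 2 * Real.exp (T * r) * Real.exp (-(T * (r + η))) := by
            gcongr
            exact msgCount_le T r
        _ = 2 * Real.exp (-(T * η)) := by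
            rw [mul_assoc, ← Real.exp_add]
            congr 2
            ring

end SingleUser

section Reliable

variable {ι : Type*} [Fintype ι] [DecidableEq ι]

theorem tin_eq_bind {X Y : ι → Type*} [∀ i, MeasurableSpace (X i)] [∀ i, MeasurableSpace (Y i)]
    (W : Kernel (∀ i, X i) (∀ i, Y i)) (p : ∀ i, Measure (X i)) [∀ i, IsProbabilityMeasure (p i)]
    (i : ι) (a : X i) :
    tin W p i a = ((W.map fun y => y i).comap (fun z => Function.update z i a)
      ((measurable_update_pair i).comp measurable_prodMk_left)) ∘ₘ Measure.pi p := by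
  have hm : Measurable fun y : ∀ i, Y i => y i := measurable_pi_apply i
  ext s hs
  rw [tin_apply W p i a hs, Measure.bind_apply hs (Kernel.aemeasurable _)]
  refine lintegral_congr fun z => ?_
  rw [Kernel.comap_apply, Kernel.map_apply' _ hm _ hs]

variable {κ : Type*} [Fintype κ] [DecidableEq κ] {X Y : ι → κ → Type*}
  [∀ i k, MeasurableSpace (X i k)] [∀ i k, MeasurableSpace (Y i k)]

instance (W : ∀ k, Kernel (∀ i, X i k) (∀ i, Y i k)) [∀ k, IsMarkovKernel (W k)] (i : ι) (k : κ) :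
    IsMarkovKernel ((W k).map fun y => y i) :=
  Kernel.IsMarkovKernel.map _ (measurable_pi_apply i)

/-- For fixed messages, each user sends one fresh codeword on carrier `k`, so the symbols are
independent over both time and users. -/
theorem randomCodebooks_map {N : ℕ} (p : Fin (N + 1) → ∀ i k, ProbabilityMeasure (X i k))
    (r : ι → κ → ℝ≥0) (T : ℕ) (w : ∀ i k, Fin (msgCount T (r i k))) (k : κ) :
    (randomCodebooks p r T).map (fun c (τ : Fin T) j => c j k (w j k) τ) =
      Measure.pi fun τ : Fin T => Measure.pi fun j =>
        (p (Fin.ofNat (N + 1) τ) j k : Measure (X j k)) := by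
  set P : ∀ j, Measure (∀ k, Fin (msgCount T (r j k)) → Fin T → X j k) := fun j =>
    Measure.pi fun k => Measure.pi fun _ => Measure.pi fun τ : Fin T =>
      (p (Fin.ofNat (N + 1) τ) j k : Measure (X j k)) with hP
  have hm : ∀ j, Measurable fun c : ∀ k, Fin (msgCount T (r j k)) → Fin T → X j k =>
      c k (w j k) := fun j => (measurable_pi_apply (w j k)).comp (measurable_pi_apply k)
  have hPj : ∀ j, (P j).map (fun c => c k (w j k)) = Measure.pi fun τ : Fin T =>
      (p (Fin.ofNat (N + 1) τ) j k : Measure (X j k)) := by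
    intro j
    have h : (P j).map (fun c => c k (w j k)) =
        ((P j).map fun c => c k).map fun b => b (w j k) := by
      rw [Measure.map_map (measurable_pi_apply _) (measurable_pi_apply _)]
      rfl
    rw [h, hP, map_eval_pi, map_eval_pi]
  have : ∀ j, IsProbabilityMeasure ((P j).map fun c => c k (w j k)) := fun j => by
    rw [hPj]; infer_instance
  have h1 : (Measure.pi P).map (fun c j => c j k (w j k)) =
      Measure.pi fun j => Measure.pi fun τ : Fin T =>
        (p (Fin.ofNat (N + 1) τ) j k : Measure (X j k)) := by
    rw [Measure.pi_map_pi fun j => (hm j).aemeasurable]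
    simp only [hPj]
  have h2 := pi_pi_map_swap fun (τ : Fin T) j => (p (Fin.ofNat (N + 1) τ) j k : Measure (X j k))
  have hmm : Measurable fun (c : ∀ j k, Fin (msgCount T (r j k)) → Fin T → X j k) j =>
      c j k (w j k) := measurable_pi_iff.2 fun j => (hm j).comp (measurable_pi_apply j)
  rw [← h1, Measure.map_map measurable_swap_pi hmm] at h2
  exact h2

variable (W : ∀ k, Kernel (∀ i, X i k) (∀ i, Y i k)) [∀ k, IsMarkovKernel (W k)]

/-- The decoder does not see the other users' codebooks, which are independent of its own and have
independent symbols over time. Averaging over them replaces the interference by memoryless noise,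
and the channel becomes a product of the channels `tin`. -/
theorem lintegral_user_error {N : ℕ} (p : Fin (N + 1) → ∀ i k, ProbabilityMeasure (X i k))
    (r : ι → κ → ℝ≥0) (T : ℕ) (w : ∀ i k, Fin (msgCount T (r i k))) (i : ι) (k : κ)
    {δ : (Fin (msgCount T (r i k)) → Fin T → X i k) → (Fin T → Y i k) → Fin (msgCount T (r i k))}
    (hδ : Measurable (Function.uncurry δ)) :
    ∫⁻ c, piKernel (fun _ : Fin T => (W k).map fun y => y i) (fun τ j => c j k (w j k) τ)
        {y | δ (c i k) y ≠ w i k} ∂(randomCodebooks p r T) =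
      ∫⁻ b, piKernel (fun τ : Fin T =>
          tin (W k) (fun j => (p (Fin.ofNat (N + 1) τ) j k : Measure (X j k))) i) (b (w i k))
          {y | δ b y ≠ w i k}
        ∂(Measure.pi fun _ => Measure.pi fun τ : Fin T =>
          (p (Fin.ofNat (N + 1) τ) i k : Measure (X i k))) := by
  set K := piKernel (fun _ : Fin T => (W k).map fun y => y i) with hK
  have hset : MeasurableSet {z : (Fin (msgCount T (r i k)) → Fin T → X i k) × (Fin T → Y i k) |
      δ z.1 z.2 ≠ w i k} := (hδ (measurableSet_singleton (w i k))).compl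
  have hz : Measurable fun (c : Codebooks X r T) (τ : Fin T) j => c j k (w j k) τ :=
    measurable_pi_iff.2 fun τ => measurable_pi_iff.2 fun j => (measurable_pi_apply τ).comp
      ((measurable_pi_apply (w j k)).comp ((measurable_pi_apply k).comp (measurable_pi_apply j)))
  have hF : Measurable fun c : Codebooks X r T =>
      K (fun τ j => c j k (w j k) τ) {y | δ (c i k) y ≠ w i k} := by
    have hcik : Measurable fun c : Codebooks X r T => c i k :=
      (measurable_pi_apply k).comp (measurable_pi_apply i)
    exact Kernel.measurable_kernel_prodMk_left (κ := K.comap _ hz)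
      (t := {z : Codebooks X r T × (Fin T → Y i k) | δ (z.1 i k) z.2 ≠ w i k})
      (((hcik.comp measurable_fst).prodMk measurable_snd) hset)
  have hinner : ∀ (b : Fin T → X i k) {s : Set (Fin T → Y i k)}, MeasurableSet s →
      ∫⁻ c, K (fun τ => Function.update (fun j => c j k (w j k) τ) i (b τ)) s
        ∂(randomCodebooks p r T) = piKernel (fun τ : Fin T =>
          tin (W k) (fun j => (p (Fin.ofNat (N + 1) τ) j k : Measure (X j k))) i) b s := by
    intro b s hs
    have hu : ∀ τ, Measurable fun z : ∀ j, X j k => Function.update z i (b τ) := fun τ =>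
      (measurable_update_pair i).comp measurable_prodMk_left
    have h1 : Measurable fun z : Fin T → ∀ j, X j k =>
        K (fun τ => Function.update (z τ) i (b τ)) s :=
      (Kernel.measurable_coe K hs).comp (measurable_pi_iff.2 fun τ =>
        (hu τ).comp (measurable_pi_apply τ))
    have h2 := lintegral_map (μ := randomCodebooks p r T) h1 hz
    rw [randomCodebooks_map] at h2
    rw [← h2, piKernel_apply]
    simp only [tin_eq_bind]
    rw [← piKernel_comp_pi, Measure.bind_apply hs (Kernel.aemeasurable _)]
    rfl
  have hb : Measurable fun b : Fin (msgCount T (r i k)) → Fin T → X i k =>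
      piKernel (fun τ : Fin T =>
          tin (W k) (fun j => (p (Fin.ofNat (N + 1) τ) j k : Measure (X j k))) i) (b (w i k))
          {y | δ b y ≠ w i k} := by
    have hbw : Measurable fun b : Fin (msgCount T (r i k)) → Fin T → X i k => b (w i k) :=
      measurable_pi_apply (w i k)
    exact Kernel.measurable_kernel_prodMk_left (κ := (piKernel fun τ : Fin T =>
      tin (W k) (fun j => (p (Fin.ofNat (N + 1) τ) j k : Measure (X j k))) i).comap _ hbw) hset
  -- The codebooks of user `i` are drawn separately, leaving an inner average over those of the
  -- other users.
  rw [randomCodebooks, lintegral_pi_update _ i hF]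
  rw [← (measurePreserving_eval (fun k => Measure.pi fun _ : Fin (msgCount T (r i k)) =>
    Measure.pi fun τ : Fin T => (p (Fin.ofNat (N + 1) τ) i k : Measure (X i k))) k).lintegral_comp hb]
  refine lintegral_congr fun a => ?_
  have hs : MeasurableSet {y | δ (a k) y ≠ w i k} := measurable_prodMk_left hset
  refine Eq.trans ?_ (hinner (a k (w i k)) hs)
  refine lintegral_congr fun c => ?_
  have h1 : (fun (τ : Fin T) j => Function.update c i a j k (w j k) τ) =
      fun τ => Function.update (fun j => c j k (w j k) τ) i (a k (w i k) τ) := by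
    funext τ j
    by_cases hj : j = i
    · subst hj; simp
    · simp [hj]
  rw [h1, Function.update_self]

/-- A union bound over users and carriers; each decoder depends only on one marginal of the block
output. -/
theorem errorProb_separate_le {r : ι → κ → ℝ≥0} {T : ℕ} (δ : TINDecoders X Y r T)
    (hδ : ∀ i k, Measurable (Function.uncurry (δ i k))) (c : Codebooks X r T) :
    errorProb (parallel W) (separateEnc c) (separateDec δ c) ≤
      (Fintype.card (∀ i k, Fin (msgCount T (r i k))) : ℝ≥0∞)⁻¹ *
        ∑ w : ∀ i k, Fin (msgCount T (r i k)), ∑ i, ∑ k,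
          piKernel (fun _ : Fin T => (W k).map fun y => y i) (fun τ j => c j k (w j k) τ)
            {y | δ i k (c i k) y ≠ w i k} := by
  rw [errorProb]
  gcongr with w
  set x : Fin T → ∀ i k, X i k := fun τ i => separateEnc c i (w i) τ with hx
  have hterm : ∀ i k, blockLaw (parallel W) x {y | δ i k (c i k) (fun τ => y τ i k) ≠ w i k} =
      piKernel (fun _ : Fin T => (W k).map fun y => y i) (fun τ j => c j k (w j k) τ)
        {y | δ i k (c i k) y ≠ w i k} := by
    intro i k
    have hs : MeasurableSet {y | δ i k (c i k) y ≠ w i k} :=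
      (((hδ i k).comp measurable_prodMk_left) (measurableSet_singleton (w i k))).compl
    have hm1 : Measurable fun y : Fin T → ∀ i k, Y i k => fun τ => y τ i k :=
      measurable_pi_iff.2 fun τ => (measurable_pi_apply k).comp
        ((measurable_pi_apply i).comp (measurable_pi_apply τ))
    have hmt : Measurable fun y : ∀ i k, Y i k => y i k :=
      (measurable_pi_apply k).comp (measurable_pi_apply i)
    have hmi : Measurable fun y : ∀ i, Y i k => y i := measurable_pi_apply i
    have : ∀ τ, IsProbabilityMeasure ((parallel W (x τ)).map fun y => y i k) := fun τ =>
      Measure.isProbabilityMeasure_map hmt.aemeasurable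
    have h1 : (blockLaw (parallel W) x).map (fun y τ => y τ i k) =
        piKernel (fun _ : Fin T => (W k).map fun y => y i) (fun τ j => c j k (w j k) τ) := by
      rw [blockLaw, Measure.pi_map_pi fun τ => hmt.aemeasurable, piKernel_apply]
      congr 1
      funext τ
      rw [parallel_map_user_carrier, Kernel.map_apply _ hmi]
      rfl
    rw [← h1, Measure.map_apply hm1 hs]
    rfl
  calc blockLaw (parallel W) x {y | ∃ i, separateDec δ c i (fun τ => y τ i) ≠ w i}
      ≤ blockLaw (parallel W) x
          (⋃ i, ⋃ k, {y | δ i k (c i k) (fun τ => y τ i k) ≠ w i k}) := by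
        refine measure_mono fun y hy => ?_
        obtain ⟨i, hi⟩ := hy
        obtain ⟨k, hk⟩ := Function.ne_iff.1 hi
        exact Set.mem_iUnion₂.2 ⟨i, k, hk⟩
    _ ≤ ∑ i, ∑ k, blockLaw (parallel W) x {y | δ i k (c i k) (fun τ => y τ i k) ≠ w i k} :=
        (measure_iUnion_fintype_le _ _).trans
          (Finset.sum_le_sum fun i _ => measure_iUnion_fintype_le _ _)
    _ = _ := by simp only [hterm]

/-- Separate random coding with interference treated as noise is reliable at all rates below the
mutual informations. -/
theorem reliableTIN {N : ℕ} (p : Fin (N + 1) → ∀ i k, ProbabilityMeasure (X i k))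
    (r : ι → κ → ℝ≥0) (h : ∀ i k, r i k = 0 ∨ (r i k : ℝ≥0∞) < carrierInfo W p i k) :
    ReliableTIN W p r := by
  have hex := fun i k => exists_periodic_decoder (fun s => (p s i k : Measure (X i k)))
    (fun s => tin (W k) (fun j => (p s j k : Measure (X j k))) i) (r := r i k) (by
      have := h i k
      simp only [carrierInfo, userInfo_eq] at this
      exact this)
  choose δ e hδ he hle using hex
  refine ⟨fun T i k => δ i k T, fun T i k => hδ i k T, ?_⟩
  have hlim : Tendsto (fun T => ∑ i, ∑ k, e i k T) atTop (𝓝 0) := by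
    have := tendsto_finsetSum (Finset.univ : Finset ι) fun i _ =>
      tendsto_finsetSum (Finset.univ : Finset κ) fun k _ => he i k
    simpa using this
  refine tendsto_of_tendsto_of_tendsto_of_le_of_le' tendsto_const_nhds hlim
    (Eventually.of_forall fun _ => zero_le) ?_
  have hall : ∀ᶠ T in atTop, ∀ i k, ∀ w, _ :=
    eventually_all.2 fun i => eventually_all.2 fun k => hle i k
  filter_upwards [hall] with T hT
  have hFm : ∀ (w : ∀ i k, Fin (msgCount T (r i k))) i k, Measurable fun c : Codebooks X r T =>
      piKernel (fun _ : Fin T => (W k).map fun y => y i) (fun τ j => c j k (w j k) τ)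
        {y | δ i k T (c i k) y ≠ w i k} := by
    intro w i k
    have hz : Measurable fun (c : Codebooks X r T) (τ : Fin T) j => c j k (w j k) τ :=
      measurable_pi_iff.2 fun τ => measurable_pi_iff.2 fun j => (measurable_pi_apply τ).comp
        ((measurable_pi_apply (w j k)).comp ((measurable_pi_apply k).comp (measurable_pi_apply j)))
    have hcik : Measurable fun c : Codebooks X r T => c i k :=
      (measurable_pi_apply k).comp (measurable_pi_apply i)
    have hset : MeasurableSet {z : (Fin (msgCount T (r i k)) → Fin T → X i k) × (Fin T → Y i k) |
        δ i k T z.1 z.2 ≠ w i k} := (hδ i k T (measurableSet_singleton (w i k))).compl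
    exact Kernel.measurable_kernel_prodMk_left (κ := (piKernel _).comap _ hz)
      (t := {z : Codebooks X r T × (Fin T → Y i k) | δ i k T (z.1 i k) z.2 ≠ w i k})
      (((hcik.comp measurable_fst).prodMk measurable_snd) hset)
  refine (lintegral_mono fun c => errorProb_separate_le W (fun i k => δ i k T)
    (fun i k => hδ i k T) c).trans ?_
  rw [lintegral_const_mul _ (Finset.measurable_sum _ fun w _ => Finset.measurable_sum _ fun i _ =>
    Finset.measurable_sum _ fun k _ => hFm w i k),
    lintegral_finsetSum _ fun w _ => Finset.measurable_sum _ fun i _ =>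
      Finset.measurable_sum _ fun k _ => hFm w i k]
  have hw : ∀ w : ∀ i k, Fin (msgCount T (r i k)), ∫⁻ c, ∑ i, ∑ k,
      piKernel (fun _ : Fin T => (W k).map fun y => y i) (fun τ j => c j k (w j k) τ)
        {y | δ i k T (c i k) y ≠ w i k} ∂(randomCodebooks p r T) ≤ ∑ i, ∑ k, e i k T := by
    intro w
    rw [lintegral_finsetSum _ fun i _ => Finset.measurable_sum _ fun k _ => hFm w i k]
    refine Finset.sum_le_sum fun i _ => ?_
    rw [lintegral_finsetSum _ fun k _ => hFm w i k]
    refine Finset.sum_le_sum fun k _ => ?_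
    rw [lintegral_user_error W p r T w i k (hδ i k T)]
    exact hT i k (w i k)
  calc _ ≤ (Fintype.card (∀ i k, Fin (msgCount T (r i k))) : ℝ≥0∞)⁻¹ *
        ∑ _w : ∀ i k, Fin (msgCount T (r i k)), ∑ i, ∑ k, e i k T := by
        gcongr with w
        exact hw w
    _ = ∑ i, ∑ k, e i k T := by
        rw [Finset.sum_const, Finset.card_univ, nsmul_eq_mul, ← mul_assoc,
          ENNReal.inv_mul_cancel (Nat.cast_ne_zero.2 Fintype.card_ne_zero)
            (ENNReal.natCast_ne_top _), one_mul]

end Reliable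

/-! ### The law of large numbers for the costs of random codebooks -/

theorem tendsto_lintegral_sub_natCast {A : Type*} [MeasurableSpace A] (μ : Measure A)
    {b : A → ℝ≥0∞} (hb : Measurable b) (hfin : ∫⁻ x, b x ∂μ ≠ ∞) :
    Tendsto (fun n : ℕ => ∫⁻ x, b x - n ∂μ) atTop (𝓝 0) := by
  have hae : ∀ᵐ x ∂μ, b x < ∞ := ae_lt_top hb hfin
  have h := tendsto_lintegral_of_dominated_convergence (μ := μ) (F := fun (n : ℕ) x => b x - n)
    (f := fun _ => 0) b (fun n => hb.sub_const _) (fun n => ae_of_all _ fun x => tsub_le_self) hfin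
    (by
      filter_upwards [hae] with x hx
      have : ∀ᶠ n : ℕ in atTop, b x - n = 0 := by
        obtain ⟨n, hn⟩ := ENNReal.exists_nat_gt hx.ne
        filter_upwards [eventually_ge_atTop n] with j hj
        exact tsub_eq_zero_of_le (hn.le.trans (by exact_mod_cast hj))
      exact tendsto_const_nhds.congr' (this.mono fun n hn => hn.symm))
  simpa using h

section Costs

variable {A : Type*} [MeasurableSpace A] {N : ℕ} (μ : Fin (N + 1) → Measure A)
  [∀ s, IsProbabilityMeasure (μ s)]

theorem inv_mul_sum_periodic_le (a : Fin (N + 1) → ℝ≥0∞) {T : ℕ} (hT : 0 < T) :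
    (T : ℝ≥0∞)⁻¹ * ∑ τ : Fin T, a (Fin.ofNat (N + 1) τ) ≤
      ((N + 1 : ℕ) : ℝ≥0∞)⁻¹ * ∑ s, a s + (T : ℝ≥0∞)⁻¹ * ∑ s, a s := by
  have hT0 : (T : ℝ≥0∞) ≠ 0 := by exact_mod_cast hT.ne'
  have hTt : (T : ℝ≥0∞) ≠ ∞ := ENNReal.natCast_ne_top T
  have hdiv : ((T / (N + 1) : ℕ) : ℝ≥0∞) ≤ T * ((N + 1 : ℕ) : ℝ≥0∞)⁻¹ := by
    rw [← div_eq_mul_inv, ENNReal.le_div_iff_mul_le (by simp) (by simp)]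
    exact_mod_cast Nat.div_mul_le_self T (N + 1)
  calc (T : ℝ≥0∞)⁻¹ * ∑ τ : Fin T, a (Fin.ofNat (N + 1) τ)
      ≤ (T : ℝ≥0∞)⁻¹ * ((T * ((N + 1 : ℕ) : ℝ≥0∞)⁻¹ + 1) * ∑ s, a s) := by
        refine mul_le_mul_right ((sum_periodic_le a T).trans ?_) _
        refine mul_le_mul_left ?_ _
        rw [Nat.cast_add, Nat.cast_one]
        exact add_le_add hdiv le_rfl
    _ = _ := by
        rw [← mul_assoc, mul_add, ← mul_assoc, ENNReal.inv_mul_cancel hT0 hTt, one_mul, mul_one,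
          add_mul]

/-- The empirical cost of a random codebook exceeds its mean only with small probability. -/
theorem tendsto_measure_lt_cost {b : A → ℝ≥0∞} (hb : Measurable b) {c : ℝ≥0∞}
    (hc : ((N + 1 : ℕ) : ℝ≥0∞)⁻¹ * ∑ s, ∫⁻ x, b x ∂(μ s) < c) {M : ℕ → ℕ} (hM : ∀ T, 0 < M T) :
    Tendsto (fun T => (Measure.pi fun _ : Fin (M T) => Measure.pi fun τ : Fin T =>
        μ (Fin.ofNat (N + 1) τ))
      {x | c < ((M T : ℝ≥0∞) * T)⁻¹ * ∑ v, ∑ τ, b (x v τ)}) atTop (𝓝 0) := by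
  set S := ∑ s, ∫⁻ x, b x ∂(μ s) with hS
  set mean := ((N + 1 : ℕ) : ℝ≥0∞)⁻¹ * S with hmean
  have hN0 : ((N + 1 : ℕ) : ℝ≥0∞)⁻¹ ≠ 0 := by simp
  have hSt : S ≠ ∞ := by
    intro h
    rw [hmean, h, ENNReal.mul_top hN0] at hc
    exact not_top_lt hc
  have hmt : mean ≠ ∞ := hc.ne_top
  have hbt : ∀ s, ∫⁻ x, b x ∂(μ s) ≠ ∞ := fun s =>
    ne_top_of_le_ne_top hSt (Finset.single_le_sum (f := fun s => ∫⁻ x, b x ∂(μ s))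
      (fun _ _ => zero_le) (Finset.mem_univ s))
  -- One `ε` each is reserved for the part of the cost above the truncation level, for the deviation
  -- in Chebyshev's inequality, and for an incomplete period.
  obtain ⟨ε, hε0, hε⟩ : ∃ ε : ℝ≥0, 0 < ε ∧ mean + 3 * ε ≤ c := by
    obtain ⟨d, hd0, hd⟩ := ENNReal.lt_iff_exists_add_pos_lt.1 hc
    refine ⟨d / 3, by positivity, ?_⟩
    have : (3 : ℝ≥0∞) * ((d / 3 : ℝ≥0) : ℝ≥0∞) = d := by
      have h3 : (3 : ℝ≥0) * (d / 3) = d := mul_div_cancel₀ d (by norm_num)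
      exact_mod_cast congrArg (fun t : ℝ≥0 => (t : ℝ≥0∞)) h3
    rw [this]
    exact hd.le
  have hε0' : (ε : ℝ≥0∞) ≠ 0 := by exact_mod_cast hε0.ne'
  refine ENNReal.tendsto_nhds_zero.2 fun η hη => ?_
  have htail : Tendsto (fun n : ℕ => ∑ s, ∫⁻ x, b x - n ∂(μ s)) atTop (𝓝 0) := by
    have := tendsto_finsetSum (Finset.univ : Finset (Fin (N + 1))) fun s _ =>
      tendsto_lintegral_sub_natCast (μ s) hb (hbt s)
    simpa using this
  -- The cost has a finite mean but perhaps no variance, so it is truncated at `B`, and Markov's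
  -- inequality handles the rest. The factor two covers the incomplete period, as `1 / (N + 1) + 1 /
  -- T ≤ 2`.
  obtain ⟨B, hB⟩ : ∃ B : ℕ, (2 * ∑ s, ∫⁻ x, b x - B ∂(μ s)) / ε ≤ η / 2 := by
    have h1 : Tendsto (fun n : ℕ => (2 * ∑ s, ∫⁻ x, b x - n ∂(μ s)) / ε) atTop (𝓝 0) := by
      have := ENNReal.Tendsto.div_const (ENNReal.Tendsto.const_mul (a := 2) htail (Or.inr (by simp)))
        (Or.inr hε0')
      simpa using this
    exact (ENNReal.tendsto_nhds_zero.1 h1 (η / 2) (ENNReal.half_pos hη.ne')).exists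
  have hcheb : Tendsto (fun T : ℕ => ENNReal.ofReal ((B : ℝ) ^ 2 / (T * (ε : ℝ) ^ 2))) atTop
      (𝓝 0) := by
    have h1 : Tendsto (fun T : ℕ => (B : ℝ) ^ 2 / (T * (ε : ℝ) ^ 2)) atTop (𝓝 0) :=
      Tendsto.const_div_atTop (tendsto_natCast_atTop_atTop.atTop_mul_const (by positivity)) _
    simpa using ENNReal.tendsto_ofReal h1
  have hinv : Tendsto (fun T : ℕ => (T : ℝ≥0∞)⁻¹ * S) atTop (𝓝 0) := by
    simpa using ENNReal.Tendsto.mul_const ENNReal.tendsto_inv_nat_nhds_zero (Or.inr hSt)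
  filter_upwards [ENNReal.tendsto_nhds_zero.1 hcheb (η / 2) (ENNReal.half_pos hη.ne'),
    ENNReal.tendsto_nhds_zero.1 hinv ε (by exact_mod_cast hε0), eventually_gt_atTop 0]
    with T hT1 hT2 hT
  set P : Measure (Fin (M T) × Fin T → A) :=
    Measure.pi fun z : Fin (M T) × Fin T => μ (Fin.ofNat (N + 1) z.2) with hP
  have hcurry := pi_map_curry fun (_ : Fin (M T)) (τ : Fin T) => μ (Fin.ofNat (N + 1) τ)
  have hms : MeasurableSet {x : Fin (M T) → Fin T → A |
      c < ((M T : ℝ≥0∞) * T)⁻¹ * ∑ v, ∑ τ, b (x v τ)} := by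
    refine measurableSet_lt measurable_const (Measurable.const_mul ?_ _)
    exact Finset.measurable_sum _ fun v _ => Finset.measurable_sum _ fun τ _ =>
      hb.comp ((measurable_pi_apply τ).comp (measurable_pi_apply v))
  have hL : ((M T * T : ℕ) : ℝ≥0∞) ≠ 0 := by exact_mod_cast (Nat.mul_pos (hM T) hT).ne'
  have hLt : ((M T * T : ℕ) : ℝ≥0∞) ≠ ∞ := ENNReal.natCast_ne_top _
  set L : ℝ≥0∞ := ((M T * T : ℕ) : ℝ≥0∞) with hLdef
  have hper : ∀ a : Fin (N + 1) → ℝ≥0∞, L⁻¹ * ∑ z : Fin (M T) × Fin T, a (Fin.ofNat (N + 1) z.2) =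
      (T : ℝ≥0∞)⁻¹ * ∑ τ : Fin T, a (Fin.ofNat (N + 1) τ) := by
    intro a
    have hM0 : (M T : ℝ≥0∞) ≠ 0 := by exact_mod_cast (hM T).ne'
    have h1 : ∑ z : Fin (M T) × Fin T, a (Fin.ofNat (N + 1) z.2) =
        (M T : ℝ≥0∞) * ∑ τ : Fin T, a (Fin.ofNat (N + 1) τ) := by
      rw [Fintype.sum_prod_type]
      simp
    rw [h1, hLdef, Nat.cast_mul, ENNReal.mul_inv (Or.inl hM0) (Or.inl (ENNReal.natCast_ne_top _)),
      mul_mul_mul_comm, ENNReal.inv_mul_cancel hM0 (ENNReal.natCast_ne_top _), one_mul]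
  have hcm : Measurable fun (x : Fin (M T) × Fin T → A) i k => x (i, k) :=
    measurable_curry_pi (X := fun _ _ => A)
  have hbz : ∀ z : Fin (M T) × Fin T, Measurable fun x : Fin (M T) × Fin T → A => b (x z) :=
    fun z => hb.comp (measurable_pi_apply z)
  have hmint : ∀ x, min (b x) B ≠ ∞ := fun x =>
    ne_top_of_le_ne_top (ENNReal.natCast_ne_top B) (min_le_right _ _)
  have hmε : mean + 2 * ε ≠ ∞ := ENNReal.add_ne_top.2 ⟨hmt, ENNReal.mul_ne_top (by simp) (by simp)⟩
  rw [← hcurry, Measure.map_apply hcm hms]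
  have hsub : (fun (x : Fin (M T) × Fin T → A) i k => x (i, k)) ⁻¹' {x : Fin (M T) → Fin T → A |
      c < ((M T : ℝ≥0∞) * T)⁻¹ * ∑ v, ∑ τ, b (x v τ)} ⊆
      {x | (ε : ℝ≥0∞) ≤ L⁻¹ * ∑ z, (b (x z) - B)} ∪
        {x | ∑ z, -(min (b (x z)) B).toReal ≤ -((M T * T : ℕ) * (mean + 2 * ε).toReal)} := by
    intro x hx
    by_contra hn
    rw [Set.mem_union, not_or] at hn
    obtain ⟨h1, h2⟩ := hn
    replace h1 : L⁻¹ * ∑ z, (b (x z) - B) < ε := not_le.1 h1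
    replace h2 : -((M T * T : ℕ) * (mean + 2 * ε).toReal) < ∑ z, -(min (b (x z)) B).toReal :=
      not_le.1 h2
    rw [Finset.sum_neg_distrib, neg_lt_neg_iff, ← ENNReal.toReal_sum fun z _ => hmint _,
      ← ENNReal.toReal_natCast, ← ENNReal.toReal_mul] at h2
    have h3 : L⁻¹ * ∑ z, min (b (x z)) B ≤ mean + 2 * ε := by
      rw [mul_comm, ← div_eq_mul_inv]
      refine ENNReal.div_le_of_le_mul' ?_
      exact ((ENNReal.toReal_le_toReal (ENNReal.sum_ne_top.2 fun z _ => hmint _)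
        (ENNReal.mul_ne_top hLt hmε)).1 h2.le)
    have h4 : L⁻¹ * ∑ z, b (x z) < mean + 3 * ε := by
      have h5 : ∀ z, b (x z) = (b (x z) - B) + min (b (x z)) B := fun z => tsub_add_min.symm
      calc L⁻¹ * ∑ z, b (x z) = L⁻¹ * ∑ z, (b (x z) - B) + L⁻¹ * ∑ z, min (b (x z)) B := by
            rw [← mul_add, ← Finset.sum_add_distrib]
            exact congrArg _ (Finset.sum_congr rfl fun z _ => h5 z)
        _ < ε + (mean + 2 * ε) := ENNReal.add_lt_add_of_lt_of_le
            (ne_top_of_le_ne_top hmε h3) h1 h3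
        _ = mean + 3 * ε := by ring
    have h6 : c < L⁻¹ * ∑ z, b (x z) := by
      rw [Fintype.sum_prod_type, hLdef, Nat.cast_mul]
      exact hx
    exact absurd (h6.trans h4) (not_lt.2 hε)
  refine (measure_mono hsub).trans ((measure_union_le _ _).trans ?_)
  rw [← ENNReal.add_halves η]
  refine add_le_add ?_ ?_
  · refine le_trans ?_ hB
    have hmeas : Measurable fun x : Fin (M T) × Fin T → A => L⁻¹ * ∑ z, (b (x z) - B) :=
      (Finset.measurable_sum _ fun z _ => (hbz z).sub_const _).const_mul _
    refine (meas_ge_le_lintegral_div hmeas.aemeasurable hε0' ENNReal.coe_ne_top).trans ?_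
    refine ENNReal.div_le_div_right ?_ _
    rw [lintegral_const_mul _ (Finset.measurable_sum _ fun z _ => (hbz z).sub_const _),
      lintegral_finsetSum _ fun z _ => (hbz z).sub_const _]
    have hz : ∀ z : Fin (M T) × Fin T, ∫⁻ x, b (x z) - B ∂P =
        ∫⁻ x, b x - B ∂(μ (Fin.ofNat (N + 1) z.2)) := fun z =>
      (measurePreserving_eval (fun z : Fin (M T) × Fin T => μ (Fin.ofNat (N + 1) z.2))
        z).lintegral_comp (hb.sub_const _)
    simp only [hP] at hz
    simp only [hz]
    rw [hper fun s => ∫⁻ x, b x - B ∂(μ s)]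
    refine (inv_mul_sum_periodic_le (fun s => ∫⁻ x, b x - B ∂(μ s)) hT).trans ?_
    rw [two_mul]
    have h1 : ∀ n : ℕ, 0 < n → (n : ℝ≥0∞)⁻¹ ≤ 1 := fun n hn => by
      rw [ENNReal.inv_le_one]
      exact_mod_cast hn
    exact add_le_add (mul_le_of_le_one_left' (h1 _ N.succ_pos)) (mul_le_of_le_one_left' (h1 _ hT))
  · refine le_trans ?_ hT1
    -- The Chebyshev lemma bounds a lower tail, hence the negated costs.
    refine (measure_sum_le_le (T := M T * T) (by simp) (Nat.mul_pos (hM T) hT)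
      (fun z : Fin (M T) × Fin T => μ (Fin.ofNat (N + 1) z.2)) (ε := ε) (B := B)
      (X := fun _ x => -(min (b x) B).toReal)
      (fun z => (hb.min measurable_const).ennreal_toReal.neg) (fun z x => ?_) (by exact_mod_cast hε0)
      ?_).trans (ENNReal.ofReal_le_ofReal ?_)
    · rw [abs_neg, abs_of_nonneg ENNReal.toReal_nonneg]
      exact ENNReal.toReal_le_of_le_ofReal (by positivity) (by simp)
    · have hint : ∀ s, ∫ x, -(min (b x) B).toReal ∂(μ s) = -(∫⁻ x, min (b x) B ∂(μ s)).toReal := by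
        intro s
        rw [integral_neg, integral_toReal (hb.min measurable_const).aemeasurable
          (ae_of_all _ fun x => (hmint x).lt_top)]
      simp only [hint]
      have hfin : ∀ s, ∫⁻ x, min (b x) B ∂(μ s) ≠ ∞ := fun s =>
        ne_top_of_le_ne_top (hbt s) (lintegral_mono fun x => min_le_left _ _)
      rw [Finset.sum_neg_distrib, ← ENNReal.toReal_sum fun z _ => hfin _]
      have h1 : ∑ z : Fin (M T) × Fin T, ∫⁻ x, min (b x) B ∂(μ (Fin.ofNat (N + 1) z.2)) ≤
          L * (mean + ε) := by
        have h2 : L⁻¹ * ∑ z : Fin (M T) × Fin T,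
            ∫⁻ x, min (b x) B ∂(μ (Fin.ofNat (N + 1) z.2)) ≤ mean + ε := by
          rw [hper fun s => ∫⁻ x, min (b x) B ∂(μ s)]
          refine (inv_mul_sum_periodic_le (fun s => ∫⁻ x, min (b x) B ∂(μ s)) hT).trans ?_
          have h3 : ∑ s, ∫⁻ x, min (b x) B ∂(μ s) ≤ S :=
            Finset.sum_le_sum fun s _ => lintegral_mono fun x => min_le_left _ _
          exact add_le_add (mul_le_mul_right h3 _) ((mul_le_mul_right h3 _).trans hT2)
        calc _ = L * (L⁻¹ * ∑ z : Fin (M T) × Fin T,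
            ∫⁻ x, min (b x) B ∂(μ (Fin.ofNat (N + 1) z.2))) := by
              rw [← mul_assoc, ENNReal.mul_inv_cancel hL hLt, one_mul]
          _ ≤ _ := mul_le_mul_right h2 _
      have h4 := ENNReal.toReal_mono (ENNReal.mul_ne_top hLt (by simp [hmt])) h1
      rw [ENNReal.toReal_mul, ENNReal.toReal_add hmt ENNReal.coe_ne_top, hLdef,
        ENNReal.toReal_natCast, ENNReal.coe_toReal] at h4
      rw [ENNReal.toReal_add hmt (ENNReal.mul_ne_top (by simp) (by simp)),
        ENNReal.toReal_mul (a := 2), ENNReal.coe_toReal, ENNReal.toReal_ofNat]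
      linarith
    · have hM1 : (1 : ℝ) ≤ M T := by exact_mod_cast hM T
      have hT' : (0 : ℝ) < T := by exact_mod_cast hT
      have hε' : (0 : ℝ) < ε := by exact_mod_cast hε0
      push_cast
      gcongr
      nlinarith

end Costs

/-! ### Random codebooks and the constraint -/

theorem card_inv_mul_sum_pi {κ : Type*} [Fintype κ] [DecidableEq κ] (n : κ → Type*)
    [∀ k, Fintype (n k)] [∀ k, Nonempty (n k)] [∀ k, MeasurableSpace (n k)]
    [∀ k, MeasurableSingletonClass (n k)] (k : κ) (f : n k → ℝ≥0∞) :
    (Fintype.card (∀ k, n k) : ℝ≥0∞)⁻¹ * ∑ w : ∀ k, n k, f (w k) =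
      (Fintype.card (n k) : ℝ≥0∞)⁻¹ * ∑ v, f v := by
  rw [← lintegral_unif (fun w : ∀ k, n k => f (w k)), ← lintegral_unif, ← pi_unif]
  exact (measurePreserving_eval (fun k => unif (n k)) k).lintegral_comp Measurable.of_discrete

section Constraint

variable {ι : Type*} [Fintype ι] {κ : Type*} [Fintype κ] [DecidableEq κ] {X Y : ι → κ → Type*}
  [∀ i k, MeasurableSpace (X i k)] [∀ i k, MeasurableSpace (Y i k)] (Q : CostConstraint X)

theorem codebookCost_separateEnc {r : ι → κ → ℝ≥0} {T : ℕ} (c : Codebooks X r T) (i : ι) (k : κ) :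
    Q.codebookCost i (separateEnc c i) k =
      ((msgCount T (r i k) : ℝ≥0∞) * T)⁻¹ * ∑ v, ∑ τ, Q.cost i k (c i k v τ) := by
  have h := card_inv_mul_sum_pi (fun k => Fin (msgCount T (r i k))) k
    fun v => ∑ τ, Q.cost i k (c i k v τ)
  have h0 : (Fintype.card (∀ k, Fin (msgCount T (r i k))) : ℝ≥0∞) ≠ 0 :=
    Nat.cast_ne_zero.2 Fintype.card_ne_zero
  have h1 : (msgCount T (r i k) : ℝ≥0∞) ≠ 0 := Nat.cast_ne_zero.2 (msgCount_pos _ _).ne'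
  rw [Fintype.card_fin] at h
  rw [CostConstraint.codebookCost, ENNReal.mul_inv (Or.inl h0) (Or.inl (ENNReal.natCast_ne_top _)),
    ENNReal.mul_inv (Or.inl h1) (Or.inl (ENNReal.natCast_ne_top _)), mul_right_comm,
    mul_right_comm _ _ (∑ v, _), ← h]
  rfl

theorem randomCodebooks_map_eval {N : ℕ} (p : Fin (N + 1) → ∀ i k, ProbabilityMeasure (X i k))
    (r : ι → κ → ℝ≥0) (T : ℕ) (i : ι) (k : κ) :
    (randomCodebooks p r T).map (fun c => c i k) =
      Measure.pi fun _ : Fin (msgCount T (r i k)) => Measure.pi fun τ : Fin T =>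
        (p (Fin.ofNat (N + 1) τ) i k : Measure (X i k)) := by
  have h : (randomCodebooks p r T).map (fun c => c i k) =
      ((randomCodebooks p r T).map fun c => c i).map fun c => c k := by
    rw [Measure.map_map (measurable_pi_apply _) (measurable_pi_apply _)]
    rfl
  rw [h, randomCodebooks, map_eval_pi, map_eval_pi]

/-- The random codebooks satisfy a constraint that holds with some slack, or almost surely. -/
theorem meetsConstraint {N : ℕ} (p : Fin (N + 1) → ∀ i k, ProbabilityMeasure (X i k))
    (r : ι → κ → ℝ≥0)
    (h : ∀ i, ∃ v ∈ Q.region i, ∀ k,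
      ((N + 1 : ℕ) : ℝ≥0∞)⁻¹ * ∑ s, ∫⁻ x, Q.cost i k x ∂(p s i k : Measure (X i k)) < v k ∨
      ∀ s, ∀ᵐ x ∂(p s i k : Measure (X i k)), Q.cost i k x ≤ v k) :
    MeetsConstraint Q p r := by
  choose v hv hslack using h
  set E : ∀ (T : ℕ) (i : ι) (k : κ), Set (Fin (msgCount T (r i k)) → Fin T → X i k) := fun T i k =>
    {b | v i k < ((msgCount T (r i k) : ℝ≥0∞) * T)⁻¹ * ∑ w, ∑ τ, Q.cost i k (b w τ)} with hE
  have hEm : ∀ T i k, MeasurableSet (E T i k) := fun T i k =>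
    measurableSet_lt measurable_const (Measurable.const_mul (Finset.measurable_sum _ fun w _ =>
      Finset.measurable_sum _ fun τ _ => (Q.measurable_cost i k).comp
        ((measurable_pi_apply τ).comp (measurable_pi_apply w))) _)
  have hlim : ∀ i k, Tendsto (fun T => (Measure.pi fun _ : Fin (msgCount T (r i k)) =>
      Measure.pi fun τ : Fin T => (p (Fin.ofNat (N + 1) τ) i k : Measure (X i k))) (E T i k))
      atTop (𝓝 0) := by
    intro i k
    rcases hslack i k with h1 | h1
    · exact tendsto_measure_lt_cost (fun s => (p s i k : Measure (X i k))) (Q.measurable_cost i k)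
        h1 fun T => msgCount_pos T _
    · refine tendsto_const_nhds.congr fun T => (measure_eq_zero_iff_ae_notMem.2 ?_).symm
      have h2 : ∀ᵐ b ∂(Measure.pi fun _ : Fin (msgCount T (r i k)) => Measure.pi fun τ : Fin T =>
          (p (Fin.ofNat (N + 1) τ) i k : Measure (X i k))), ∀ w τ, Q.cost i k (b w τ) ≤ v i k := by
        have h3 : ∀ᵐ b ∂(Measure.pi fun τ : Fin T =>
            (p (Fin.ofNat (N + 1) τ) i k : Measure (X i k))), ∀ τ, Q.cost i k (b τ) ≤ v i k :=
          ae_all_iff.2 fun τ => (measurePreserving_eval (fun τ : Fin T =>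
            (p (Fin.ofNat (N + 1) τ) i k : Measure (X i k))) τ).quasiMeasurePreserving.ae (h1 _)
        refine ae_all_iff.2 fun w => ?_
        refine (measurePreserving_eval (fun _ : Fin (msgCount T (r i k)) =>
          Measure.pi fun τ : Fin T => (p (Fin.ofNat (N + 1) τ) i k : Measure (X i k)))
          w).quasiMeasurePreserving.ae h3
      filter_upwards [h2] with b hb
      change ¬ v i k < ((msgCount T (r i k) : ℝ≥0∞) * T)⁻¹ * ∑ w, ∑ τ, Q.cost i k (b w τ)
      refine not_lt.2 ?_
      calc _ ≤ ((msgCount T (r i k) : ℝ≥0∞) * T)⁻¹ *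
            ∑ _w : Fin (msgCount T (r i k)), ∑ _τ : Fin T, v i k := by
            gcongr with w _ τ _
            exact hb w τ
        _ ≤ v i k := by
            simp only [Finset.sum_const, Finset.card_univ, Fintype.card_fin, nsmul_eq_mul]
            rw [← mul_assoc (msgCount T (r i k) : ℝ≥0∞), ← mul_assoc]
            exact mul_le_of_le_one_left' (ENNReal.inv_mul_le_one _)
  have hsum : Tendsto (fun T => ∑ i, ∑ k, (Measure.pi fun _ : Fin (msgCount T (r i k)) =>
      Measure.pi fun τ : Fin T => (p (Fin.ofNat (N + 1) τ) i k : Measure (X i k))) (E T i k))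
      atTop (𝓝 0) := by
    have := tendsto_finsetSum (Finset.univ : Finset ι) fun i _ =>
      tendsto_finsetSum (Finset.univ : Finset κ) fun k _ => hlim i k
    simpa using this
  refine tendsto_of_tendsto_of_tendsto_of_le_of_le tendsto_const_nhds hsum (fun _ => zero_le)
    fun T => ?_
  have hm : ∀ i k, Measurable fun c : Codebooks X r T => c i k := fun i k =>
    (measurable_pi_apply k).comp (measurable_pi_apply i)
  calc randomCodebooks p r T {c | ¬ ∀ i, Q.codebookCost i (separateEnc c i) ∈ Q.region i}
      ≤ randomCodebooks p r T (⋃ i, ⋃ k, (fun c => c i k) ⁻¹' E T i k) := by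
        refine measure_mono fun c hc => ?_
        by_contra hn
        refine hc fun i => Q.isLowerSet_region i (fun k => ?_) (hv i)
        rw [codebookCost_separateEnc]
        by_contra hk
        exact hn (Set.mem_iUnion₂.2 ⟨i, k, not_le.1 hk⟩)
    _ ≤ ∑ i, ∑ k, randomCodebooks p r T ((fun c => c i k) ⁻¹' E T i k) :=
        (measure_iUnion_fintype_le _ _).trans
          (Finset.sum_le_sum fun i _ => measure_iUnion_fintype_le _ _)
    _ = _ := by
        refine Finset.sum_congr rfl fun i _ => Finset.sum_congr rfl fun k _ => ?_
        rw [← randomCodebooks_map_eval, Measure.map_apply (hm i k) (hEm T i k)]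

/-- A symbol that costs at most the mean, and less if the cost is not almost surely constant. -/
theorem exists_cost_le {A : Type*} [MeasurableSpace A] [Nonempty A] {N : ℕ}
    (μ : Fin (N + 1) → Measure A) [∀ s, IsProbabilityMeasure (μ s)] {b : A → ℝ≥0∞}
    (hb : Measurable b) {c : ℝ≥0∞} (hc : ((N + 1 : ℕ) : ℝ≥0∞)⁻¹ * ∑ s, ∫⁻ x, b x ∂(μ s) = c) :
    ∃ x, (c ≠ ∞ ∧ b x < c) ∨ (b x ≤ c ∧ ∀ s, ∀ᵐ x ∂(μ s), b x ≤ c) := by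
  rcases eq_or_ne c ∞ with rfl | hct
  · exact ⟨Classical.arbitrary A, Or.inr ⟨le_top, fun s => ae_of_all _ fun x => le_top⟩⟩
  by_cases hex : ∃ x, b x < c
  · obtain ⟨x, hx⟩ := hex
    exact ⟨x, Or.inl ⟨hct, hx⟩⟩
  -- If no symbol is cheaper than the mean, the excess over the mean is nonnegative with integral
  -- zero, so it vanishes almost surely.
  push Not at hex
  have hN0 : ((N + 1 : ℕ) : ℝ≥0∞) ≠ 0 := by simp
  have hNt : ((N + 1 : ℕ) : ℝ≥0∞) ≠ ∞ := by simp
  have hS : ∑ s, ∫⁻ x, b x ∂(μ s) = (N + 1 : ℕ) * c := by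
    rw [← hc, ← mul_assoc, ENNReal.mul_inv_cancel hN0 hNt, one_mul]
  have hsplit : ∀ s, ∫⁻ x, b x ∂(μ s) = c + ∫⁻ x, b x - c ∂(μ s) := by
    intro s
    have h1 : ∀ x, b x = c + (b x - c) := fun x => (add_tsub_cancel_of_le (hex x)).symm
    rw [lintegral_congr h1, lintegral_add_left measurable_const]
    simp
  have hzero : ∑ s, ∫⁻ x, b x - c ∂(μ s) = 0 := by
    have h2 : (N + 1 : ℕ) * c + ∑ s, ∫⁻ x, b x - c ∂(μ s) = (N + 1 : ℕ) * c + 0 := by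
      rw [add_zero]
      conv_rhs => rw [← hS]
      simp only [hsplit, Finset.sum_add_distrib]
      simp
    exact (ENNReal.add_right_inj (ENNReal.mul_ne_top hNt hct)).1 h2
  have hae : ∀ s, ∀ᵐ x ∂(μ s), b x ≤ c := by
    intro s
    have h3 : ∫⁻ x, b x - c ∂(μ s) = 0 := (Finset.sum_eq_zero_iff.1 hzero) s (Finset.mem_univ s)
    filter_upwards [(lintegral_eq_zero_iff (hb.sub_const _)).1 h3] with x hx
    exact tsub_eq_zero_iff_le.1 hx
  obtain ⟨x, hx⟩ := (hae 0).exists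
  exact ⟨x, Or.inr ⟨hx, hae⟩⟩

/-- The input laws `p`, repeated `n` times, followed by a slot with the input laws `d`. -/
def repeatThen {L : Type*} {N : ℕ} (p : Fin (N + 1) → L) (d : L) (n : ℕ)
    (s : Fin (n * (N + 1) + 1)) : L :=
  if (s : ℕ) < n * (N + 1) then p (Fin.ofNat (N + 1) s) else d

theorem sum_repeatThen {L α : Type*} [AddCommMonoid α] {N : ℕ} (p : Fin (N + 1) → L) (d : L)
    (n : ℕ) (g : L → α) : ∑ s, g (repeatThen p d n s) = n • ∑ s, g (p s) + g d := by
  rw [Fin.sum_univ_castSucc, ← sum_range_mul_periodic (fun s => g (p s)), Finset.sum_range]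
  simp [repeatThen]

/-- Meeting the mean cost exactly is not enough for random codebooks. Adding one slot with a cheaper
deterministic symbol to many repetitions of `p` creates strict slack, while the share of the
repeated slots tends to one. On carriers where no symbol is cheaper than the mean, or the mean is
infinite, the cost is almost surely within the bound and slack is unnecessary. -/
theorem exists_slack (W : ∀ k, Kernel (∀ i, X i k) (∀ i, Y i k)) [∀ k, IsMarkovKernel (W k)]
    [∀ i k, Nonempty (X i k)]
    {N : ℕ} {p : Fin (N + 1) → ∀ i k, ProbabilityMeasure (X i k)} (hp : Q.Feasible p) {R : ℝ≥0∞}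
    (hR : R < ∑ k, ∑ i, carrierInfo W p i k) :
    ∃ (N' : ℕ) (p' : Fin (N' + 1) → ∀ i k, ProbabilityMeasure (X i k)), Q.Feasible p' ∧
      R < ∑ k, ∑ i, carrierInfo W p' i k ∧ ∀ r, MeetsConstraint Q p' r := by
  set c : ι → κ → ℝ≥0∞ := fun i k =>
    ((N + 1 : ℕ) : ℝ≥0∞)⁻¹ * ∑ s, ∫⁻ x, Q.cost i k x ∂(p s i k : Measure (X i k)) with hc
  have hx := fun i k => exists_cost_le (fun s => (p s i k : Measure (X i k)))
    (Q.measurable_cost i k) (c := c i k) rfl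
  choose x hx using hx
  have hxle : ∀ i k, Q.cost i k (x i k) ≤ c i k := fun i k => by
    rcases hx i k with h | h
    exacts [h.2.le, h.1]
  set d : ∀ i k, ProbabilityMeasure (X i k) := fun i k => ⟨Measure.dirac (x i k), inferInstance⟩
    with hd
  have hN0 : ((N + 1 : ℕ) : ℝ≥0∞) ≠ 0 := by simp
  have hNt : ((N + 1 : ℕ) : ℝ≥0∞) ≠ ∞ := by simp
  have hS : ∀ i k, ∑ s, ∫⁻ x, Q.cost i k x ∂(p s i k : Measure (X i k)) = (N + 1 : ℕ) * c i k := by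
    intro i k
    rw [hc, ← mul_assoc, ENNReal.mul_inv_cancel hN0 hNt, one_mul]
  have hdx : ∀ i k, ∫⁻ y, Q.cost i k y ∂(d i k : Measure (X i k)) = Q.cost i k (x i k) :=
    fun i k => lintegral_dirac' _ (Q.measurable_cost i k)
  have hsum : ∀ n i k, ∑ s, ∫⁻ y, Q.cost i k y ∂(repeatThen p d n s i k : Measure (X i k)) =
      ((n * (N + 1) : ℕ) : ℝ≥0∞) * c i k + Q.cost i k (x i k) := by
    intro n i k
    rw [sum_repeatThen p d n fun l => ∫⁻ y, Q.cost i k y ∂(l i k : Measure (X i k)), hS, hdx,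
      nsmul_eq_mul, ← mul_assoc, Nat.cast_mul]
  have hL0 : ∀ n : ℕ, ((n * (N + 1) + 1 : ℕ) : ℝ≥0∞) ≠ 0 := fun n =>
    Nat.cast_ne_zero.2 (Nat.succ_ne_zero _)
  have hLt : ∀ n : ℕ, ((n * (N + 1) + 1 : ℕ) : ℝ≥0∞) ≠ ∞ := fun n => ENNReal.natCast_ne_top _
  have hmul : ∀ (n : ℕ) (a : ℝ≥0∞), ((n * (N + 1) + 1 : ℕ) : ℝ≥0∞)⁻¹ *
      (((n * (N + 1) : ℕ) : ℝ≥0∞) * a + a) = a := by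
    intro n a
    have : ((n * (N + 1) : ℕ) : ℝ≥0∞) * a + a = ((n * (N + 1) + 1 : ℕ) : ℝ≥0∞) * a := by
      push_cast
      ring
    rw [this, ← mul_assoc, ENNReal.inv_mul_cancel (hL0 n) (hLt n), one_mul]
  have hfeas : ∀ n i k, ((n * (N + 1) + 1 : ℕ) : ℝ≥0∞)⁻¹ *
      ∑ s, ∫⁻ y, Q.cost i k y ∂(repeatThen p d n s i k : Measure (X i k)) ≤ c i k := by
    intro n i k
    rw [hsum]
    exact (mul_le_mul_right (add_le_add le_rfl (hxle i k)) _).trans (hmul n _).le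
  have hinfo : ∀ n, ((n * (N + 1) + 1 : ℕ) : ℝ≥0∞)⁻¹ * ((n * (N + 1) : ℕ) : ℝ≥0∞) *
      ∑ k, ∑ i, carrierInfo W p i k ≤ ∑ k, ∑ i, carrierInfo W (repeatThen p d n) i k := by
    intro n
    rw [Finset.mul_sum]
    refine Finset.sum_le_sum fun k _ => ?_
    rw [Finset.mul_sum]
    refine Finset.sum_le_sum fun i _ => ?_
    rw [carrierInfo, carrierInfo,
      sum_repeatThen p d n fun l => userInfo (W k) (fun j => l j k) i, mul_assoc, Nat.cast_mul,
      mul_assoc (n : ℝ≥0∞), ← mul_assoc ((N + 1 : ℕ) : ℝ≥0∞), ENNReal.mul_inv_cancel hN0 hNt,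
      one_mul, nsmul_eq_mul]
    -- The information of the added slot is nonnegative and is dropped.
    exact mul_le_mul_right le_self_add _
  have hratio : Tendsto (fun n : ℕ => ((n * (N + 1) + 1 : ℕ) : ℝ≥0∞)⁻¹ *
      ((n * (N + 1) : ℕ) : ℝ≥0∞)) atTop (𝓝 1) := by
    have h1 : Tendsto (fun n : ℕ => ((n * (N + 1) + 1 : ℕ) : ℝ≥0∞)⁻¹) atTop (𝓝 0) :=
      ENNReal.tendsto_inv_nat_nhds_zero.comp (tendsto_atTop_mono
        (fun n => (Nat.le_mul_of_pos_right n N.succ_pos).trans (Nat.le_succ _)) tendsto_id)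
    have h2 : Tendsto (fun n : ℕ => 1 - ((n * (N + 1) + 1 : ℕ) : ℝ≥0∞)⁻¹) atTop (𝓝 (1 - 0)) :=
      ENNReal.Tendsto.sub tendsto_const_nhds h1 (Or.inl ENNReal.one_ne_top)
    rw [tsub_zero] at h2
    refine h2.congr fun n => ?_
    refine (ENNReal.eq_sub_of_add_eq (ENNReal.inv_ne_top.2 (hL0 n)) ?_).symm
    have := hmul n 1
    rwa [mul_add, mul_one, mul_one] at this
  have hlim : Tendsto (fun n : ℕ => ((n * (N + 1) + 1 : ℕ) : ℝ≥0∞)⁻¹ *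
      ((n * (N + 1) : ℕ) : ℝ≥0∞) * ∑ k, ∑ i, carrierInfo W p i k) atTop
      (𝓝 (1 * ∑ k, ∑ i, carrierInfo W p i k)) :=
    ENNReal.Tendsto.mul_const hratio (Or.inl one_ne_zero)
  rw [one_mul] at hlim
  obtain ⟨n, hn⟩ := (hlim.eventually (lt_mem_nhds hR)).exists
  refine ⟨n * (N + 1), repeatThen p d n, fun i => Q.isLowerSet_region i (fun k => hfeas n i k) (hp i),
    hn.trans_le (hinfo n), fun r => meetsConstraint Q _ r fun i => ⟨c i, hp i, fun k => ?_⟩⟩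
  rcases hx i k with ⟨hct, hlt⟩ | ⟨hle, hae⟩
  · left
    rw [hsum]
    conv_rhs => rw [← hmul n (c i k)]
    refine (ENNReal.mul_lt_mul_iff_right (ENNReal.inv_ne_zero.2 (hLt n))
      (ENNReal.inv_ne_top.2 (hL0 n))).2 ?_
    exact ENNReal.add_lt_add_left (ENNReal.mul_ne_top (ENNReal.natCast_ne_top _) hct) hlt
  · right
    intro s
    rw [repeatThen]
    split_ifs
    · exact hae _
    · exact (ae_dirac_iff (measurableSet_le (Q.measurable_cost i k) measurable_const)).2 hle

end Constraint

/-! ### Achievability -/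

/-- The complement of `s` has at least half of the mass, so `f` cannot exceed twice `e` throughout
it. Neither `s` nor `f` need be measurable, hence the measurable hull. -/
theorem exists_notMem_le_lintegral {Ω : Type*} [MeasurableSpace Ω] (μ : Measure Ω)
    [IsProbabilityMeasure μ] {s : Set Ω} (hs : μ s ≤ 2⁻¹) {f : Ω → ℝ≥0∞} {e : ℝ≥0∞}
    (he : ∫⁻ x, f x ∂μ < e) : ∃ x ∉ s, f x ≤ 2 * e := by
  by_contra! h
  have hm : MeasurableSet (toMeasurable μ s)ᶜ := (measurableSet_toMeasurable μ s).compl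
  have h1 : 2⁻¹ ≤ μ (toMeasurable μ s)ᶜ := by
    rw [prob_compl_eq_one_sub (measurableSet_toMeasurable μ s), measure_toMeasurable]
    refine le_trans ?_ (tsub_le_tsub_left hs 1)
    rw [ENNReal.one_sub_inv_two]
  have h2 : 2 * e * μ (toMeasurable μ s)ᶜ ≤ ∫⁻ x, f x ∂μ := by
    rw [← lintegral_indicator_const hm]
    refine lintegral_mono fun x => ?_
    by_cases hx : x ∈ (toMeasurable μ s)ᶜ
    · rw [Set.indicator_of_mem hx]
      exact (h x fun hxs => hx (subset_toMeasurable μ s hxs)).le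
    · rw [Set.indicator_of_notMem hx]
      exact zero_le
  have h3 : e ≤ 2 * e * μ (toMeasurable μ s)ᶜ := by
    calc e = 2 * e * 2⁻¹ := by
          rw [mul_right_comm, ENNReal.mul_inv_cancel (by simp) (by simp), one_mul]
      _ ≤ _ := mul_le_mul_right h1 _
  exact absurd (h3.trans h2) (not_le.2 he)

/-- Rates of the form `z i / b * log 2` below given bounds. -/
theorem exists_dyadic_rates {ι : Type*} [Fintype ι] {f : ι → ℝ≥0∞} {R : ℝ≥0∞}
    (h : R < ∑ i, f i) :
    ∃ (b : ℕ) (z : ι → ℕ) (r : ι → ℝ≥0), 0 < b ∧ (∀ i, r i = 0 ∨ (r i : ℝ≥0∞) < f i) ∧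
      R < ((∑ i, r i : ℝ≥0) : ℝ≥0∞) ∧ ∀ i, (b : ℝ) * r i = z i * Real.log 2 := by
  obtain ⟨a, ha, hR⟩ := exists_lt_sum h
  set l : ℝ≥0 := ⟨Real.log 2, Real.log_nonneg one_le_two⟩ with hl
  have hl0 : l ≠ 0 := fun h0 =>
    (Real.log_pos one_lt_two).ne' (congrArg (fun t : ℝ≥0 => (t : ℝ)) h0)
  -- Rounding `a i / log 2` down to a multiple of `1 / n` loses nothing in the limit.
  have hlim : ∀ i, Tendsto (fun n : ℕ => (⌊a i / l * n⌋₊ : ℝ≥0) / n * l) atTop (𝓝 (a i)) := by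
    intro i
    have h1 : Tendsto (fun n : ℕ => (⌊a i / l * (n : ℝ≥0)⌋₊ : ℝ≥0) / n) atTop (𝓝 (a i / l)) := by
      refine NNReal.tendsto_coe.1 (((tendsto_nat_floor_mul_div_atTop (R := ℝ)
        (a i / l : ℝ≥0).2).comp tendsto_natCast_atTop_atTop).congr fun n => ?_)
      have h2 : ((a i / l : ℝ≥0) : ℝ) * (n : ℝ) = ((a i / l * (n : ℝ≥0) : ℝ≥0) : ℝ) := by
        rw [NNReal.coe_mul, NNReal.coe_natCast]
      change (⌊((a i / l : ℝ≥0) : ℝ) * (n : ℝ)⌋₊ : ℝ) / (n : ℝ) = _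
      rw [h2, show ⌊((a i / l * (n : ℝ≥0) : ℝ≥0) : ℝ)⌋₊ = ⌊a i / l * (n : ℝ≥0)⌋₊ from
        Nonneg.nat_floor_coe _, NNReal.coe_div, NNReal.coe_natCast, NNReal.coe_natCast]
    have h2 := h1.mul_const l
    rwa [div_mul_cancel₀ _ hl0] at h2
  have hsum : Tendsto (fun n : ℕ => ((∑ i, (⌊a i / l * n⌋₊ : ℝ≥0) / n * l : ℝ≥0) : ℝ≥0∞)) atTop
      (𝓝 ((∑ i, a i : ℝ≥0) : ℝ≥0∞)) :=
    ENNReal.tendsto_coe.2 (tendsto_finsetSum _ fun i _ => hlim i)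
  obtain ⟨b, hb, hb0⟩ := ((hsum.eventually (lt_mem_nhds hR)).and (eventually_gt_atTop 0)).exists
  have hb' : (b : ℝ≥0) ≠ 0 := by exact_mod_cast hb0.ne'
  refine ⟨b, fun i => ⌊a i / l * b⌋₊, fun i => (⌊a i / l * b⌋₊ : ℝ≥0) / b * l, hb0, fun i => ?_,
    hb, fun i => ?_⟩
  · have hle : (⌊a i / l * b⌋₊ : ℝ≥0) / b * l ≤ a i := by
      calc (⌊a i / l * b⌋₊ : ℝ≥0) / b * l ≤ (a i / l * b) / b * l := by
            gcongr
            exact Nat.floor_le zero_le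
        _ = a i := by
            rw [mul_div_cancel_right₀ _ hb', div_mul_cancel₀ _ hl0]
    rcases ha i with h0 | h0
    · left
      exact le_antisymm (hle.trans h0.le) zero_le
    · right
      exact (ENNReal.coe_le_coe.2 hle).trans_lt h0
  · have h1 : (b : ℝ≥0) * ((⌊a i / l * b⌋₊ : ℝ≥0) / b * l) = ⌊a i / l * b⌋₊ * l := by
      rw [← mul_assoc, mul_div_cancel₀ _ hb']
    calc (b : ℝ) * (((⌊a i / l * b⌋₊ : ℝ≥0) / b * l : ℝ≥0) : ℝ)
        = (((b : ℝ≥0) * ((⌊a i / l * b⌋₊ : ℝ≥0) / b * l) : ℝ≥0) : ℝ) := by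
          rw [NNReal.coe_mul (b : ℝ≥0), NNReal.coe_natCast]
      _ = (⌊a i / l * b⌋₊ : ℝ) * Real.log 2 := by
          rw [h1, NNReal.coe_mul, NNReal.coe_natCast]
          rfl

/-- At lengths divisible by `b` the ceiling in `msgCount` is exact. The rates are then exactly those
required by `Achievable`, not just in the limit. -/
theorem msgCount_eq_two_pow {b z : ℕ} {r : ℝ≥0} (h : (b : ℝ) * r = z * Real.log 2) (t : ℕ) :
    msgCount (b * t) r = 2 ^ (z * t) := by
  have h1 : Real.exp ((b * t : ℕ) * r) = ((2 ^ (z * t) : ℕ) : ℝ) := by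
    have h2 : ((b * t : ℕ) : ℝ) * r = (z * t : ℕ) * Real.log 2 := by
      push_cast
      rw [mul_right_comm, h]
      ring
    rw [h2, Real.exp_nat_mul, Real.exp_log two_pos]
    push_cast
    ring
  rw [msgCount, h1, Nat.ceil_natCast]

section Relabel

variable {ι : Type*} [Fintype ι] [DecidableEq ι]

theorem errorProb_equiv {X Y : ι → Type*} [∀ i, MeasurableSpace (X i)] [∀ i, MeasurableSpace (Y i)]
    (W : Kernel (∀ i, X i) (∀ i, Y i)) {T : ℕ} {M M' : ι → Type*} [∀ i, Fintype (M i)]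
    [∀ i, Fintype (M' i)] (e : ∀ i, M' i ≃ M i) (enc : ∀ i, M i → Fin T → X i)
    (dec : ∀ i, (Fin T → Y i) → M i) :
    errorProb W (fun i w => enc i (e i w)) (fun i y => (e i).symm (dec i y)) =
      errorProb W enc dec := by
  rw [errorProb, errorProb, Fintype.card_congr (Equiv.piCongrRight e),
    ← (Equiv.piCongrRight e).sum_comp]
  congr 1
  refine Finset.sum_congr rfl fun w _ => ?_
  congr 1
  ext y
  simp [Equiv.symm_apply_eq]

variable {κ : Type*} [Fintype κ] [DecidableEq κ] {X Y : ι → κ → Type*}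
  [∀ i k, MeasurableSpace (X i k)] [∀ i k, MeasurableSpace (Y i k)]

theorem codebookCost_equiv (Q : CostConstraint X) (i : ι) {M M' : Type*} [Fintype M] [Fintype M']
    (e : M' ≃ M) {T : ℕ} (c : M → Fin T → ∀ k, X i k) :
    Q.codebookCost i (fun w => c (e w)) = Q.codebookCost i c := by
  funext k
  rw [CostConstraint.codebookCost, CostConstraint.codebookCost, Fintype.card_congr e,
    ← e.sum_comp]

/-- The code made of separate codebooks and decoding rules. -/
def separateCode {r : ι → κ → ℝ≥0} {T : ℕ} (δ : TINDecoders X Y r T)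
    (hδ : ∀ i k, Measurable (Function.uncurry (δ i k))) (c : Codebooks X r T) :
    Code (fun i => ∀ k, X i k) (fun i => ∀ k, Y i k) T where
  numMsg i := Fintype.card (∀ k, Fin (msgCount T (r i k)))
  numMsg_pos _ := Fintype.card_pos
  enc i w := separateEnc c i ((Fintype.equivFin _).symm w)
  dec i y := Fintype.equivFin _ (separateDec δ c i y)
  measurable_dec i := by
    have h1 : Measurable fun y : Fin T → ∀ k, Y i k => separateDec δ c i y :=
      measurable_pi_iff.2 fun k => ((hδ i k).comp measurable_prodMk_left).comp
        (measurable_pi_iff.2 fun τ => (measurable_pi_apply k).comp (measurable_pi_apply τ))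
    exact Measurable.of_discrete.comp h1

theorem separateCode_rate {r : ι → κ → ℝ≥0} {b t : ℕ} (hb : 0 < b) (ht : 0 < t) {z : ι → κ → ℕ}
    (hz : ∀ i k, (b : ℝ) * r i k = z i k * Real.log 2) (δ : TINDecoders X Y r (b * t))
    (hδ : ∀ i k, Measurable (Function.uncurry (δ i k))) (c : Codebooks X r (b * t)) (i : ι) :
    (separateCode δ hδ c).rate i = ∑ k, (r i k : ℝ) := by
  have h1 : (separateCode δ hδ c).numMsg i = ∏ k, 2 ^ (z i k * t) := by
    change Fintype.card (∀ k, Fin (msgCount (b * t) (r i k))) = _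
    rw [Fintype.card_pi]
    simp only [Fintype.card_fin, msgCount_eq_two_pow (hz i _)]
  have hb' : (b : ℝ) ≠ 0 := by exact_mod_cast hb.ne'
  have ht' : (t : ℝ) ≠ 0 := by exact_mod_cast ht.ne'
  rw [Code.rate, h1]
  push_cast
  rw [Real.log_prod (fun k _ => by positivity), Finset.sum_div]
  refine Finset.sum_congr rfl fun k _ => ?_
  rw [Real.log_pow, div_eq_iff (mul_ne_zero hb' ht')]
  push_cast
  linear_combination (-(t : ℝ)) * hz i k

/-- Reliable separate random coding that satisfies the constraint makes its rates achievable. -/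
theorem achievable_of_reliableTIN (W : ∀ k, Kernel (∀ i, X i k) (∀ i, Y i k))
    [∀ k, IsMarkovKernel (W k)] (Q : CostConstraint X) {N : ℕ}
    {p : Fin (N + 1) → ∀ i k, ProbabilityMeasure (X i k)} {r : ι → κ → ℝ≥0} {b : ℕ} (hb : 0 < b)
    {z : ι → κ → ℕ} (hz : ∀ i k, (b : ℝ) * r i k = z i k * Real.log 2)
    (hrel : ReliableTIN W p r) (hmeets : MeetsConstraint Q p r) :
    Achievable W Q fun i => ∑ k, (r i k : ℝ) := by
  obtain ⟨δ, hδ, hlim⟩ := hrel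
  have hprob : ∀ T, IsProbabilityMeasure (randomCodebooks p r T) := fun T => by
    rw [randomCodebooks]
    infer_instance
  set E : ℕ → ℝ≥0∞ := fun T => ∫⁻ c, errorProb (parallel W) (separateEnc c) (separateDec (δ T) c)
      ∂(randomCodebooks p r T) with hE
  obtain ⟨T₀, hT₀⟩ := eventually_atTop.1 (((ENNReal.tendsto_nhds_zero.1 hmeets 2⁻¹ (by simp)).and
    (ENNReal.tendsto_nhds_zero.1 hlim 1 one_pos)))
  have hex : ∀ n : ℕ, ∃ c : Codebooks X r (b * (T₀ + n + 1)),
      (∀ i, Q.codebookCost i (separateEnc c i) ∈ Q.region i) ∧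
      errorProb (parallel W) (separateEnc c) (separateDec (δ _) c) ≤
        2 * (E (b * (T₀ + n + 1)) + ((n + 1 : ℕ) : ℝ≥0∞)⁻¹) := by
    intro n
    have hle : T₀ ≤ b * (T₀ + n + 1) := by nlinarith
    obtain ⟨h1, h2⟩ := hT₀ _ hle
    -- For large lengths the constraint fails with probability at most one half. The added `1 / (n +
    -- 1)` makes the bound on the mean error strict, even if that mean is zero.
    obtain ⟨c, hc, hc'⟩ := exists_notMem_le_lintegral (randomCodebooks p r (b * (T₀ + n + 1))) h1
      (f := fun c => errorProb (parallel W) (separateEnc c) (separateDec (δ _) c))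
      (e := E (b * (T₀ + n + 1)) + ((n + 1 : ℕ) : ℝ≥0∞)⁻¹)
      (ENNReal.lt_add_right (ne_top_of_le_ne_top ENNReal.one_ne_top h2)
        (ENNReal.inv_ne_zero.2 (ENNReal.natCast_ne_top _)))
    exact ⟨c, not_not.1 hc, hc'⟩
  choose c hc hce using hex
  refine ⟨fun n => b * (T₀ + n + 1), fun n => separateCode (δ _) (hδ _) (c n),
    fun n => Nat.mul_pos hb (Nat.succ_pos _), fun n i => separateCode_rate hb (Nat.succ_pos _) hz _ _ _ i,
    fun n i => ?_, ?_⟩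
  · have h1 := hc n i
    rw [← codebookCost_equiv Q i (Fintype.equivFin _).symm (separateEnc (c n) i)] at h1
    exact h1
  · have hT : Tendsto (fun n : ℕ => b * (T₀ + n + 1)) atTop atTop :=
      tendsto_atTop_mono (fun n => (by simp only [id]; lia : id n ≤ T₀ + n + 1).trans
        (Nat.le_mul_of_pos_left _ hb)) tendsto_id
    have h1 : Tendsto (fun n : ℕ => 2 * (E (b * (T₀ + n + 1)) + ((n + 1 : ℕ) : ℝ≥0∞)⁻¹)) atTop
        (𝓝 (2 * (0 + 0))) :=
      ENNReal.Tendsto.const_mul ((hlim.comp hT).add (ENNReal.tendsto_inv_nat_nhds_zero.comp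
        (tendsto_add_atTop_nat 1))) (Or.inr (by simp))
    rw [add_zero, mul_zero] at h1
    refine tendsto_of_tendsto_of_tendsto_of_le_of_le tendsto_const_nhds h1 (fun _ => zero_le)
      fun n => ?_
    refine le_trans (le_of_eq ?_) (hce n)
    exact errorProb_equiv (parallel W) (fun i => (Fintype.equivFin
      (∀ k, Fin (msgCount (b * (T₀ + n + 1)) (r i k)))).symm) (separateEnc (c n))
      (separateDec (δ _) (c n))

/-- Separate random coding achieves all sum-rates below the mutual informations of feasible
input laws. -/
theorem exists_achievable_separate (W : ∀ k, Kernel (∀ i, X i k) (∀ i, Y i k))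
    [∀ k, IsMarkovKernel (W k)] [∀ i k, Nonempty (X i k)] (Q : CostConstraint X) {N : ℕ}
    {p : Fin (N + 1) → ∀ i k, ProbabilityMeasure (X i k)} (hp : Q.Feasible p) {R : ℝ≥0∞}
    (hR : R < ∑ k, ∑ i, carrierInfo W p i k) :
    ∃ (N' : ℕ) (p' : Fin (N' + 1) → ∀ i k, ProbabilityMeasure (X i k)) (r : ι → κ → ℝ≥0),
      Q.Feasible p' ∧ R < ((∑ k, ∑ i, r i k : ℝ≥0) : ℝ≥0∞) ∧ ReliableTIN W p' r ∧
      MeetsConstraint Q p' r ∧ Achievable W Q fun i => ∑ k, (r i k : ℝ) := by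
  obtain ⟨N', p', hp', hR', hmeets⟩ := exists_slack Q W hp hR
  rw [← Fintype.sum_prod_type' (f := fun k i => carrierInfo W p' i k)] at hR'
  obtain ⟨b, z, r, hb, hr, hRr, hz⟩ := exists_dyadic_rates hR'
  have hrel : ReliableTIN W p' fun i k => r (k, i) := reliableTIN W p' _ fun i k => hr (k, i)
  refine ⟨N', p', fun i k => r (k, i), hp', ?_, hrel, hmeets _,
    achievable_of_reliableTIN W Q hb (z := fun i k => z (k, i)) (fun i k => hz (k, i)) hrel (hmeets _)⟩
  rwa [← Fintype.sum_prod_type' (f := fun k i => r (k, i))]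

theorem le_sumCapacity (W : ∀ k, Kernel (∀ i, X i k) (∀ i, Y i k)) [∀ k, IsMarkovKernel (W k)]
    [∀ i k, Nonempty (X i k)] (Q : CostConstraint X) {N : ℕ}
    {p : Fin (N + 1) → ∀ i k, ProbabilityMeasure (X i k)} (hp : Q.Feasible p) :
    ∑ k, ∑ i, carrierInfo W p i k ≤ sumCapacity W Q := by
  refine le_of_forall_lt fun R hR => ?_
  obtain ⟨N', p', r, -, hRr, -, -, hach⟩ := exists_achievable_separate W Q hp hR
  refine hRr.trans_le (le_iSup₂_of_le _ (subset_closure hach) (le_of_eq ?_))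
  rw [Finset.sum_comm, ← ENNReal.ofReal_coe_nnreal]
  push_cast
  rfl

end Relabel

/-! ### Single slots, and continuity for finite alphabets -/

section SingleSlot

variable {ι : Type*} [Fintype ι] {κ : Type*} [Fintype κ] {X Y : ι → κ → Type*}
  [∀ i k, MeasurableSpace (X i k)] [∀ i k, MeasurableSpace (Y i k)]
  (W : ∀ k, Kernel (∀ i, X i k) (∀ i, Y i k)) [∀ k, IsMarkovKernel (W k)]

theorem carrierInfo_const (p : ∀ i k, ProbabilityMeasure (X i k)) (i : ι) (k : κ) :
    carrierInfo W (N := 0) (fun _ => p) i k = userInfo (W k) (fun j => p j k) i := by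
  simp [carrierInfo]

theorem sum_carrierInfo_le {N : ℕ} (p : Fin (N + 1) → ∀ i k, ProbabilityMeasure (X i k)) :
    ∑ k, ∑ i, carrierInfo W p i k ≤
      ⨆ p : ∀ i k, ProbabilityMeasure (X i k), ∑ k, ∑ i, userInfo (W k) (fun j => p j k) i := by
  have h : ∑ k, ∑ i, carrierInfo W p i k = ((N + 1 : ℕ) : ℝ≥0∞)⁻¹ *
      ∑ s, ∑ k, ∑ i, userInfo (W k) (fun j => p s j k) i := by
    simp only [carrierInfo, ← Finset.mul_sum]
    congr 1
    exact (Finset.sum_congr rfl fun k _ => Finset.sum_comm).trans Finset.sum_comm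
  rw [h]
  calc _ ≤ ((N + 1 : ℕ) : ℝ≥0∞)⁻¹ * ∑ _s : Fin (N + 1),
        ⨆ p : ∀ i k, ProbabilityMeasure (X i k), ∑ k, ∑ i, userInfo (W k) (fun j => p j k) i := by
        gcongr with s
        exact le_iSup (fun p : ∀ i k, ProbabilityMeasure (X i k) =>
          ∑ k, ∑ i, userInfo (W k) (fun j => p j k) i) (p s)
    _ = _ := by
        rw [Finset.sum_const, Finset.card_univ, Fintype.card_fin, nsmul_eq_mul, ← mul_assoc,
          ENNReal.inv_mul_cancel (by simp) (by simp), one_mul]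

end SingleSlot

section Mixture

variable {B : Type*} [MeasurableSpace B] {Z : Type*} [Fintype Z] {Θ : Type*} [TopologicalSpace Θ]
  [FirstCountableTopology Θ]

/-- The divergence of a mixture from a dominating measure depends continuously on the weights. -/
theorem exists_continuous_klDiv_mixture (ν : Z → Measure B) [∀ z, IsFiniteMeasure (ν z)]
    (m : Measure B) [IsProbabilityMeasure m] {C : ℝ≥0} (hν : ∀ z, ν z ≤ C • m)
    {c : Θ → Z → ℝ} (hc : ∀ z, Continuous fun θ => c θ z) (h0 : ∀ θ z, 0 ≤ c θ z)
    (h1 : ∀ θ z, c θ z ≤ 1) :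
    ∃ K : Θ → ℝ, Continuous K ∧ ∀ θ, 0 ≤ K θ ∧
      klDiv (∑ z, ENNReal.ofReal (c θ z) • ν z) m = ENNReal.ofReal (K θ) := by
  set G : Z → B → ℝ≥0∞ := fun z => (ν z).rnDeriv m with hG
  have hGm : ∀ z, Measurable (G z) := fun z => Measure.measurable_rnDeriv _ _
  have hac : ∀ z, ν z ≪ m := fun z => Measure.absolutelyContinuous_of_le_smul (c := (C : ℝ≥0∞)) (hν z)
  -- Domination by `C • m` bounds all densities by `C`, so `klFun` is evaluated on a fixed compact
  -- interval and dominated convergence gives continuity.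
  have hGC : ∀ᵐ y ∂m, ∀ z, G z y ≤ C := by
    refine ae_all_iff.2 fun z => ae_le_of_forall_setLIntegral_le_of_sigmaFinite (hGm z)
      fun s hs _ => ?_
    rw [Measure.setLIntegral_rnDeriv (hac z), setLIntegral_const]
    exact hν z s
  set F : Θ → B → ℝ := fun θ y => klFun (∑ z, c θ z * (G z y).toReal) with hF
  have hFm : ∀ θ, Measurable (F θ) := fun θ => measurable_klFun.comp
    (Finset.measurable_sum _ fun z _ => (hGm z).ennreal_toReal.const_mul _)
  obtain ⟨M, hM⟩ := (isCompact_Icc (a := (0 : ℝ)) (b := Fintype.card Z * C)).exists_bound_of_continuousOn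
    continuous_klFun.continuousOn
  have harg0 : ∀ θ y, 0 ≤ ∑ z, c θ z * (G z y).toReal := fun θ y =>
    Finset.sum_nonneg fun z _ => mul_nonneg (h0 θ z) ENNReal.toReal_nonneg
  have hbound : ∀ θ, ∀ᵐ y ∂m, ‖F θ y‖ ≤ M := by
    intro θ
    filter_upwards [hGC] with y hy
    refine hM _ ⟨harg0 θ y, ?_⟩
    calc ∑ z, c θ z * (G z y).toReal ≤ ∑ _z : Z, 1 * (C : ℝ) := by
          refine Finset.sum_le_sum fun z _ => mul_le_mul (h1 θ z) ?_ ENNReal.toReal_nonneg zero_le_one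
          exact ENNReal.toReal_le_coe_of_le_coe (hy z)
      _ = Fintype.card Z * C := by simp
  have hint : ∀ θ, Integrable (F θ) m := fun θ =>
    Integrable.of_bound (hFm θ).aestronglyMeasurable M (hbound θ)
  have hF0 : ∀ θ y, 0 ≤ F θ y := fun θ y => klFun_nonneg (harg0 θ y)
  refine ⟨fun θ => ∫ y, F θ y ∂m, ?_, fun θ => ⟨integral_nonneg (hF0 θ), ?_⟩⟩
  · refine continuous_of_dominated (fun θ => (hFm θ).aestronglyMeasurable) hbound
      (integrable_const M) (ae_of_all _ fun y => ?_)
    exact continuous_klFun.comp (continuous_finsetSum _ fun z _ => (hc z).mul continuous_const)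
  · have hdens : ∑ z, ENNReal.ofReal (c θ z) • ν z =
        m.withDensity fun y => ∑ z, ENNReal.ofReal (c θ z) * G z y := by
      ext s hs
      rw [withDensity_apply _ hs, lintegral_finsetSum _ fun z _ => (hGm z).const_mul _,
        Measure.finsetSum_apply]
      refine Finset.sum_congr rfl fun z _ => ?_
      rw [lintegral_const_mul _ (hGm z), Measure.setLIntegral_rnDeriv (hac z), Measure.smul_apply,
        smul_eq_mul]
    have hfin : IsFiniteMeasure (∑ z, ENNReal.ofReal (c θ z) • ν z) := by
      refine ⟨?_⟩
      rw [Measure.finsetSum_apply]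
      refine ENNReal.sum_lt_top.2 fun z _ => ?_
      rw [Measure.smul_apply, smul_eq_mul]
      exact ENNReal.mul_lt_top ENNReal.ofReal_lt_top (measure_lt_top _ _)
    have hacm : ∑ z, ENNReal.ofReal (c θ z) • ν z ≪ m := by
      rw [hdens]
      exact withDensity_absolutelyContinuous _ _
    rw [klDiv_eq_lintegral_klFun_of_ac hacm, ofReal_integral_eq_lintegral_ofReal (hint θ)
      (ae_of_all _ (hF0 θ))]
    have hrn : (∑ z, ENNReal.ofReal (c θ z) • ν z).rnDeriv m =ᵐ[m]
        fun y => ∑ z, ENNReal.ofReal (c θ z) * G z y := by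
      rw [hdens]
      exact Measure.rnDeriv_withDensity _ (Finset.measurable_sum _ fun z _ => (hGm z).const_mul _)
    refine lintegral_congr_ae ?_
    filter_upwards [hrn, hGC] with y hy hyC
    have hne : ∀ z, ENNReal.ofReal (c θ z) * G z y ≠ ∞ := fun z =>
      ENNReal.mul_ne_top ENNReal.ofReal_ne_top (ne_top_of_le_ne_top ENNReal.coe_ne_top (hyC z))
    rw [hy, hF, ENNReal.toReal_sum fun z _ => hne z]
    simp only [ENNReal.toReal_mul, ENNReal.toReal_ofReal (h0 θ _)]

end Mixture

section Continuity

variable {ι : Type*} [Fintype ι] [DecidableEq ι] {X Y : ι → Type*} [∀ i, Fintype (X i)]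
  [∀ i, Nonempty (X i)] [∀ i, MeasurableSpace (X i)] [∀ i, StandardBorelSpace (X i)]
  [∀ i, MeasurableSpace (Y i)]

/-- For finite input alphabets, the mutual informations depend continuously on the input laws. -/
theorem continuous_userInfo (W : Kernel (∀ i, X i) (∀ i, Y i)) [IsMarkovKernel W] {Θ : Type*}
    [TopologicalSpace Θ] [FirstCountableTopology Θ] {p : Θ → ∀ i, ProbabilityMeasure (X i)}
    (hp : ∀ i x, Continuous fun θ => (p θ i : Measure (X i)).real {x}) (i : ι) :
    Continuous fun θ => userInfo W (p θ) i := by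
  have hm : Measurable fun y : ∀ i, Y i => y i := measurable_pi_apply i
  set V := W.map fun y => y i with hV
  have hVm : IsMarkovKernel V := Kernel.IsMarkovKernel.map W hm
  -- The output law under uniform inputs dominates every conditional output law, with the number of
  -- input tuples as constant.
  set m := V ∘ₘ unif (∀ j, X j) with hmdef
  have hle : ∀ z, V z ≤ (Fintype.card (∀ j, X j) : ℝ≥0) • m := by
    intro z
    refine Measure.le_iff.2 fun s hs => ?_
    rw [Measure.smul_apply, hmdef, Measure.bind_apply hs (Kernel.aemeasurable _), lintegral_unif,
      ENNReal.smul_def, smul_eq_mul, ENNReal.coe_natCast, ← mul_assoc,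
      ENNReal.mul_inv_cancel (Nat.cast_ne_zero.2 Fintype.card_ne_zero) (ENNReal.natCast_ne_top _),
      one_mul]
    exact Finset.single_le_sum (f := fun z => V z s) (fun _ _ => zero_le) (Finset.mem_univ z)
  set c : Θ → (∀ j, X j) → ℝ := fun θ z =>
    (Measure.pi fun j => (p θ j : Measure (X j))).real {z} with hc
  have hcc : ∀ z, Continuous fun θ => c θ z := by
    intro z
    have : (fun θ => c θ z) = fun θ => ∏ j, (p θ j : Measure (X j)).real {z j} := by
      funext θ
      rw [hc]
      simp only [Measure.real, Measure.pi_singleton, ENNReal.toReal_prod]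
    rw [this]
    exact continuous_finsetProd _ fun j _ => hp j (z j)
  have hc0 : ∀ θ z, 0 ≤ c θ z := fun θ z => measureReal_nonneg
  have hc1 : ∀ θ z, c θ z ≤ 1 := fun θ z => measureReal_le_one
  have hcof : ∀ θ z, ENNReal.ofReal (c θ z) =
      (Measure.pi fun j => (p θ j : Measure (X j))) {z} := fun θ z => ofReal_measureReal
  have htin : ∀ θ a, tin W (fun j => (p θ j : Measure (X j))) i a =
      ∑ z, ENNReal.ofReal (c θ z) • V (Function.update z i a) := by
    intro θ a
    ext s hs
    rw [tin_apply W _ i a hs, lintegral_fintype, Measure.finsetSum_apply]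
    refine Finset.sum_congr rfl fun z _ => ?_
    rw [Measure.smul_apply, smul_eq_mul, hcof, hV, Kernel.map_apply' _ hm _ hs, mul_comm]
  have hout : ∀ θ, tin W (fun j => (p θ j : Measure (X j))) i ∘ₘ (p θ i : Measure (X i)) =
      ∑ z, ENNReal.ofReal (c θ z) • V z := by
    intro θ
    ext s hs
    rw [Measure.bind_apply hs (Kernel.aemeasurable _), Measure.finsetSum_apply]
    have h1 : ∀ a, tin W (fun j => (p θ j : Measure (X j))) i a s =
        ∫⁻ z, V (Function.update z i a) s ∂(Measure.pi fun j => (p θ j : Measure (X j))) := by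
      intro a
      rw [tin_apply W _ i a hs]
      refine lintegral_congr fun z => ?_
      rw [hV, Kernel.map_apply' _ hm _ hs]
    simp only [h1]
    rw [← lintegral_pi_update (fun j => (p θ j : Measure (X j))) i (Kernel.measurable_coe V hs),
      lintegral_fintype]
    refine Finset.sum_congr rfl fun z _ => ?_
    rw [Measure.smul_apply, smul_eq_mul, hcof, mul_comm]
  obtain ⟨K, hKc, hK⟩ := exists_continuous_klDiv_mixture (fun z => V z) m hle hcc hc0 hc1
  have hex := fun a : X i => exists_continuous_klDiv_mixture
    (fun z => V (Function.update z i a)) m (fun z => hle _) hcc hc0 hc1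
  choose L hLc hL using hex
  -- By the compensation identity, the mutual information is the divergence of the joint law from
  -- the product with `m`, minus that of the output law from `m`. Both are finite and continuous in
  -- the weights.
  have hformula : ∀ θ, userInfo W (p θ) i = ENNReal.ofReal
      (∑ a, L a θ * (p θ i : Measure (X i)).real {a} - K θ) := by
    intro θ
    have h := klDiv_compProd_prod (p θ i : Measure (X i))
      (tin W (fun j => (p θ j : Measure (X j))) i) m
    have h2 : klDiv ((p θ i : Measure (X i)) ⊗ₘ tin W (fun j => (p θ j : Measure (X j))) i)
        ((p θ i : Measure (X i)).prod m) =
        ENNReal.ofReal (∑ a, L a θ * (p θ i : Measure (X i)).real {a}) := by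
      rw [← Measure.compProd_const, klDiv_compProd_eq_lintegral, lintegral_fintype,
        ENNReal.ofReal_sum_of_nonneg fun a _ => mul_nonneg (hL a θ).1 measureReal_nonneg]
      refine Finset.sum_congr rfl fun a _ => ?_
      rw [Kernel.const_apply, htin, (hL a θ).2, ENNReal.ofReal_mul (hL a θ).1, ofReal_measureReal]
    rw [h2, hout, (hK θ).2, ← userInfo_eq] at h
    rw [ENNReal.ofReal_sub _ (hK θ).1]
    exact ENNReal.eq_sub_of_add_eq ENNReal.ofReal_ne_top h.symm
  simp only [hformula]
  exact ENNReal.continuous_ofReal.comp ((continuous_finsetSum _ fun a _ =>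
    (hLc a).mul (hp i a)).sub hKc)

/-- The law on a finite type with given probabilities. -/
def simplexLaw {A : Type*} [Fintype A] [MeasurableSpace A] (θ : stdSimplex ℝ A) :
    ProbabilityMeasure A :=
  ⟨∑ a, ENNReal.ofReal (θ.1 a) • Measure.dirac a, ⟨by
    rw [Measure.finsetSum_apply]
    simp only [Measure.smul_apply, measure_univ, smul_eq_mul, mul_one]
    rw [← ENNReal.ofReal_sum_of_nonneg fun a _ => θ.2.1 a, θ.2.2, ENNReal.ofReal_one]⟩⟩

theorem simplexLaw_singleton {A : Type*} [Fintype A] [MeasurableSpace A]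
    [MeasurableSingletonClass A] (θ : stdSimplex ℝ A) (x : A) :
    (simplexLaw θ : Measure A) {x} = ENNReal.ofReal (θ.1 x) := by
  classical
  change (∑ a, ENNReal.ofReal (θ.1 a) • Measure.dirac a : Measure A) {x} = _
  rw [Measure.finsetSum_apply]
  simp [Set.indicator_apply]

theorem exists_simplexLaw_eq {A : Type*} [Fintype A] [MeasurableSpace A]
    [MeasurableSingletonClass A] (p : ProbabilityMeasure A) :
    ∃ θ : stdSimplex ℝ A, simplexLaw θ = p := by
  have h : (fun x => (p : Measure A).real {x}) ∈ stdSimplex ℝ A := by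
    refine ⟨fun x => measureReal_nonneg, ?_⟩
    rw [sum_measureReal_singleton]
    simp
  refine ⟨⟨_, h⟩, Subtype.ext (Measure.ext_of_singleton fun x => ?_)⟩
  exact (simplexLaw_singleton _ x).trans ofReal_measureReal

end Continuity

/-- For finite input alphabets, some input laws maximize the sum of the mutual informations. -/
theorem exists_sum_userInfo_eq_iSup {ι : Type*} [Fintype ι] [DecidableEq ι] {κ : Type*} [Fintype κ]
    {X Y : ι → κ → Type*} [∀ i k, Finite (X i k)] [∀ i k, Nonempty (X i k)]
    [∀ i k, MeasurableSpace (X i k)] [∀ i k, StandardBorelSpace (X i k)]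
    [∀ i k, MeasurableSpace (Y i k)]
    (W : ∀ k, Kernel (∀ i, X i k) (∀ i, Y i k)) [∀ k, IsMarkovKernel (W k)] :
    ∃ p : ∀ i k, ProbabilityMeasure (X i k),
      ⨆ p : ∀ i k, ProbabilityMeasure (X i k), ∑ k, ∑ i, userInfo (W k) (fun j => p j k) i =
        ∑ k, ∑ i, userInfo (W k) (fun j => p j k) i := by
  classical
  have : ∀ i k, Fintype (X i k) := fun i k => Fintype.ofFinite _
  have hne : ∀ i k, Nonempty (stdSimplex ℝ (X i k)) := fun i k =>
    ⟨⟨_, single_mem_stdSimplex ℝ (Classical.arbitrary (X i k))⟩⟩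
  have hcont : Continuous fun θ : ∀ i k, stdSimplex ℝ (X i k) =>
      ∑ k, ∑ i, userInfo (W k) (fun j => simplexLaw (θ j k)) i := by
    have hx : ∀ j k x, Continuous fun θ : ∀ i k, stdSimplex ℝ (X i k) =>
        (simplexLaw (θ j k) : Measure (X j k)).real {x} := by
      intro j k x
      have h : (fun θ : ∀ i k, stdSimplex ℝ (X i k) =>
          (simplexLaw (θ j k) : Measure (X j k)).real {x}) = fun θ => (θ j k).1 x := by
        funext θ
        rw [Measure.real, simplexLaw_singleton, ENNReal.toReal_ofReal ((θ j k).2.1 x)]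
      rw [h]
      have h1 : Continuous fun θ : ∀ i k, stdSimplex ℝ (X i k) => θ j k :=
        (continuous_apply k).comp (continuous_apply j)
      exact (continuous_apply x).comp (continuous_subtype_val.comp h1)
    refine continuous_finsetSum _ fun k _ => continuous_finsetSum _ fun i _ => ?_
    exact continuous_userInfo (X := fun j => X j k) (Y := fun j => Y j k) (W k)
      (p := fun (θ : ∀ i k, stdSimplex ℝ (X i k)) j => simplexLaw (θ j k)) (fun j x => hx j k x) i
  have : ∀ i k, CompactSpace (stdSimplex ℝ (X i k)) := fun i k =>
    isCompact_iff_compactSpace.1 (isCompact_stdSimplex ℝ (X i k))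
  obtain ⟨θ, -, hθ⟩ := isCompact_univ.exists_isMaxOn Set.univ_nonempty hcont.continuousOn
  refine ⟨fun i k => simplexLaw (θ i k), le_antisymm (iSup_le fun p => ?_)
    (le_iSup (fun p : ∀ i k, ProbabilityMeasure (X i k) =>
      ∑ k, ∑ i, userInfo (W k) (fun j => p j k) i) _)⟩
  choose η hη using fun i k => exists_simplexLaw_eq (p i k)
  have h : (fun i k => simplexLaw (η i k)) = p := funext fun i => funext fun k => hη i k
  rw [← h]
  exact hθ (Set.mem_univ η)

end ParallelIC

end

-- The separability theorem

theorem mainTheorem3 {m F : ℕ} {X Y : Fin (m + 1) → Fin F → Type*} {V : Fin F → Type*}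
    [∀ i k, MeasurableSpace (X i k)] [∀ i k, StandardBorelSpace (X i k)] [∀ i k, Nonempty (X i k)]
    [∀ i k, MeasurableSpace (Y i k)] [∀ i k, StandardBorelSpace (Y i k)]
    [∀ k, MeasurableSpace (V k)] [∀ k, StandardBorelSpace (V k)]
    (C : ∀ k, ManyToOne (fun i => X i k) (fun i => Y i k) (V k))
    (hC : ∀ k, (C k).Degraded) (Q : CostConstraint X) :
    -- the sum-capacity under the constraint
    sumCapacity (fun k => (C k).kernel) Q =
      (⨆ (N : ℕ) (p : Fin (N + 1) → ∀ i k, ProbabilityMeasure (X i k)) (_ : Q.Feasible p),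
        ∑ k, ∑ i, carrierInfo (fun k => (C k).kernel) p i k) ∧
    -- separate random coding with interference treated as noise is reliable on every carrier at
    -- all rates below the mutual information
    (∀ (N : ℕ) (p : Fin (N + 1) → ∀ i k, ProbabilityMeasure (X i k)) (r : Fin (m + 1) → Fin F → ℝ≥0),
      (∀ i k, r i k = 0 ∨ (r i k : ℝ≥0∞) < carrierInfo (fun k => (C k).kernel) p i k) →
      ReliableTIN (fun k => (C k).kernel) p r) ∧
    -- and it achieves the sum-capacity
    (∀ R < sumCapacity (fun k => (C k).kernel) Q,
      ∃ (N : ℕ) (p : Fin (N + 1) → ∀ i k, ProbabilityMeasure (X i k))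
        (r : Fin (m + 1) → Fin F → ℝ≥0),
        Q.Feasible p ∧ R < ((∑ k, ∑ i, r i k : ℝ≥0) : ℝ≥0∞) ∧
        ReliableTIN (fun k => (C k).kernel) p r ∧ MeetsConstraint Q p r) ∧
    -- vector inputs are not better than inputs with the same marginals that are independent
    -- across carriers
    (∀ q : ∀ i, ProbabilityMeasure (∀ k, X i k),
      ∑ i, userInfo (parallel fun k => (C k).kernel) q i ≤
        ∑ k, ∑ i, userInfo (C k).kernel (fun j => carrierMarginal (q j) k) i) ∧
    -- without a constraint, one input law for each user and each carrier is enough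
    ((∀ i, Q.region i = Set.univ) →
      sumCapacity (fun k => (C k).kernel) Q =
        (⨆ p : ∀ i k, ProbabilityMeasure (X i k),
          ∑ k, ∑ i, userInfo (C k).kernel (fun j => p j k) i) ∧
      (∀ R < sumCapacity (fun k => (C k).kernel) Q,
        ∃ (p : ∀ i k, ProbabilityMeasure (X i k)) (r : Fin (m + 1) → Fin F → ℝ≥0),
          R < ((∑ k, ∑ i, r i k : ℝ≥0) : ℝ≥0∞) ∧
          ReliableTIN (fun k => (C k).kernel) (N := 0) (fun _ => p) r) ∧
      -- and for finite input alphabets the maximum is attained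
      ((∀ i k, Finite (X i k)) →
        ∃ p : ∀ i k, ProbabilityMeasure (X i k),
          sumCapacity (fun k => (C k).kernel) Q =
            ∑ k, ∑ i, userInfo (C k).kernel (fun j => p j k) i)) := by
  have hcap : sumCapacity (fun k => (C k).kernel) Q =
      ⨆ (N : ℕ) (p : Fin (N + 1) → ∀ i k, ProbabilityMeasure (X i k)) (_ : Q.Feasible p),
        ∑ k, ∑ i, carrierInfo (fun k => (C k).kernel) p i k :=
    le_antisymm (sumCapacity_le C hC Q) (iSup_le fun _ => iSup_le fun _ => iSup_le fun hp =>
      le_sumCapacity (fun k => (C k).kernel) Q hp)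
  refine ⟨hcap, fun N p r h => reliableTIN (fun k => (C k).kernel) p r h, fun R hR => ?_,
    ManyToOne.sum_userInfo_parallel_le C hC, fun hQ => ?_⟩
  · rw [hcap] at hR
    obtain ⟨N, hR⟩ := lt_iSup_iff.1 hR
    obtain ⟨p, hR⟩ := lt_iSup_iff.1 hR
    obtain ⟨hp, hR⟩ := lt_iSup_iff.1 hR
    obtain ⟨N', p', r, hp', hr, hrel, hmeets, -⟩ :=
      exists_achievable_separate (fun k => (C k).kernel) Q hp hR
    exact ⟨N', p', r, hp', hr, hrel, hmeets⟩
  have hsup : sumCapacity (fun k => (C k).kernel) Q = ⨆ p : ∀ i k, ProbabilityMeasure (X i k),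
      ∑ k, ∑ i, userInfo (C k).kernel (fun j => p j k) i := by
    refine le_antisymm ?_ (iSup_le fun p => ?_)
    · rw [hcap]
      exact iSup_le fun N => iSup_le fun p => iSup_le fun _ =>
        sum_carrierInfo_le (fun k => (C k).kernel) p
    · have h := le_sumCapacity (fun k => (C k).kernel) Q (N := 0) (p := fun _ => p) fun i => by
        rw [hQ i]
        trivial
      simpa only [carrierInfo_const] using h
  refine ⟨hsup, fun R hR => ?_, fun _ => ?_⟩
  · rw [hsup] at hR
    obtain ⟨p, hR⟩ := lt_iSup_iff.1 hR
    rw [← Fintype.sum_prod_type' (f := fun k i => userInfo (C k).kernel (fun j => p j k) i)] at hR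
    -- Only reliability is asked for here, so `p` is used in a single slot, with neither an added
    -- cheap slot nor dyadic rates.
    obtain ⟨r, hr, hRr⟩ := exists_lt_sum hR
    refine ⟨p, fun i k => r (k, i), ?_, reliableTIN (fun k => (C k).kernel) _ _ fun i k => ?_⟩
    · rwa [← Fintype.sum_prod_type' (f := fun k i => r (k, i))]
    · rw [carrierInfo_const]
      exact hr (k, i)
  · obtain ⟨p, hp⟩ := exists_sum_userInfo_eq_iSup fun k => (C k).kernel
    exact ⟨p, hsup.trans hp⟩
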